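/- Let $N\ge 2$ be an integer, $0<s<1$, $p>2$ with $ps<N$, and let $\Omega\subset\mathbb R^N$ be a bounded domain (open and connected) containing the origin. Let $$\Lambda_{N,p,s}=\int_0^1\sigma^{ps-1}\bigl|1-\sigma^{\frac{N-ps}{p}}\bigr|^pK(\sigma)\,d\sigma,\qquad K(\sigma)=\int_{|y'|=1}\frac{dH^{N-1}(y')}{|x'-\sigma y'|^{N+ps}}\quad(|x'|=1)$$ be the fractional Hardy constant, and for $w,v:\mathbb R^N\to\mathbb R$ put $$\langle(-\Delta)^s_pw,v\rangle=\frac12\iint_{D_\Omega}\frac{|w(x)-w(y)|^{p-2}(w(x)-w(y))(v(x)-v(y))}{|x-y|^{N+ps}}\,dx\,dy,\qquad D_\Omega=(\mathbb R^N\times\mathbb R^N)\setminus(\Omega^c\times\Omega^c).$$ Let $W^{s,p}_0(\Omega)$ be the closure of $C_c^\infty(\Omega)$ with respect to $\|v\|_{L^p}+\bigl(\iint_{D_\Omega}\frac{|v(x)-v(y)|^p}{|x-y|^{N+ps}}dx\,dy\bigr)^{1/p}$ (functions extended by $0$ outside $\Omega$). For $T>0$, write $\Omega_T=\Omega\times(0,T)$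 and $p'=p/(p-1)$. Given $f\in L^{p'}(\Omega_T)$ and $g\in L^2(\Omega)$, an energy solution of $$v_t+(-\Delta)^s_pv=f\ \text{in }\Omega_T,\qquad v=0\ \text{in }(\mathbb R^N\setminus\Omega)\times(0,T),\qquad v(\cdot,0)=g\ \text{in }\Omega$$ is a function $v\in L^p(0,T;W^{s,p}_0(\Omega))\cap C([0,T];L^2(\Omega))$ such that $v(\cdot,t)\to g$ in $L^2(\Omega)$ as $t\to0^+$ and $$-\iint_{\Omega_T}v\,\varphi_t\,dx\,dt+\int_0^T\langle(-\Delta)^s_pv(\cdot,t),\varphi(\cdot,t)\rangle\,dt=\iint_{\Omega_T}f\varphi\,dx\,dt\qquad\text{for all }\varphi\in C_c^\infty(\Omega_T).$$ Let $\lambda>\Lambda_{N,p,s}$ and let $u_0\in L^1(\Omega)$ satisfy $u_0\ge0$ a.e. and $u_0\not\equiv0$. Consider the problem $$u_t+(-\Delta)^s_pu=\lambda\frac{u^{p-1}}{|x|^{ps}}\ \text{in }\Omega_T,\qquad u\ge0\ \text{in }\mathbb R^N\times(0,T),\qquad u=0\ \text{in }(\mathbb R^N\setminus\Omega)\times(0,T),\qquad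 u(\cdot,0)=u_0\ \text{in }\Omega.\tag{P}$$ A solution obtained as limit of approximations (SOLA) of (P) is a function $u:\mathbb R^N\times(0,T)\to\mathbb R$, with $u\ge 0$ a.e. and $u=0$ a.e. outside $\Omega$, for which there are nonnegative $f_n\in L^{p'}(\Omega_T)$, nonnegative $u_{0n}\in L^2(\Omega)$ and nonnegative energy solutions $u_n$ with data $(f_n,u_{0n})$ such that $u_{0n}\to u_0$ in $L^1(\Omega)$ and, a.e. in $\Omega_T$, $u_n\to u$ and $f_n\to\lambda u^{p-1}/|x|^{ps}$. (This includes, for instance, $f_n=\lambda\min\{n,|x|^{-ps}\}u_n^{p-1}$ and, along a subsequence, every case with $f_n\to \lambda u^{p-1}/|x|^{ps}$ in $L^1(\Omega_T)$.) Then for every $T>0$ problem (P) has no SOLA. -/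

import Mathlib

open MeasureTheory Filter Topology Set
open scoped ENNReal ContDiff

noncomputable section

namespace FracHardy

/-- The Euclidean space `ℝ^N`. -/
abbrev E (N : ℕ) : Type := EuclideanSpace ℝ (Fin N)

/-- A fixed unit vector of `ℝ^N` (by rotation invariance, the choice does not matter below). -/
def unitVec {N : ℕ} (hN : 1 < N) : E N :=
  EuclideanSpace.single (⟨0, Nat.lt_trans Nat.zero_lt_one hN⟩ : Fin N) (1 : ℝ)

/-- `K(σ) = ∫_{|y'| = 1} dH^{N-1}(y') / |x' - σ y'|^{N + ps}` with `|x'| = 1`;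
`volume.toSphere` is the surface measure of the unit sphere. -/
def sphereKernel {N : ℕ} (hN : 1 < N) (p s σ : ℝ) : ℝ :=
  ∫ y : Metric.sphere (0 : E N) 1,
    1 / ‖unitVec hN - σ • (y : E N)‖ ^ ((N : ℝ) + p * s)
    ∂((volume : Measure (E N)).toSphere)

/-- The fractional Hardy constant
`Λ_{N,p,s} = ∫_0^1 σ^{ps-1} |1 - σ^{(N-ps)/p}|^p K(σ) dσ`. -/
def hardyConstant {N : ℕ} (hN : 1 < N) (p s : ℝ) : ℝ :=
  ∫ σ in Ioo (0 : ℝ) 1,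
    σ ^ (p * s - 1) * |1 - σ ^ (((N : ℝ) - p * s) / p)| ^ p * sphereKernel hN p s σ

/-- `D_Ω = (ℝ^N × ℝ^N) \ (Ωᶜ × Ωᶜ)`. -/
def crossDomain {N : ℕ} (Ω : Set (E N)) : Set (E N × E N) :=
  (Ωᶜ ×ˢ Ωᶜ)ᶜ

/-- The `p`-th power of the Gagliardo seminorm,
`∬_{D_Ω} |v(x) - v(y)|^p / |x - y|^{N+ps} dx dy`. -/
def gagliardo {N : ℕ} (p s : ℝ) (Ω : Set (E N)) (v : E N → ℝ) : ℝ≥0∞ :=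
  ∫⁻ z in crossDomain Ω,
    ENNReal.ofReal (|v z.1 - v z.2| ^ p / ‖z.1 - z.2‖ ^ ((N : ℝ) + p * s))

/-- The pairing `⟨(-Δ)^s_p w, v⟩
= (1/2) ∬_{D_Ω} |w(x)-w(y)|^{p-2} (w(x)-w(y)) (v(x)-v(y)) / |x-y|^{N+ps} dx dy`. -/
def fracPairing {N : ℕ} (p s : ℝ) (Ω : Set (E N)) (w v : E N → ℝ) : ℝ :=
  (1 / 2) * ∫ z in crossDomain Ω,
    |w z.1 - w z.2| ^ (p - 2) * (w z.1 - w z.2) * (v z.1 - v z.2)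
      / ‖z.1 - z.2‖ ^ ((N : ℝ) + p * s)

/-- Membership in `W^{s,p}_0(Ω)`: the functions on `ℝ^N`, vanishing a.e. outside `Ω`, that lie in
the closure of `C_c^∞(Ω)` for the `L^p` norm together with the Gagliardo seminorm over `D_Ω`. -/
def MemW0 {N : ℕ} (p s : ℝ) (Ω : Set (E N)) (v : E N → ℝ) : Prop :=
  MemLp v (ENNReal.ofReal p) volume ∧
  (∀ᵐ x ∂(volume : Measure (E N)), x ∉ Ω → v x = 0) ∧
  ∃ φ : ℕ → E N → ℝ,
    (∀ k, ContDiff ℝ ∞ (φ k) ∧ HasCompactSupport (φ k) ∧ tsupport (φ k) ⊆ Ω) ∧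
    Tendsto (fun k => eLpNorm (fun x => φ k x - v x) (ENNReal.ofReal p) volume) atTop (𝓝 0) ∧
    Tendsto (fun k => gagliardo p s Ω (fun x => φ k x - v x)) atTop (𝓝 0)

/-- `u` (written `u t x`) is an energy solution in `Ω × (0,T)` of
`u_t + (-Δ)^s_p u = f`, `u = 0` outside `Ω`, `u(·,0) = u₀`.

Since `v ↦ ∬ f v - ∫ ⟨(-Δ)^s_p u, v⟩ dt` is a bounded linear functional on `L^p(0,T; W^{s,p}_0(Ω))`
when `u` lies in that space and `f ∈ L^{p'}(Ω × (0,T))`, the last field says exactly that the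
distributional derivative `u_t` belongs to the dual space `L^{p'}(0,T; W^{-s,p'}(Ω))` and that
`∫ ⟨u_t, v⟩ dt + ∫ ⟨(-Δ)^s_p u, v⟩ dt = ∬ f v` for all `v` in `L^p(0,T; W^{s,p}_0(Ω))`. -/
structure IsEnergySolution {N : ℕ} (p s T : ℝ) (Ω : Set (E N)) (f : ℝ → E N → ℝ)
    (u₀ : E N → ℝ) (u : ℝ → E N → ℝ) : Prop where
  memLp : MemLp (fun z : ℝ × E N => u z.1 z.2) (ENNReal.ofReal p)
    (volume.restrict (Ioo 0 T ×ˢ (univ : Set (E N))))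
  memW0 : ∀ᵐ t ∂(volume.restrict (Ioo 0 T)), MemW0 p s Ω (u t)
  energy : ∫⁻ t in Ioo 0 T, gagliardo p s Ω (u t) < ⊤
  memL2 : ∀ t ∈ Icc 0 T, MemLp (u t) 2 (volume.restrict Ω)
  continuous_L2 : ∀ t₀ ∈ Icc 0 T,
    Tendsto (fun t => eLpNorm (fun x => u t x - u t₀ x) 2 (volume.restrict Ω))
      (𝓝[Icc 0 T] t₀) (𝓝 0)
  initial : Tendsto (fun t => eLpNorm (fun x => u t x - u₀ x) 2 (volume.restrict Ω))
    (𝓝[>] 0) (𝓝 0)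
  weak : ∀ φ : ℝ × E N → ℝ, ContDiff ℝ ∞ φ → HasCompactSupport φ →
    tsupport φ ⊆ Ioo 0 T ×ˢ Ω →
    (-(∫ t in Ioo 0 T, ∫ x in Ω, u t x * deriv (fun τ => φ (τ, x)) t)) +
      (∫ t in Ioo 0 T, fracPairing p s Ω (u t) (fun x => φ (t, x)))
      = ∫ t in Ioo 0 T, ∫ x in Ω, f t x * φ (t, x)

/-- `u` is a (nonnegative) solution obtained as limit of approximations (SOLA) in `Ω × (0,T)` of
`u_t + (-Δ)^s_p u = lam * u^{p-1} / |x|^{ps}`, `u ≥ 0`, `u = 0` outside `Ω`, `u(·,0) = u₀`: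
it is the a.e. limit of nonnegative energy solutions of problems whose nonnegative right-hand sides
converge to `lam * u^{p-1} / |x|^{ps}` and whose nonnegative initial data converge to `u₀` in `L^1`.

Of the right-hand sides only a.e. convergence is required. Hence limits of the problems with
right-hand side `lam * min {n, |x|^{-ps}} * u_n^{p-1}`, or `lam * u_{n-1}^{p-1} / (|x|^{ps} + 1/n)`,
and (along a subsequence) limits of problems whose right-hand sides converge in `L^1(Ω × (0,T))`
are all included. -/
structure IsSOLA {N : ℕ} (p s lam T : ℝ) (Ω : Set (E N)) (u₀ : E N → ℝ)
    (u : ℝ → E N → ℝ) : Prop where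
  nonneg : ∀ᵐ z ∂(volume.restrict (Ioo 0 T ×ˢ (univ : Set (E N)))), 0 ≤ u z.1 z.2
  zero_outside : ∀ᵐ z ∂(volume.restrict (Ioo 0 T ×ˢ Ωᶜ)), u z.1 z.2 = 0
  approx : ∃ (f : ℕ → ℝ → E N → ℝ) (g : ℕ → E N → ℝ) (v : ℕ → ℝ → E N → ℝ),
    (∀ n, MemLp (fun z : ℝ × E N => f n z.1 z.2) (ENNReal.ofReal (p / (p - 1)))
      (volume.restrict (Ioo 0 T ×ˢ Ω))) ∧
    (∀ n, ∀ᵐ z ∂(volume.restrict (Ioo 0 T ×ˢ Ω)), 0 ≤ f n z.1 z.2) ∧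
    (∀ n, MemLp (g n) 2 (volume.restrict Ω)) ∧
    (∀ n, ∀ᵐ x ∂(volume.restrict Ω), 0 ≤ g n x) ∧
    (∀ n, IsEnergySolution p s T Ω (f n) (g n) (v n)) ∧
    (∀ n, ∀ᵐ z ∂(volume.restrict (Ioo 0 T ×ˢ (univ : Set (E N)))), 0 ≤ v n z.1 z.2) ∧
    Tendsto (fun n => eLpNorm (fun x => g n x - u₀ x) 1 (volume.restrict Ω)) atTop (𝓝 0) ∧
    (∀ᵐ z ∂(volume.restrict (Ioo 0 T ×ˢ Ω)),
      Tendsto (fun n => v n z.1 z.2) atTop (𝓝 (u z.1 z.2))) ∧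
    (∀ᵐ z ∂(volume.restrict (Ioo 0 T ×ˢ Ω)),
      Tendsto (fun n => f n z.1 z.2) atTop
        (𝓝 (lam * u z.1 z.2 ^ (p - 1) / ‖z.2‖ ^ (p * s))))

end FracHardy

end

namespace FracHardy

/-! The argument plays a weighted inequality forced by the equation against the optimality of the
Hardy constant `Λ`.

Let `v` be an approximating solution with source `f`. Test its equation with `η(t) ψ(x)^p (ε +
v)^(1-p)`. The discrete Picone inequality (`picone`) bounds the nonlocal term by `½ [ψ]^p ∫ η`,
where `[ψ]` is the Gagliardo seminorm, while the source contributes `∬ η ψ^p f / (ε + v)^(p-1)`.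
Since `f` tends to `λ u^(p-1) / |x|^(ps)`, the limit formally yields `λ ∫ ψ^p / |x|^(ps) ≤ ½ [ψ]^p +
C ∫ ψ^p` for every Lipschitz `ψ ≥ 0` supported near the origin (`exists_hardy_inequality`). No such
inequality can hold when `λ > Λ`: the truncations of `|x|^(-(N-ps)/p)` to `δ < |x| < r` have `½
[ψ]^p ≤ Λ L + O(1)`, `∫ ψ^p / |x|^(ps) ≥ L - O(1)` and `∫ ψ^p = O(1)`, where `L = ∫ |x|^(-N)` over
the annulus diverges as `δ → 0` (`exists_hardy_quotient_lt`).

Two obstacles stand in the way, both caused by small values of `v`. Because `p > 2`, the time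
derivative produces `(p-2)⁻¹ ∬ η' ψ^p (ε + v)^(2-p)`, which is not bounded uniformly in `ε`.
Moreover, where `u = 0` the quotient `f / (ε + v)^(p-1)` has no evident lower limit. Nonlocality
cures both. Picone's inequality has a remainder (`picone_remainder`): if `F` is disjoint from the
support of `ψ` and `∫_F v^(p-1) ≥ m > 0`, the left side gains a positive multiple of `∬ η ψ^p (ε +
v)^(1-p)` (`RegSol.energy_inequality`). With `η = θ^k`, half of this gain absorbs the time term up
to a constant independent of `ε` (`absorption`); the other half replaces `f` by `f + c` with `c >
0`, so that the integrand tends to `+∞` where `u = 0` and Fatou's lemma applies with a.e.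
convergence only (`le_liminf_shiftedPow`).

The lower mass bound comes from the datum (`exists_uniform_mass`). With `ε = 1` and a cutoff
supported away from the origin on which `u₀` is visible, the same test shows that `∫ ψ^p (1 +
v(t))^(2-p)` increases at most linearly in `t` (`IsEnergySolution.mass_inequality`). It therefore
stays below `∫ ψ^p` for a short time, uniformly along the sequence, which prevents `v` from being
too small on `F`.

Energy solutions have no pointwise time derivative, so the nonlinear test is justified by
integrating the equation over `(t - δ, t)` against a test function frozen at time `t`, using
concavity of the primitive of `(ε + r)^(1-p)`, and letting `δ → 0` (`RegSol.integral_deriv_mul_le`).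
-/

theorem nontrivial_E {N : ℕ} (hN : 1 < N) : Nontrivial (E N) := by
  have : Nonempty (Fin N) := ⟨⟨0, by omega⟩⟩
  infer_instance

/-! ### Integrability of powers of the norm -/

theorem integrableOn_norm_rpow_ball {N : ℕ} (hN : 1 < N) {α R : ℝ} (hR : 0 < R)
    (hα : -(N : ℝ) < α) :
    IntegrableOn (fun x : E N => ‖x‖ ^ α) (Metric.ball 0 R) volume := by
  have := nontrivial_E hN
  rw [integrableOn_fun_norm_addHaar volume (f := fun y : ℝ => y ^ α)]
  have h : IntegrableOn (fun y : ℝ => y ^ (((N - 1 : ℕ) : ℝ) + α)) (Ioo 0 R) := by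
    rw [intervalIntegral.integrableOn_Ioo_rpow_iff hR]
    have : ((N - 1 : ℕ) : ℝ) = N - 1 := by push_cast [Nat.cast_sub hN.le]; ring
    rw [this]; linarith
  refine h.congr_fun (fun y hy => ?_) measurableSet_Ioo
  simp only [finrank_euclideanSpace, Fintype.card_fin, smul_eq_mul]
  rw [Real.rpow_add hy.1, Real.rpow_natCast]

theorem integrableOn_norm_rpow_compl_ball {N : ℕ} (hN : 1 < N) {α R : ℝ} (hR : 0 < R)
    (hα : α < -(N : ℝ)) :
    IntegrableOn (fun x : E N => ‖x‖ ^ α) (Metric.ball 0 R)ᶜ volume := by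
  have := nontrivial_E hN
  have h : IntegrableOn (fun y : ℝ => y ^ (((N - 1 : ℕ) : ℝ) + α)) (Ioi (R / 2)) := by
    rw [integrableOn_Ioi_rpow_iff (by positivity)]
    have : ((N - 1 : ℕ) : ℝ) = N - 1 := by push_cast [Nat.cast_sub hN.le]; ring
    rw [this]; linarith
  have h2 : Integrable (fun x : E N => (Ici R).indicator (fun y : ℝ => y ^ α) ‖x‖) volume := by
    rw [integrable_fun_norm_addHaar volume (f := (Ici R).indicator (fun y : ℝ => y ^ α))]
    have h3 : IntegrableOn ((Ici R).indicator (fun y : ℝ => y ^ (((N - 1 : ℕ) : ℝ) + α)))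
        (Ioi 0) := by
      rw [IntegrableOn, integrable_indicator_iff measurableSet_Ici, IntegrableOn,
        Measure.restrict_restrict measurableSet_Ici]
      exact h.mono_set fun x hx => by
        have : R ≤ x := hx.1
        show R / 2 < x
        linarith
    refine h3.congr_fun (fun y hy => ?_) measurableSet_Ioi
    simp only [finrank_euclideanSpace, Fintype.card_fin, smul_eq_mul, indicator]
    split_ifs
    · rw [Real.rpow_add hy, Real.rpow_natCast]
    · simp
  rw [← integrable_indicator_iff Metric.isOpen_ball.measurableSet.compl]
  refine h2.congr (.of_forall fun x => ?_)
  simp [indicator]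

theorem lintegral_norm_rpow_ball_lt_top {N : ℕ} (hN : 1 < N) {α R : ℝ} (hα : -(N : ℝ) < α) :
    ∫⁻ x in Metric.ball (0 : E N) R, ENNReal.ofReal (‖x‖ ^ α) < ⊤ := by
  have h := integrableOn_norm_rpow_ball hN (R := max R 1) (by positivity) hα
  refine lt_of_le_of_lt (lintegral_mono_set (Metric.ball_subset_ball (le_max_left R 1))) ?_
  exact h.lintegral_lt_top

theorem lintegral_norm_rpow_compl_ball_lt_top {N : ℕ} (hN : 1 < N) {α R : ℝ} (hR : 0 < R)
    (hα : α < -(N : ℝ)) :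
    ∫⁻ x in (Metric.ball (0 : E N) R)ᶜ, ENNReal.ofReal (‖x‖ ^ α) < ⊤ :=
  (integrableOn_norm_rpow_compl_ball hN hR hα).lintegral_lt_top

/-- The annulus `δ < ‖x‖ < r`. -/
def annulus (N : ℕ) (δ r : ℝ) : Set (E N) := {x | δ < ‖x‖ ∧ ‖x‖ < r}

theorem measurableSet_annulus {N : ℕ} (δ r : ℝ) : MeasurableSet (annulus N δ r) :=
  (measurableSet_lt measurable_const measurable_norm).inter
    (measurableSet_lt measurable_norm measurable_const)

theorem lintegral_annulus_lt_top {N : ℕ} {δ r : ℝ} (hδ : 0 < δ) (α : ℝ) :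
    ∫⁻ x in annulus N δ r, ENNReal.ofReal (‖x‖ ^ α) < ⊤ := by
  have hb : ∀ x ∈ annulus N δ r, ENNReal.ofReal (‖x‖ ^ α) ≤
      ENNReal.ofReal (max (δ ^ α) (r ^ α)) := by
    intro x hx
    have hx0 : 0 < ‖x‖ := hδ.trans hx.1
    apply ENNReal.ofReal_le_ofReal
    rcases le_total 0 α with h | h
    · exact le_max_of_le_right (Real.rpow_le_rpow hx0.le hx.2.le h)
    · exact le_max_of_le_left (Real.rpow_le_rpow_of_nonpos hδ hx.1.le h)
  refine (setLIntegral_mono measurable_const hb).trans_lt ?_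
  rw [setLIntegral_const]
  refine ENNReal.mul_lt_top ENNReal.ofReal_lt_top ?_
  refine lt_of_le_of_lt (measure_mono fun x hx => ?_) (measure_ball_lt_top (x := (0 : E N)) (r := r))
  simpa using hx.2

/-- The divergence that decides the contradiction: the power `-N` just fails to be integrable at the
origin. If all these integrals stayed below `M`, monotone convergence along the inner radii `r / (n
+ 2)` (the shift keeps them below `r`) would make `ρ⁻¹` integrable on `(0, r)`. -/
theorem exists_annulus_le {N : ℕ} (hN : 1 < N) {r : ℝ} (hr : 0 < r) (M : ℝ≥0∞) (hM : M < ⊤) :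
    ∃ δ, 0 < δ ∧ δ < r ∧ M ≤ ∫⁻ x in annulus N δ r, ENNReal.ofReal (‖x‖ ^ (-(N : ℝ))) := by
  have := nontrivial_E hN
  by_contra! hcon
  have hun : (⋃ n : ℕ, annulus N (r / (n + 2)) r) = Metric.ball 0 r \ {0} := by
    ext x
    simp only [annulus, mem_iUnion, mem_ofPred_eq, Set.mem_sdiff, Metric.mem_ball, dist_zero_right,
      mem_singleton_iff]
    constructor
    · rintro ⟨n, h1, h2⟩
      refine ⟨h2, fun h => ?_⟩
      rw [h, norm_zero] at h1
      have : 0 < r / ((n : ℝ) + 2) := by positivity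
      linarith
    · rintro ⟨h1, h2⟩
      have hx : 0 < ‖x‖ := norm_pos_iff.2 h2
      obtain ⟨n, hn⟩ := exists_nat_gt (r / ‖x‖)
      refine ⟨n, ?_, h1⟩
      rw [div_lt_iff₀ hx] at hn
      rw [div_lt_iff₀ (by positivity)]
      nlinarith
  have hmono : Monotone fun n : ℕ => annulus N (r / (n + 2)) r := by
    intro n m hnm x hx
    refine ⟨lt_of_le_of_lt ?_ hx.1, hx.2⟩
    have : (n : ℝ) ≤ m := by exact_mod_cast hnm
    gcongr
  have hle : ∫⁻ x in Metric.ball (0 : E N) r, ENNReal.ofReal (‖x‖ ^ (-(N : ℝ))) ≤ M := by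
    have h0 : (Metric.ball (0 : E N) r \ {0} : Set (E N)) =ᵐ[volume] Metric.ball 0 r :=
      sdiff_null_ae_eq_self (measure_singleton _)
    rw [← setLIntegral_congr h0, ← hun, setLIntegral_iUnion_of_directed _ hmono.directed_le]
    refine iSup_le fun n => (hcon _ (by positivity) ?_).le
    rw [div_lt_iff₀ (by positivity)]
    have : (0 : ℝ) ≤ n := by positivity
    nlinarith
  have hint : IntegrableOn (fun x : E N => ‖x‖ ^ (-(N : ℝ))) (Metric.ball 0 r) := by
    refine ⟨by measurability, ?_⟩
    rw [hasFiniteIntegral_iff_ofReal (.of_forall fun x => by positivity)]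
    exact hle.trans_lt hM
  rw [integrableOn_fun_norm_addHaar volume (f := fun y : ℝ => y ^ (-(N : ℝ)))] at hint
  have h2 : IntegrableOn (fun y : ℝ => y ^ (-1 : ℝ)) (Ioo 0 r) := by
    refine hint.congr_fun (fun y hy => ?_) measurableSet_Ioo
    simp only [finrank_euclideanSpace, Fintype.card_fin, smul_eq_mul]
    rw [← Real.rpow_natCast, ← Real.rpow_add hy.1]
    congr 1
    push_cast [Nat.cast_sub hN.le]; ring
  rw [intervalIntegral.integrableOn_Ioo_rpow_iff hr] at h2
  linarith

/-! ### Rotations, dilations and polar coordinates -/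

theorem exists_isometry_unitVec {N : ℕ} (hN : 1 < N) {x : E N} (hx : ‖x‖ = 1) :
    ∃ R : E N ≃ₗᵢ[ℝ] E N, R (unitVec hN) = x := by
  have h : ‖unitVec hN‖ = ‖x‖ := by rw [hx]; simp [unitVec]
  exact ⟨_, Submodule.reflection_sub h⟩

theorem norm_unitVec {N : ℕ} (hN : 1 < N) : ‖unitVec hN‖ = 1 := by simp [unitVec]

theorem lintegral_eq_lintegral_smul {N : ℕ} {ρ : ℝ} (hρ : 0 < ρ) (F : E N → ℝ≥0∞) :
    ∫⁻ y, F y = ENNReal.ofReal (ρ ^ (N : ℝ)) * ∫⁻ y, F (ρ • y) := by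
  have h := Measure.map_addHaar_smul (volume : Measure (E N)) hρ.ne'
  have h2 : ∫⁻ y, F (ρ • y) = ∫⁻ y, F y ∂(Measure.map (fun x : E N => ρ • x) volume) :=
    ((Homeomorph.smulOfNeZero ρ hρ.ne').measurableEmbedding.lintegral_map F).symm
  rw [h2, h, lintegral_smul_measure, smul_eq_mul, ← mul_assoc]
  simp only [finrank_euclideanSpace, Fintype.card_fin]
  rw [abs_of_pos (by positivity), ← ENNReal.ofReal_mul (by positivity), Real.rpow_natCast,
    mul_inv_cancel₀ (by positivity)]
  simp

theorem lintegral_polar {N : ℕ} (hN : 1 < N) {F : E N → ℝ≥0∞} (hF : Measurable F) :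
    ∫⁻ y, F y = ∫⁻ σ in Ioi (0 : ℝ), ENNReal.ofReal (σ ^ ((N : ℝ) - 1)) *
      ∫⁻ θ : Metric.sphere (0 : E N) 1, F (σ • (θ : E N)) ∂((volume : Measure (E N)).toSphere) := by
  have := nontrivial_E hN
  have h1 : ∫⁻ y, F y = ∫⁻ y : ({0}ᶜ : Set (E N)), F y
      ∂(Measure.comap Subtype.val (volume : Measure (E N))) := by
    rw [lintegral_subtype_comap (measurableSet_singleton _).compl, restrict_compl_singleton]
  have hmp := (volume : Measure (E N)).measurePreserving_homeomorphUnitSphereProd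
  have h2 : ∫⁻ y : ({0}ᶜ : Set (E N)), F y ∂(Measure.comap Subtype.val (volume : Measure (E N)))
      = ∫⁻ z, F (z.2.1 • (z.1 : E N)) ∂((volume : Measure (E N)).toSphere.prod
        (Measure.volumeIoiPow (Module.finrank ℝ (E N) - 1))) := by
    rw [← hmp.lintegral_comp_emb (Homeomorph.measurableEmbedding _)]
    refine lintegral_congr fun y => ?_
    congr 1
    have hy : ‖(y : E N)‖ ≠ 0 := norm_ne_zero_iff.2 y.2
    simp [homeomorphUnitSphereProd, hy]
  have hm : Measurable fun z : Metric.sphere (0 : E N) 1 × Ioi (0 : ℝ) =>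
      F (z.2.1 • (z.1 : E N)) := by
    apply hF.comp; fun_prop
  rw [h1, h2, lintegral_prod_symm _ hm.aemeasurable, Measure.volumeIoiPow,
    lintegral_withDensity_eq_lintegral_mul _ (by fun_prop) hm.lintegral_prod_left']
  simp only [finrank_euclideanSpace, Fintype.card_fin, Pi.mul_apply]
  rw [← lintegral_subtype_comap measurableSet_Ioi]
  refine lintegral_congr fun σ => ?_
  congr 2
  rw [← Real.rpow_natCast]
  congr 1
  push_cast [Nat.cast_sub hN.le]; ring

/-- Mean value inequality; on `[δ, ∞)` the derivative is largest in modulus at `δ`. -/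
theorem abs_rpow_neg_sub_rpow_neg_le {b δ : ℝ} (hb : 0 ≤ b) (hδ : 0 < δ) {x y : ℝ} (hx : δ ≤ x)
    (hy : δ ≤ y) : |x ^ (-b) - y ^ (-b)| ≤ b * δ ^ (-b - 1) * |x - y| := by
  have hd : ∀ z ∈ Ici δ, HasDerivWithinAt (fun z : ℝ => z ^ (-b)) (-b * z ^ (-b - 1)) (Ici δ) z :=
    fun z hz => (Real.hasDerivAt_rpow_const (.inl (hδ.trans_le hz).ne')).hasDerivWithinAt
  have hbd : ∀ z ∈ Ici δ, ‖-b * z ^ (-b - 1)‖ ≤ b * δ ^ (-b - 1) := by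
    intro z hz
    have hz0 : 0 < z := hδ.trans_le hz
    rw [norm_mul, norm_neg, Real.norm_of_nonneg hb, Real.norm_of_nonneg (by positivity)]
    exact mul_le_mul_of_nonneg_left (Real.rpow_le_rpow_of_nonpos hδ hz (by linarith)) hb
  simpa using (convex_Ici δ).norm_image_sub_le_of_norm_hasDerivWithin_le hd hbd hy hx

/-- The factor `2` gained by folding onto `‖y‖ < ‖x‖` cancels the `1/2` of the pairing; this is why
`Λ` only involves `σ < 1`. -/
theorem lintegral_lintegral_eq_two_mul_of_symm {N : ℕ} {F : E N → E N → ℝ≥0∞}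
    (hF : Measurable (Function.uncurry F)) (hsymm : ∀ x y, F x y = F y x)
    (hdiag : ∀ x y, ‖x‖ = ‖y‖ → F x y = 0) :
    ∫⁻ x, ∫⁻ y, F x y = 2 * ∫⁻ x, ∫⁻ y in Metric.ball 0 ‖x‖, F x y := by
  have hms : MeasurableSet {z : E N × E N | ‖z.2‖ < ‖z.1‖} :=
    measurableSet_lt (by fun_prop) (by fun_prop)
  set F1 : E N → E N → ℝ≥0∞ := fun x y => (Metric.ball (0 : E N) ‖x‖).indicator (F x) y with hF1
  have hF1m : Measurable (Function.uncurry F1) := by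
    have : Function.uncurry F1 =
        {z : E N × E N | ‖z.2‖ < ‖z.1‖}.indicator (Function.uncurry F) := by
      ext ⟨x, y⟩
      simp [hF1, Function.uncurry, indicator]
    rw [this]
    exact hF.indicator hms
  have hdec : ∀ x y, F x y = F1 x y + F1 y x := by
    intro x y
    simp only [hF1, indicator, Metric.mem_ball, dist_zero_right]
    rcases lt_trichotomy ‖x‖ ‖y‖ with h | h | h
    · simp [h, h.not_gt, hsymm x y]
    · simp [h, hdiag x y h]
    · simp [h, h.not_gt]
  have h1 : ∀ x, ∫⁻ y in Metric.ball 0 ‖x‖, F x y = ∫⁻ y, F1 x y := fun x =>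
    (lintegral_indicator Metric.isOpen_ball.measurableSet _).symm
  simp_rw [h1]
  calc ∫⁻ x, ∫⁻ y, F x y = ∫⁻ x, ((∫⁻ y, F1 x y) + ∫⁻ y, F1 y x) := by
        refine lintegral_congr fun x => ?_
        rw [← lintegral_add_left (hF1m.of_uncurry_left)]
        exact lintegral_congr fun y => hdec x y
    _ = (∫⁻ x, ∫⁻ y, F1 x y) + ∫⁻ x, ∫⁻ y, F1 y x :=
        lintegral_add_left hF1m.lintegral_prod_right' _
    _ = 2 * ∫⁻ x, ∫⁻ y, F1 x y := by
        rw [two_mul, lintegral_lintegral_swap (f := fun x y => F1 y x)]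
        exact (hF1m.comp measurable_swap).aemeasurable

/-- Substitute `y = ‖x‖ • R y'`, with `R` an isometry taking the fixed unit vector to `x / ‖x‖`. The
volume gives `‖x‖ ^ N` and the kernel `‖x‖ ^ (-N - ps)`, so for radial functions the dependence on
the direction of `x` disappears. -/
theorem lintegral_ball_norm_eq {N : ℕ} (hN : 1 < N) (p s : ℝ) (g : ℝ → ℝ) {x : E N}
    (hx : x ≠ 0) :
    ∫⁻ y in Metric.ball 0 ‖x‖,
        ENNReal.ofReal (|g ‖x‖ - g ‖y‖| ^ p / ‖x - y‖ ^ ((N : ℝ) + p * s)) =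
      ENNReal.ofReal (‖x‖ ^ (-(p * s))) * ∫⁻ y in Metric.ball 0 1,
        ENNReal.ofReal (|g ‖x‖ - g (‖x‖ * ‖y‖)| ^ p /
          ‖unitVec hN - y‖ ^ ((N : ℝ) + p * s)) := by
  have hρ : 0 < ‖x‖ := norm_pos_iff.2 hx
  set ρ := ‖x‖ with hρdef
  obtain ⟨R, hR⟩ := exists_isometry_unitVec hN (x := ρ⁻¹ • x)
    (by rw [norm_smul, norm_inv, norm_norm, inv_mul_cancel₀ hρ.ne'])
  have hxR : x = ρ • R (unitVec hN) := by rw [hR, smul_smul, mul_inv_cancel₀ hρ.ne', one_smul]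
  rw [← lintegral_indicator Metric.isOpen_ball.measurableSet,
    ← lintegral_indicator Metric.isOpen_ball.measurableSet,
    lintegral_eq_lintegral_smul hρ, ← R.measurePreserving.lintegral_comp_emb
      R.toHomeomorph.measurableEmbedding,
    ← lintegral_const_mul' _ _ ENNReal.ofReal_ne_top,
    ← lintegral_const_mul' _ _ ENNReal.ofReal_ne_top]
  refine lintegral_congr fun y => ?_
  have hn : ‖ρ • R y‖ = ρ * ‖y‖ := by
    rw [norm_smul, R.norm_map, Real.norm_of_nonneg hρ.le]
  simp only [indicator, Metric.mem_ball, dist_zero_right, hn]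
  by_cases hy : ‖y‖ < 1
  · have h1 : ρ * ‖y‖ < ρ := by nlinarith
    simp only [h1, hy, if_true]
    have h2 : ‖x - ρ • R y‖ = ρ * ‖unitVec hN - y‖ := by
      rw [hxR, ← smul_sub, ← map_sub, norm_smul, R.norm_map, Real.norm_of_nonneg hρ.le]
    rw [h2, ← ENNReal.ofReal_mul (by positivity), ← ENNReal.ofReal_mul (by positivity)]
    congr 1
    rw [Real.mul_rpow hρ.le (norm_nonneg _), Real.rpow_add hρ, Real.rpow_neg hρ.le]
    have := (Real.rpow_pos_of_pos hρ (N : ℝ)).ne'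
    field_simp
  · have h1 : ¬ ρ * ‖y‖ < ρ := by
      push Not at hy ⊢; nlinarith
    simp [h1, hy]

/-! ### The Hardy constant as an integral over the unit ball -/

section Constant

variable {N : ℕ} (hN : 1 < N) {p s : ℝ}

theorem one_sub_norm_le {y : E N} : 1 - ‖y‖ ≤ ‖unitVec hN - y‖ := by
  have := norm_sub_norm_le (unitVec hN) y
  rwa [norm_unitVec] at this

/-- The weighted Hardy kernel is integrable on the unit ball. -/
theorem lintegral_hardyKernel_lt_top (hp : 2 < p) (hs0 : 0 < s) (hs1 : s < 1)
    (hps : p * s < (N : ℝ)) {β : ℝ} (hβ0 : 0 ≤ β) (hβ : β < p * s) :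
    ∫⁻ y in Metric.ball (0 : E N) 1, ENNReal.ofReal (‖y‖ ^ (-β) *
      (|‖y‖ ^ (-(((N : ℝ) - p * s) / p)) - 1| ^ p / ‖unitVec hN - y‖ ^ ((N : ℝ) + p * s))) < ⊤ := by
  set a := ((N : ℝ) - p * s) / p with ha
  have ha0 : 0 < a := div_pos (by linarith) (by linarith)
  have hap : a * p = N - p * s := by rw [ha]; field_simp
  have hps0 : 0 < p * s := by positivity
  obtain ⟨C, hC0, hC⟩ : ∃ C : ℝ, 0 ≤ C ∧ ∀ τ : ℝ, 1 / 2 ≤ τ → τ < 1 → τ ^ (-a) - 1 ≤ C * (1 - τ) := by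
    refine ⟨a * (1 / 2) ^ (-a - 1), by positivity, fun τ h1 h2 => ?_⟩
    have h := abs_rpow_neg_sub_rpow_neg_le ha0.le (δ := 1 / 2) (by norm_num) h1
      (y := 1) (by norm_num)
    rw [Real.one_rpow, abs_sub_comm τ, abs_of_pos (by linarith : 0 < 1 - τ)] at h
    exact (le_abs_self _).trans h
  set c1 : ℝ := 2 ^ ((N : ℝ) + p * s)
  have hle : ∀ y ∈ Metric.ball (0 : E N) 1, y ≠ 0 → ENNReal.ofReal (‖y‖ ^ (-β) *
      (|‖y‖ ^ (-a) - 1| ^ p / ‖unitVec hN - y‖ ^ ((N : ℝ) + p * s))) ≤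
      ENNReal.ofReal c1 * ENNReal.ofReal (‖y‖ ^ (-β - (N - p * s))) +
      ENNReal.ofReal (2 ^ β * C ^ p) *
        ENNReal.ofReal (‖unitVec hN - y‖ ^ (p - ((N : ℝ) + p * s))) := by
    intro y hy hy0
    have hy0 : 0 < ‖y‖ := norm_pos_iff.2 hy0
    have hy1 : ‖y‖ < 1 := by simpa using hy
    have h1 := one_sub_norm_le hN (y := y)
    have hd : 0 < ‖unitVec hN - y‖ := by linarith
    have hya : 1 ≤ ‖y‖ ^ (-a) :=
      Real.one_le_rpow_of_pos_of_le_one_of_nonpos hy0 hy1.le (by linarith)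
    rw [abs_of_nonneg (by linarith), ← ENNReal.ofReal_mul (by positivity),
      ← ENNReal.ofReal_mul (by positivity), ← ENNReal.ofReal_add (by positivity) (by positivity)]
    apply ENNReal.ofReal_le_ofReal
    -- For `‖y‖ < 1/2` the kernel is bounded and the singularity `‖y‖ ^ (-β - (N - ps))` is
    -- integrable because `β < ps`. For `‖y‖ ≥ 1/2` the numerator vanishes to first order at the
    -- sphere, and what remains is the power `p - N - ps` of the distance to the unit vector,
    -- integrable because `s < 1`.
    rcases lt_or_ge ‖y‖ (1 / 2) with hh | hh
    · refine le_add_of_le_of_nonneg ?_ (by positivity)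
      have e1 : (‖y‖ ^ (-a) - 1) ^ p ≤ ‖y‖ ^ (-(N - p * s)) := by
        rw [← hap, ← neg_mul, Real.rpow_mul hy0.le]
        exact Real.rpow_le_rpow (by linarith) (by linarith) (by linarith)
      have e2 : (‖unitVec hN - y‖ ^ ((N : ℝ) + p * s))⁻¹ ≤ c1 := by
        rw [← Real.inv_rpow hd.le]
        refine Real.rpow_le_rpow (by positivity) ?_ (by positivity)
        rw [inv_le_comm₀ hd (by norm_num)]; linarith
      rw [sub_eq_add_neg (-β), Real.rpow_add hy0, div_eq_mul_inv]
      calc _ ≤ ‖y‖ ^ (-β) * (‖y‖ ^ (-((N : ℝ) - p * s)) * c1) := by gcongr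
        _ = _ := by ring
    · refine le_add_of_nonneg_of_le (by positivity) ?_
      have e1 : (‖y‖ ^ (-a) - 1) ^ p ≤ C ^ p * ‖unitVec hN - y‖ ^ p := by
        rw [← Real.mul_rpow hC0 hd.le]
        refine Real.rpow_le_rpow (by linarith) ((hC _ hh hy1).trans ?_) (by linarith)
        gcongr
      have e2 : ‖y‖ ^ (-β) ≤ 2 ^ β := by
        rw [Real.rpow_neg hy0.le, ← Real.inv_rpow hy0.le]
        refine Real.rpow_le_rpow (by positivity) ?_ hβ0
        rw [inv_le_comm₀ hy0 (by norm_num)]; linarith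
      rw [Real.rpow_sub hd]
      calc _ ≤ 2 ^ β * (C ^ p * ‖unitVec hN - y‖ ^ p / ‖unitVec hN - y‖ ^ ((N : ℝ) + p * s)) := by
            gcongr
        _ = _ := by ring
  have hae : ∀ᵐ y ∂(volume.restrict (Metric.ball (0 : E N) 1)), y ∈ Metric.ball (0 : E N) 1 ∧ y ≠ 0 := by
    have := nontrivial_E hN
    filter_upwards [ae_restrict_mem Metric.isOpen_ball.measurableSet,
      ae_restrict_of_ae (Measure.ae_ne volume (0 : E N))] with y h1 h2 using ⟨h1, h2⟩
  refine (lintegral_mono_ae (hae.mono fun y hy => hle y hy.1 hy.2)).trans_lt ?_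
  rw [lintegral_add_left (by fun_prop), lintegral_const_mul' _ _ ENNReal.ofReal_ne_top,
    lintegral_const_mul' _ _ ENNReal.ofReal_ne_top]
  refine ENNReal.add_lt_top.2 ⟨ENNReal.mul_lt_top ENNReal.ofReal_lt_top ?_,
    ENNReal.mul_lt_top ENNReal.ofReal_lt_top ?_⟩
  · exact lintegral_norm_rpow_ball_lt_top hN (by linarith)
  · have hsub : (Metric.ball (0 : E N) 1) ⊆ (fun y => unitVec hN - y) ⁻¹' (Metric.ball 0 2) := by
      intro y hy
      simp only [mem_preimage, Metric.mem_ball, dist_zero_right] at hy ⊢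
      have := norm_sub_le (unitVec hN) y
      rw [norm_unitVec] at this
      linarith
    refine (lintegral_mono_set hsub).trans_lt ?_
    have hmp := Measure.measurePreserving_sub_left (volume : Measure (E N)) (unitVec hN)
    rw [hmp.setLIntegral_comp_preimage Metric.isOpen_ball.measurableSet
      (f := fun y => ENNReal.ofReal (‖y‖ ^ (p - ((N : ℝ) + p * s)))) (by fun_prop)]
    refine lintegral_norm_rpow_ball_lt_top hN ?_
    nlinarith

/-- The Hardy constant as an integral over the unit ball. -/
theorem lintegral_hardyKernel_eq (hp : 2 < p) (hs0 : 0 < s) (hs1 : s < 1)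
    (hps : p * s < (N : ℝ)) :
    ∫⁻ y in Metric.ball (0 : E N) 1, ENNReal.ofReal
      (|‖y‖ ^ (-(((N : ℝ) - p * s) / p)) - 1| ^ p / ‖unitVec hN - y‖ ^ ((N : ℝ) + p * s)) =
      ENNReal.ofReal (hardyConstant hN p s) := by
  have hfin := lintegral_hardyKernel_lt_top hN hp hs0 hs1 hps le_rfl (by positivity)
  simp only [neg_zero, Real.rpow_zero, one_mul] at hfin
  set a := ((N : ℝ) - p * s) / p with ha
  have hap : a * p = N - p * s := by rw [ha]; field_simp
  set f : ℝ → ℝ := fun σ => σ ^ (p * s - 1) * |1 - σ ^ a| ^ p * sphereKernel hN p s σ with hf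
  have hK0 : ∀ σ, 0 ≤ sphereKernel hN p s σ := fun σ => integral_nonneg fun y => by positivity
  have hKm : StronglyMeasurable (sphereKernel hN p s) := by
    unfold sphereKernel
    refine StronglyMeasurable.integral_prod_right (f := fun (σ : ℝ)
      (y : Metric.sphere (0 : E N) 1) => 1 / ‖unitVec hN - σ • (y : E N)‖ ^ ((N : ℝ) + p * s)) ?_
    apply Measurable.stronglyMeasurable
    unfold Function.uncurry
    fun_prop
  have hKl : ∀ σ ∈ Ioo (0 : ℝ) 1, ENNReal.ofReal (sphereKernel hN p s σ) =
      ∫⁻ θ : Metric.sphere (0 : E N) 1, ENNReal.ofReal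
        (1 / ‖unitVec hN - σ • (θ : E N)‖ ^ ((N : ℝ) + p * s))
        ∂((volume : Measure (E N)).toSphere) := by
    intro σ hσ
    have hd : ∀ θ : Metric.sphere (0 : E N) 1, 1 - σ ≤ ‖unitVec hN - σ • (θ : E N)‖ := by
      intro θ
      have := one_sub_norm_le hN (y := σ • (θ : E N))
      rwa [norm_smul, Real.norm_of_nonneg hσ.1.le, norm_eq_of_mem_sphere θ, mul_one] at this
    have h1 : 0 < 1 - σ := by linarith [hσ.2]
    rw [sphereKernel, ofReal_integral_eq_lintegral_ofReal _ (.of_forall fun y => by positivity)]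
    refine Integrable.of_bound (C := 1 / (1 - σ) ^ ((N : ℝ) + p * s)) ?_ (.of_forall fun θ => ?_)
    · apply Measurable.aestronglyMeasurable; fun_prop
    · rw [Real.norm_of_nonneg (by positivity)]
      gcongr
      exact hd θ
  have key : ∫⁻ y in Metric.ball (0 : E N) 1, ENNReal.ofReal
      (|‖y‖ ^ (-a) - 1| ^ p / ‖unitVec hN - y‖ ^ ((N : ℝ) + p * s)) =
      ∫⁻ σ in Ioo (0 : ℝ) 1, ENNReal.ofReal (f σ) := by
    rw [← lintegral_indicator Metric.isOpen_ball.measurableSet, lintegral_polar hN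
      (Measurable.indicator (by fun_prop) Metric.isOpen_ball.measurableSet)]
    have hI : Ioo (0 : ℝ) 1 = Iio 1 ∩ Ioi 0 := by rw [Set.inter_comm]; rfl
    rw [hI, ← Measure.restrict_restrict measurableSet_Iio, ← lintegral_indicator measurableSet_Iio]
    refine setLIntegral_congr_fun measurableSet_Ioi fun σ hσ => ?_
    have hσ0 : (0 : ℝ) < σ := hσ
    have hn : ∀ θ : Metric.sphere (0 : E N) 1, ‖σ • (θ : E N)‖ = σ := fun θ => by
      rw [norm_smul, Real.norm_of_nonneg hσ0.le, norm_eq_of_mem_sphere θ, mul_one]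
    by_cases h1 : σ < 1
    · simp only [indicator, Metric.mem_ball, dist_zero_right, hn, h1, if_true, mem_Iio]
      rw [hf]
      simp only
      rw [ENNReal.ofReal_mul (by positivity), hKl σ ⟨hσ0, h1⟩,
        ← lintegral_const_mul' _ _ ENNReal.ofReal_ne_top,
        ← lintegral_const_mul' _ _ ENNReal.ofReal_ne_top]
      refine lintegral_congr fun θ => ?_
      rw [← ENNReal.ofReal_mul (by positivity), ← ENNReal.ofReal_mul (by positivity)]
      congr 1
      -- Pulling `σ ^ (-a)` out of the difference costs `σ ^ (-(N - ps))`, which turns the polar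
      -- weight `σ ^ (N - 1)` into the weight `σ ^ (ps - 1)` of `Λ`.
      have e1 : |σ ^ (-a) - 1| ^ p = σ ^ (-(N - p * s)) * |1 - σ ^ a| ^ p := by
        have : σ ^ (-a) - 1 = σ ^ (-a) * (1 - σ ^ a) := by
          rw [mul_sub, ← Real.rpow_add hσ0]; simp
        rw [this, abs_mul, Real.mul_rpow (abs_nonneg _) (abs_nonneg _),
          abs_of_nonneg (by positivity), ← Real.rpow_mul hσ0.le, neg_mul, hap]
      have e2 : σ ^ (p * s - 1) = σ ^ ((N : ℝ) - 1) * σ ^ (-(N - p * s)) := by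
        rw [← Real.rpow_add hσ0]; congr 1; ring
      rw [e1, e2]; ring
    · simp only [indicator, Metric.mem_ball, dist_zero_right, hn, h1, if_false, mem_Iio,
        lintegral_zero, mul_zero]
  rw [key] at hfin ⊢
  rw [hardyConstant, ofReal_integral_eq_lintegral_ofReal]
  · refine ⟨?_, ?_⟩
    · apply Measurable.aestronglyMeasurable
      have := hKm.measurable
      fun_prop
    · rw [hasFiniteIntegral_iff_ofReal]
      · exact hfin
      · filter_upwards [ae_restrict_mem measurableSet_Ioo] with σ hσ
        have := hK0 σ
        have := hσ.1
        positivity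
  · filter_upwards [ae_restrict_mem measurableSet_Ioo] with σ hσ
    have := hK0 σ
    have := hσ.1
    simp only [Pi.zero_apply]
    positivity

end Constant

/-- The profile `ρ ↦ ρ^{-a}`, truncated to `[δ, r]` and shifted so as to vanish beyond `r`. -/
noncomputable def hardyProfile (a δ r ρ : ℝ) : ℝ := (max δ (min ρ r)) ^ (-a) - r ^ (-a)

set_option linter.unusedSectionVars false

/-! ### The truncated power profile -/

section Profile

variable {a δ r : ℝ} (ha : 0 < a) (hδ : 0 < δ) (hδr : δ < r)
include ha hδ hδr

theorem hardyProfile_nonneg (ρ : ℝ) : 0 ≤ hardyProfile a δ r ρ := by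
  rw [hardyProfile, sub_nonneg]
  refine Real.rpow_le_rpow_of_nonpos (lt_max_of_lt_left hδ) ?_ (by linarith)
  exact max_le hδr.le (min_le_right _ _)

theorem hardyProfile_of_ge {ρ : ℝ} (h : r ≤ ρ) : hardyProfile a δ r ρ = 0 := by
  rw [hardyProfile, min_eq_right h, max_eq_right hδr.le, sub_self]

theorem hardyProfile_of_le {ρ : ℝ} (h : ρ ≤ δ) : hardyProfile a δ r ρ = δ ^ (-a) - r ^ (-a) := by
  rw [hardyProfile, max_eq_left ((min_le_left _ _).trans h)]

theorem hardyProfile_of_mem {ρ : ℝ} (h1 : δ ≤ ρ) (h2 : ρ ≤ r) :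
    hardyProfile a δ r ρ = ρ ^ (-a) - r ^ (-a) := by
  rw [hardyProfile, min_eq_left h2, max_eq_right h1]

theorem hardyProfile_antitone : Antitone (hardyProfile a δ r) := by
  intro x y hxy
  simp only [hardyProfile]
  refine sub_le_sub_right (Real.rpow_le_rpow_of_nonpos (lt_max_of_lt_left hδ) ?_ (by linarith)) _
  gcongr

theorem hardyProfile_le {ρ : ℝ} (hρ : 0 < ρ) : hardyProfile a δ r ρ ≤ ρ ^ (-a) := by
  rcases le_or_gt ρ r with h | h
  · rw [hardyProfile, min_eq_left h]
    have h1 : (max δ ρ) ^ (-a) ≤ ρ ^ (-a) :=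
      Real.rpow_le_rpow_of_nonpos hρ (le_max_right _ _) (by linarith)
    have : 0 ≤ r ^ (-a) := by have := hδ.trans hδr; positivity
    linarith
  · rw [hardyProfile_of_ge ha hδ hδr h.le]; positivity

/-- Clamping the radius to `[δ, r]` can only reduce the drop of the power between two radii. Hence
the energy density of the profile is dominated pointwise by that of the homogeneous function, with
no error on the annulus. -/
theorem hardyProfile_sub_le {ρ τ : ℝ} (hτ : 0 < τ) (h : τ ≤ ρ) :
    hardyProfile a δ r τ - hardyProfile a δ r ρ ≤ τ ^ (-a) - ρ ^ (-a) := by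
  have hr := hδ.trans hδr
  have mono : ∀ {x y : ℝ}, 0 < x → x ≤ y → y ^ (-a) ≤ x ^ (-a) := fun hx hxy =>
    Real.rpow_le_rpow_of_nonpos hx hxy (by linarith)
  simp only [hardyProfile]
  have hρ := hτ.trans_le h
  rcases le_total ρ δ with h1 | h1
  · have e1 : max δ (min ρ r) = δ := max_eq_left ((min_le_left _ _).trans h1)
    have e2 : max δ (min τ r) = δ := max_eq_left ((min_le_left _ _).trans (h.trans h1))
    rw [e1, e2]
    linarith [mono hτ h]
  rcases le_total r τ with h2 | h2
  · rw [min_eq_right h2, min_eq_right (h2.trans h)]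
    linarith [mono hτ h]
  rw [min_eq_left h2]
  have k1 : (max δ τ) ^ (-a) ≤ τ ^ (-a) := mono hτ (le_max_right _ _)
  have k2 : ρ ^ (-a) ≤ (max δ (min ρ r)) ^ (-a) :=
    mono (lt_max_of_lt_left hδ) (max_le h1 (min_le_left _ _))
  linarith

theorem exists_lipschitzWith_hardyProfile_norm (N : ℕ) :
    ∃ K, LipschitzWith K fun x : E N => hardyProfile a δ r ‖x‖ := by
  refine ⟨Real.toNNReal (a * δ ^ (-a - 1)), LipschitzWith.of_dist_le_mul fun x y => ?_⟩
  have hC : 0 ≤ a * δ ^ (-a - 1) := by positivity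
  rw [Real.coe_toNNReal _ hC, Real.dist_eq, hardyProfile, hardyProfile, sub_sub_sub_cancel_right]
  refine (abs_rpow_neg_sub_rpow_neg_le ha.le hδ (le_max_left _ _) (le_max_left _ _)).trans ?_
  refine mul_le_mul_of_nonneg_left ?_ hC
  calc |max δ (min ‖x‖ r) - max δ (min ‖y‖ r)| ≤ |min ‖x‖ r - min ‖y‖ r| := by
        have := abs_max_sub_max_le_max δ (min ‖x‖ r) δ (min ‖y‖ r)
        simpa using this
    _ ≤ |‖x‖ - ‖y‖| := by
        have := abs_min_sub_min_le_max ‖x‖ r ‖y‖ r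
        simpa using this
    _ ≤ dist x y := by rw [dist_eq_norm]; exact abs_norm_sub_norm_le x y

end Profile

/-! ### Energy, Hardy integral and `L^p` norm of the profile -/

section Energy

variable {N : ℕ} (hN : 1 < N) {p s : ℝ} (hp : 2 < p) (hs0 : 0 < s) (hs1 : s < 1)
  (hps : p * s < (N : ℝ)) {a : ℝ} (ha : a = ((N : ℝ) - p * s) / p)
include hp hs0 hps ha

/-- Contribution of `‖y‖ < ‖x‖` to the energy of the profile, for `x` in the annulus. -/
theorem lintegral_hardyProfile_annulus_le (hs1 : s < 1) {δ r : ℝ} (hδ : 0 < δ) (hδr : δ < r)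
    {x : E N} (hx : x ≠ 0) :
    ∫⁻ y in Metric.ball 0 ‖x‖, ENNReal.ofReal
      (|hardyProfile a δ r ‖x‖ - hardyProfile a δ r ‖y‖| ^ p / ‖x - y‖ ^ ((N : ℝ) + p * s)) ≤
    ENNReal.ofReal (‖x‖ ^ (-(N : ℝ))) * ENNReal.ofReal (hardyConstant hN p s) := by
  have ha0 : 0 < a := by rw [ha]; exact div_pos (by linarith) (by linarith)
  have hap : a * p = N - p * s := by rw [ha]; field_simp
  have hx0 := norm_pos_iff.2 hx
  have := nontrivial_E hN
  rw [lintegral_ball_norm_eq hN p s _ hx, ← lintegral_hardyKernel_eq hN hp hs0 hs1 hps, ← ha,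
    ← lintegral_const_mul' _ _ ENNReal.ofReal_ne_top,
    ← lintegral_const_mul' _ _ ENNReal.ofReal_ne_top]
  refine lintegral_mono_ae ?_
  filter_upwards [ae_restrict_mem Metric.isOpen_ball.measurableSet,
      ae_restrict_of_ae (Measure.ae_ne volume (0 : E N))] with y h1 h2
  have hy1 : ‖y‖ < 1 := by simpa using h1
  have hy0 := norm_pos_iff.2 h2
  rw [← ENNReal.ofReal_mul (by positivity), ← ENNReal.ofReal_mul (by positivity)]
  apply ENNReal.ofReal_le_ofReal
  have hle : ‖x‖ * ‖y‖ ≤ ‖x‖ := by nlinarith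
  have hb := hardyProfile_sub_le ha0 hδ hδr (mul_pos hx0 hy0) hle
  have hm := hardyProfile_antitone ha0 hδ hδr hle
  have e1 : |hardyProfile a δ r ‖x‖ - hardyProfile a δ r (‖x‖ * ‖y‖)| ≤
      ‖x‖ ^ (-a) * |‖y‖ ^ (-a) - 1| := by
    rw [abs_sub_comm, abs_of_nonneg (by linarith)]
    refine hb.trans (le_trans (le_of_eq ?_) (mul_le_mul_of_nonneg_left (le_abs_self _)
      (by positivity)))
    rw [Real.mul_rpow hx0.le hy0.le]; ring
  -- The exponent `a` is critical: `-ps - a p = -N`.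
  have e2 : ‖x‖ ^ (-(N : ℝ)) = ‖x‖ ^ (-(p * s)) * (‖x‖ ^ (-a)) ^ p := by
    rw [← Real.rpow_mul hx0.le, ← Real.rpow_add hx0, neg_mul, hap]; congr 1; ring
  have e3 := Real.rpow_le_rpow (abs_nonneg _) e1 (by linarith : 0 ≤ p)
  rw [Real.mul_rpow (by positivity) (abs_nonneg _)] at e3
  rw [e2, mul_assoc (‖x‖ ^ (-(p * s))), ← mul_div_assoc ((‖x‖ ^ (-a)) ^ p)]
  gcongr

theorem lintegral_hardyProfile_ball {δ r : ℝ} (hδ : 0 < δ) (hδr : δ < r)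
    {x : E N} (hx : ‖x‖ ≤ δ) :
    ∫⁻ y in Metric.ball 0 ‖x‖, ENNReal.ofReal
      (|hardyProfile a δ r ‖x‖ - hardyProfile a δ r ‖y‖| ^ p / ‖x - y‖ ^ ((N : ℝ) + p * s)) = 0 := by
  have ha0 : 0 < a := by rw [ha]; exact div_pos (by linarith) (by linarith)
  rw [setLIntegral_congr_fun (g := fun _ => 0) Metric.isOpen_ball.measurableSet, lintegral_zero]
  intro y hy
  have hy1 : ‖y‖ < ‖x‖ := by simpa using hy
  simp only
  rw [hardyProfile_of_le ha0 hδ hδr hx, hardyProfile_of_le ha0 hδ hδr (hy1.le.trans hx), sub_self,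
    abs_zero, Real.zero_rpow (by linarith), zero_div, ENNReal.ofReal_zero]

/-- For `‖x‖ ≥ r` the bound of the annulus would not be integrable at infinity. Only points with
`‖x‖ ‖y‖ < r` (after scaling) contribute, so the factor `(r / (‖x‖ ‖y‖)) ^ (ps/2) ≥ 1` may be
inserted. It adds decay in `x`, at the price of the weight `‖y‖ ^ (-ps/2)`, which the Hardy kernel
tolerates. -/
theorem lintegral_hardyProfile_compl_le {δ r : ℝ} (hδ : 0 < δ) (hδr : δ < r)
    {x : E N} (hx : r ≤ ‖x‖) :
    ∫⁻ y in Metric.ball 0 ‖x‖, ENNReal.ofReal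
      (|hardyProfile a δ r ‖x‖ - hardyProfile a δ r ‖y‖| ^ p / ‖x - y‖ ^ ((N : ℝ) + p * s)) ≤
    ENNReal.ofReal (‖x‖ ^ (-(N : ℝ) - p * s / 2)) * (ENNReal.ofReal (r ^ (p * s / 2)) *
      ∫⁻ y in Metric.ball (0 : E N) 1, ENNReal.ofReal (‖y‖ ^ (-(p * s / 2)) *
      (|‖y‖ ^ (-a) - 1| ^ p / ‖unitVec hN - y‖ ^ ((N : ℝ) + p * s)))) := by
  have ha0 : 0 < a := by rw [ha]; exact div_pos (by linarith) (by linarith)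
  have hap : a * p = N - p * s := by rw [ha]; field_simp
  have hr0 := hδ.trans hδr
  have hx0 := hr0.trans_le hx
  have hps0 : 0 < p * s := by positivity
  have := nontrivial_E hN
  rw [lintegral_ball_norm_eq hN p s _ (norm_pos_iff.1 hx0),
    ← lintegral_const_mul' _ _ ENNReal.ofReal_ne_top,
    ← lintegral_const_mul' _ _ ENNReal.ofReal_ne_top,
    ← lintegral_const_mul' _ _ ENNReal.ofReal_ne_top]
  refine lintegral_mono_ae ?_
  filter_upwards [ae_restrict_mem Metric.isOpen_ball.measurableSet,
      ae_restrict_of_ae (Measure.ae_ne volume (0 : E N))] with y h1 h2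
  have hy1 : ‖y‖ < 1 := by simpa using h1
  have hy0 := norm_pos_iff.2 h2
  rw [← ENNReal.ofReal_mul (by positivity), ← ENNReal.ofReal_mul (by positivity),
    ← ENNReal.ofReal_mul (by positivity)]
  apply ENNReal.ofReal_le_ofReal
  rcases le_or_gt r (‖x‖ * ‖y‖) with hxy | hxy
  · rw [hardyProfile_of_ge ha0 hδ hδr hx, hardyProfile_of_ge ha0 hδ hδr hxy, sub_self, abs_zero,
      Real.zero_rpow (by linarith), zero_div, mul_zero]
    positivity
  have hle : ‖x‖ * ‖y‖ ≤ ‖x‖ := by nlinarith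
  have hb := hardyProfile_sub_le ha0 hδ hδr (mul_pos hx0 hy0) hle
  have hm := hardyProfile_antitone ha0 hδ hδr hle
  have e1 : |hardyProfile a δ r ‖x‖ - hardyProfile a δ r (‖x‖ * ‖y‖)| ≤
      ‖x‖ ^ (-a) * |‖y‖ ^ (-a) - 1| := by
    rw [abs_sub_comm, abs_of_nonneg (by linarith)]
    refine hb.trans (le_trans (le_of_eq ?_) (mul_le_mul_of_nonneg_left (le_abs_self _)
      (by positivity)))
    rw [Real.mul_rpow hx0.le hy0.le]; ring
  have e2 : ‖x‖ ^ (-(N : ℝ) - p * s / 2) =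
      ‖x‖ ^ (-(p * s)) * (‖x‖ ^ (-a)) ^ p * ‖x‖ ^ (-(p * s / 2)) := by
    rw [← Real.rpow_mul hx0.le, ← Real.rpow_add hx0, ← Real.rpow_add hx0, neg_mul, hap]
    congr 1; ring
  have e3 := Real.rpow_le_rpow (abs_nonneg _) e1 (by linarith : 0 ≤ p)
  rw [Real.mul_rpow (by positivity) (abs_nonneg _)] at e3
  have e4 : 1 ≤ ‖x‖ ^ (-(p * s / 2)) * r ^ (p * s / 2) * ‖y‖ ^ (-(p * s / 2)) := by
    rw [mul_right_comm, ← Real.mul_rpow hx0.le hy0.le, Real.rpow_neg (by positivity),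
      ← Real.inv_rpow (by positivity), ← Real.mul_rpow (by positivity) hr0.le]
    apply Real.one_le_rpow _ (by positivity)
    rw [inv_mul_eq_div, one_le_div (by positivity)]
    exact hxy.le
  rw [e2]
  set D := ‖unitVec hN - y‖ ^ ((N : ℝ) + p * s)
  have hD : 0 ≤ D := by positivity
  calc ‖x‖ ^ (-(p * s)) * (|hardyProfile a δ r ‖x‖ - hardyProfile a δ r (‖x‖ * ‖y‖)| ^ p / D)
      ≤ ‖x‖ ^ (-(p * s)) * ((‖x‖ ^ (-a)) ^ p * |‖y‖ ^ (-a) - 1| ^ p / D) * 1 := by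
        rw [mul_one]; gcongr
    _ ≤ ‖x‖ ^ (-(p * s)) * ((‖x‖ ^ (-a)) ^ p * |‖y‖ ^ (-a) - 1| ^ p / D) *
        (‖x‖ ^ (-(p * s / 2)) * r ^ (p * s / 2) * ‖y‖ ^ (-(p * s / 2))) := by gcongr
    _ = _ := by ring

/-- The energy of the profile exceeds `2 Λ ∫ ‖x‖^{-N}` by a bounded amount at most. -/
theorem exists_energy_hardyProfile_le (hs1 : s < 1) {r : ℝ} (hr : 0 < r) :
    ∃ C : ℝ≥0∞, C < ⊤ ∧ ∀ δ, 0 < δ → δ < r →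
      ∫⁻ x : E N, ∫⁻ y : E N, ENNReal.ofReal
      (|hardyProfile a δ r ‖x‖ - hardyProfile a δ r ‖y‖| ^ p / ‖x - y‖ ^ ((N : ℝ) + p * s)) ≤
      2 * (ENNReal.ofReal (hardyConstant hN p s) *
        (∫⁻ x in annulus N δ r, ENNReal.ofReal (‖x‖ ^ (-(N : ℝ)))) + C) := by
  have hps0 : 0 < p * s := by positivity
  have ha0 : 0 < a := by rw [ha]; exact div_pos (by linarith) (by linarith)
  set Cy := ENNReal.ofReal (r ^ (p * s / 2)) *
      ∫⁻ y in Metric.ball (0 : E N) 1, ENNReal.ofReal (‖y‖ ^ (-(p * s / 2)) *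
      (|‖y‖ ^ (-a) - 1| ^ p / ‖unitVec hN - y‖ ^ ((N : ℝ) + p * s))) with hCy
  have hCyt : Cy < ⊤ := by
    refine ENNReal.mul_lt_top ENNReal.ofReal_lt_top ?_
    rw [ha]
    exact lintegral_hardyKernel_lt_top hN hp hs0 hs1 hps (by positivity) (by linarith)
  -- The error comes from the exterior `‖x‖ ≥ r` alone and is independent of `δ`: on the plateau
  -- `‖x‖ ≤ δ` the inner integral vanishes, and the annulus gives the leading term.
  refine ⟨(∫⁻ x in (Metric.ball (0 : E N) r)ᶜ, ENNReal.ofReal (‖x‖ ^ (-(N : ℝ) - p * s / 2))) * Cy,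
    ENNReal.mul_lt_top (lintegral_norm_rpow_compl_ball_lt_top hN hr (by linarith)) hCyt,
    fun δ hδ hδr => ?_⟩
  rw [lintegral_lintegral_eq_two_mul_of_symm]
  rotate_left
  · obtain ⟨K, hK⟩ := exists_lipschitzWith_hardyProfile_norm ha0 hδ hδr N
    have hm : Measurable fun x : E N => hardyProfile a δ r ‖x‖ := hK.continuous.measurable
    have hm1 : Measurable fun z : E N × E N => hardyProfile a δ r ‖z.1‖ := hm.comp measurable_fst
    have hm2 : Measurable fun z : E N × E N => hardyProfile a δ r ‖z.2‖ := hm.comp measurable_snd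
    unfold Function.uncurry
    fun_prop
  · intro x y; rw [abs_sub_comm, norm_sub_rev]
  · intro x y hxy
    rw [hxy, sub_self, abs_zero, Real.zero_rpow (by linarith), zero_div, ENNReal.ofReal_zero]
  gcongr
  have hb : ∀ x : E N, ∫⁻ y in Metric.ball 0 ‖x‖, ENNReal.ofReal
      (|hardyProfile a δ r ‖x‖ - hardyProfile a δ r ‖y‖| ^ p / ‖x - y‖ ^ ((N : ℝ) + p * s)) ≤
      (annulus N δ r).indicator (fun x => ENNReal.ofReal (hardyConstant hN p s) *
        ENNReal.ofReal (‖x‖ ^ (-(N : ℝ)))) x +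
      (Metric.ball (0 : E N) r)ᶜ.indicator
        (fun x => ENNReal.ofReal (‖x‖ ^ (-(N : ℝ) - p * s / 2)) * Cy) x := by
    intro x
    rcases le_or_gt ‖x‖ δ with h1 | h1
    · rw [lintegral_hardyProfile_ball hp hs0 hps ha hδ hδr h1]; positivity
    rcases lt_or_ge ‖x‖ r with h2 | h2
    · rw [indicator_of_mem (show x ∈ annulus N δ r from ⟨h1, h2⟩)]
      refine le_add_right ?_
      rw [mul_comm (ENNReal.ofReal (hardyConstant hN p s))]
      exact lintegral_hardyProfile_annulus_le hN hp hs0 hps ha hs1 hδ hδr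
        (norm_pos_iff.1 (hδ.trans h1))
    · rw [indicator_of_mem (show x ∈ (Metric.ball (0 : E N) r)ᶜ by simpa using h2)]
      exact le_add_left (lintegral_hardyProfile_compl_le hN hp hs0 hps ha hδ hδr h2)
  refine (lintegral_mono hb).trans (le_of_eq ?_)
  rw [lintegral_add_left (Measurable.indicator (by fun_prop) (measurableSet_annulus _ _)),
    lintegral_indicator (measurableSet_annulus _ _),
    lintegral_indicator Metric.isOpen_ball.measurableSet.compl,
    lintegral_const_mul' _ _ ENNReal.ofReal_ne_top, lintegral_mul_const' _ _ hCyt.ne]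

include hN in
-- With `t = (‖x‖ / r) ^ a`, subtracting `r ^ (-a)` multiplies the profile by `1 - t`, and Bernoulli
-- gives `(1 - t) ^ p ≥ 1 - p t`. The loss `p t ‖x‖ ^ (-N)` equals `p r ^ (-a) ‖x‖ ^ (a - N)`, which
-- is integrable on the ball.
theorem exists_lintegral_annulus_le {r : ℝ} (hr : 0 < r) :
    ∃ C : ℝ≥0∞, C < ⊤ ∧ ∀ δ, 0 < δ → δ < r →
      ∫⁻ x in annulus N δ r, ENNReal.ofReal (‖x‖ ^ (-(N : ℝ))) ≤
        (∫⁻ x : E N, ENNReal.ofReal (hardyProfile a δ r ‖x‖ ^ p / ‖x‖ ^ (p * s))) + C := by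
  have ha0 : 0 < a := by rw [ha]; exact div_pos (by linarith) (by linarith)
  have hap : a * p = N - p * s := by rw [ha]; field_simp
  refine ⟨ENNReal.ofReal (p * r ^ (-a)) *
    ∫⁻ x in Metric.ball (0 : E N) r, ENNReal.ofReal (‖x‖ ^ (-(N : ℝ) + a)),
    ENNReal.mul_lt_top ENNReal.ofReal_lt_top (lintegral_norm_rpow_ball_lt_top hN (by linarith)),
    fun δ hδ hδr => ?_⟩
  rw [← lintegral_const_mul' _ _ ENNReal.ofReal_ne_top]
  have hsub : annulus N δ r ⊆ Metric.ball 0 r := fun x hx => by simpa using hx.2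
  refine le_trans ?_ (add_le_add (setLIntegral_le_lintegral (annulus N δ r) _)
    (lintegral_mono_set hsub))
  rw [← lintegral_add_right _ (by fun_prop)]
  refine setLIntegral_mono' (measurableSet_annulus _ _) fun x hx => ?_
  have hx0 : 0 < ‖x‖ := hδ.trans hx.1
  have hP := hardyProfile_nonneg ha0 hδ hδr ‖x‖
  rw [← ENNReal.ofReal_mul (by positivity), ← ENNReal.ofReal_add (by positivity) (by positivity)]
  apply ENNReal.ofReal_le_ofReal
  rw [hardyProfile_of_mem ha0 hδ hδr hx.1.le hx.2.le]
  set t := (‖x‖ / r) ^ a with ht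
  have ht0 : 0 ≤ t := by positivity
  have ht1 : t ≤ 1 := Real.rpow_le_one (by positivity) ((div_le_one hr).2 hx.2.le) ha0.le
  have e0 : r ^ (-a) = ‖x‖ ^ (-a) * t := by
    rw [ht, Real.div_rpow hx0.le hr.le, Real.rpow_neg hx0.le, Real.rpow_neg hr.le]
    have := (Real.rpow_pos_of_pos hx0 a).ne'
    field_simp
  have e1 : ‖x‖ ^ (-a) - r ^ (-a) = ‖x‖ ^ (-a) * (1 - t) := by rw [e0]; ring
  have e2 : (‖x‖ ^ (-a) * (1 - t)) ^ p / ‖x‖ ^ (p * s) = ‖x‖ ^ (-(N : ℝ)) * (1 - t) ^ p := by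
    rw [Real.mul_rpow (by positivity) (by linarith), ← Real.rpow_mul hx0.le, mul_div_right_comm,
      ← Real.rpow_sub hx0, neg_mul, hap]
    congr 2; ring
  have e3 : p * r ^ (-a) * ‖x‖ ^ (-(N : ℝ) + a) = ‖x‖ ^ (-(N : ℝ)) * (p * t) := by
    rw [e0, Real.rpow_add hx0, Real.rpow_neg hx0.le a]
    have := (Real.rpow_pos_of_pos hx0 a).ne'
    field_simp
  rw [e1, e2, e3, ← mul_add]
  have e4 := one_add_mul_self_le_rpow_one_add (s := -t) (by linarith) (p := p) (by linarith)
  rw [← sub_eq_add_neg] at e4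
  exact le_mul_of_one_le_right (by positivity) (by linarith)

include hN in
-- The profile is below `‖x‖ ^ (-a)`, and `a p = N - ps < N`. Any multiple of the `L^p` term thus
-- stays bounded as `δ → 0`, so it cannot rescue the Hardy inequality.
theorem exists_lintegral_hardyProfile_le (r : ℝ) :
    ∃ C : ℝ≥0∞, C < ⊤ ∧ ∀ δ, 0 < δ → δ < r →
      ∫⁻ x : E N, ENNReal.ofReal (hardyProfile a δ r ‖x‖ ^ p) ≤ C := by
  have ha0 : 0 < a := by rw [ha]; exact div_pos (by linarith) (by linarith)
  have hap : a * p = N - p * s := by rw [ha]; field_simp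
  have hps0 : 0 < p * s := by positivity
  have := nontrivial_E hN
  refine ⟨∫⁻ x in Metric.ball (0 : E N) r, ENNReal.ofReal (‖x‖ ^ (-((N : ℝ) - p * s))),
    lintegral_norm_rpow_ball_lt_top hN (by linarith), fun δ hδ hδr => ?_⟩
  rw [← lintegral_indicator Metric.isOpen_ball.measurableSet]
  refine lintegral_mono_ae ?_
  filter_upwards [Measure.ae_ne volume (0 : E N)] with x hx
  have hx0 := norm_pos_iff.2 hx
  by_cases h : ‖x‖ < r
  · rw [indicator_of_mem (by simpa using h)]
    apply ENNReal.ofReal_le_ofReal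
    rw [← hap, ← neg_mul, Real.rpow_mul hx0.le]
    exact Real.rpow_le_rpow (hardyProfile_nonneg ha0 hδ hδr _) (hardyProfile_le ha0 hδ hδr hx0)
      (by linarith)
  · rw [hardyProfile_of_ge ha0 hδ hδr (not_lt.1 h), Real.zero_rpow (by linarith),
      ENNReal.ofReal_zero]
    positivity

end Energy

/-! ### Optimality of the Hardy constant -/

theorem hardyConstant_nonneg {N : ℕ} (hN : 1 < N) (p s : ℝ) : 0 ≤ hardyConstant hN p s := by
  refine integral_nonneg_of_ae ?_
  filter_upwards [ae_restrict_mem measurableSet_Ioo] with σ hσ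
  have h1 : 0 ≤ sphereKernel hN p s σ := integral_nonneg fun y => by positivity
  have := hσ.1
  simp only [Pi.zero_apply]
  positivity

/-- Optimality of the Hardy constant, with a lower order term. -/
theorem exists_hardy_quotient_lt {N : ℕ} (hN : 1 < N) {p s : ℝ} (hp : 2 < p) (hs0 : 0 < s)
    (hs1 : s < 1) (hps : p * s < (N : ℝ)) {lam : ℝ} (hlam : hardyConstant hN p s < lam)
    (C₀ : ℝ) {r : ℝ} (hr : 0 < r) :
    ∃ ψ : E N → ℝ, (∃ K, LipschitzWith K ψ) ∧ (∀ x, 0 ≤ ψ x) ∧ (∀ x, r ≤ ‖x‖ → ψ x = 0) ∧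
      (∫⁻ x : E N, ∫⁻ y : E N,
        ENNReal.ofReal (|ψ x - ψ y| ^ p / ‖x - y‖ ^ ((N : ℝ) + p * s))) / 2 +
      ENNReal.ofReal C₀ * ∫⁻ x, ENNReal.ofReal (ψ x ^ p) <
      ENNReal.ofReal lam * ∫⁻ x, ENNReal.ofReal (ψ x ^ p / ‖x‖ ^ (p * s)) := by
  obtain ⟨a, ha⟩ : ∃ a, a = ((N : ℝ) - p * s) / p := ⟨_, rfl⟩
  have ha0 : 0 < a := by rw [ha]; exact div_pos (by linarith) (by linarith)
  obtain ⟨C1, hC1, h1⟩ := exists_energy_hardyProfile_le hN hp hs0 hps ha hs1 hr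
  obtain ⟨C2, hC2, h2⟩ := exists_lintegral_annulus_le hN hp hs0 hps ha hr
  obtain ⟨C3, hC3, h3⟩ := exists_lintegral_hardyProfile_le hN hp hs0 hps ha r
  set Λ := hardyConstant hN p s with hΛ
  have hΛ0 : 0 ≤ Λ := hardyConstant_nonneg hN p s
  set B := C1 + ENNReal.ofReal C₀ * C3 + ENNReal.ofReal lam * C2 with hB
  have hBt : B < ⊤ := by
    refine ENNReal.add_lt_top.2 ⟨ENNReal.add_lt_top.2 ⟨hC1, ?_⟩, ?_⟩ <;>
    exact ENNReal.mul_lt_top ENNReal.ofReal_lt_top (by assumption)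
  -- This `δ` ensures `(lam - Λ) L ≥ B + 1`, whereas failure of the claim would give `(lam - Λ) L ≤
  -- B`.
  obtain ⟨δ, hδ, hδr, hL⟩ := exists_annulus_le hN hr (ENNReal.ofReal ((B.toReal + 1) / (lam - Λ)))
    ENNReal.ofReal_lt_top
  set L := ∫⁻ x in annulus N δ r, ENNReal.ofReal (‖x‖ ^ (-(N : ℝ)))
  have hLt : L < ⊤ := lintegral_annulus_lt_top hδ _
  refine ⟨fun x => hardyProfile a δ r ‖x‖, exists_lipschitzWith_hardyProfile_norm ha0 hδ hδr N,
    fun x => hardyProfile_nonneg ha0 hδ hδr _, fun x hx => hardyProfile_of_ge ha0 hδ hδr hx, ?_⟩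
  specialize h1 δ hδ hδr
  specialize h2 δ hδ hδr
  specialize h3 δ hδ hδr
  set X := ∫⁻ x : E N, ∫⁻ y : E N, ENNReal.ofReal
      (|hardyProfile a δ r ‖x‖ - hardyProfile a δ r ‖y‖| ^ p / ‖x - y‖ ^ ((N : ℝ) + p * s))
  set H := ∫⁻ x : E N, ENNReal.ofReal (hardyProfile a δ r ‖x‖ ^ p / ‖x‖ ^ (p * s))
  set P := ∫⁻ x : E N, ENNReal.ofReal (hardyProfile a δ r ‖x‖ ^ p)
  by_contra! hcon
  have hX : X / 2 ≤ ENNReal.ofReal Λ * L + C1 := by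
    refine ENNReal.div_le_of_le_mul ?_
    rwa [mul_comm]
  have hfinal : ENNReal.ofReal lam * L ≤ ENNReal.ofReal Λ * L + B := by
    calc ENNReal.ofReal lam * L ≤ ENNReal.ofReal lam * (H + C2) := by gcongr
      _ = ENNReal.ofReal lam * H + ENNReal.ofReal lam * C2 := mul_add _ _ _
      _ ≤ (X / 2 + ENNReal.ofReal C₀ * P) + ENNReal.ofReal lam * C2 := by gcongr
      _ ≤ ((ENNReal.ofReal Λ * L + C1) + ENNReal.ofReal C₀ * C3) + ENNReal.ofReal lam * C2 := by
        gcongr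
      _ = ENNReal.ofReal Λ * L + B := by rw [hB]; ring
  have hreal : lam * L.toReal ≤ Λ * L.toReal + B.toReal := by
    have := ENNReal.toReal_mono (by finiteness) hfinal
    rw [ENNReal.toReal_add (by finiteness) hBt.ne, ENNReal.toReal_mul, ENNReal.toReal_mul,
      ENNReal.toReal_ofReal hΛ0, ENNReal.toReal_ofReal (hΛ0.trans hlam.le)] at this
    exact this
  have hL2 : (B.toReal + 1) / (lam - Λ) ≤ L.toReal := (ENNReal.ofReal_le_iff_le_toReal hLt.ne).1 hL
  rw [div_le_iff₀ (by linarith)] at hL2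
  nlinarith

/-! ### Discrete Picone inequalities -/

theorem rpow_sub_two_mul_self {p r : ℝ} (hp : 2 < p) (hr : 0 ≤ r) :
    |r| ^ (p - 2) * r = r ^ (p - 1) := by
  rcases hr.eq_or_lt with rfl | h
  · rw [mul_zero, Real.zero_rpow (by linarith)]
  · rw [abs_of_pos h]
    nth_rw 2 [← Real.rpow_one r]
    rw [← Real.rpow_add h]; congr 1; ring

/-- If `h ≤ k`, the left side is nonpositive. If `h > k` and `a > b`, write `h` as the convex
combination of `(h - k) a / (a - b)` and `k a / b` with weights `(a - b) / a` and `b / a`; convexity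
of the `p`-th power, multiplied by `(a - b) ^ (p-1) a ^ (1-p)`, is the claim. -/
theorem picone_of_le {p a b h k : ℝ} (hp : 2 < p) (hb : 0 < b) (hab : b ≤ a) (hh : 0 ≤ h)
    (hk : 0 ≤ k) :
    |a - b| ^ (p - 2) * (a - b) * (h ^ p * a ^ (1 - p) - k ^ p * b ^ (1 - p)) ≤ |h - k| ^ p := by
  have ha : 0 < a := hb.trans_le hab
  rw [rpow_sub_two_mul_self hp (by linarith)]
  rcases le_or_gt h k with hhk | hhk
  · refine le_trans (mul_nonpos_of_nonneg_of_nonpos (by have := sub_nonneg.2 hab; positivity) ?_)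
      (by positivity)
    rw [sub_nonpos]
    exact mul_le_mul (Real.rpow_le_rpow hh hhk (by linarith))
      (Real.rpow_le_rpow_of_nonpos hb hab (by linarith)) (by positivity) (by positivity)
  rcases hab.eq_or_lt with rfl | hab
  · rw [sub_self, Real.zero_rpow (by linarith), zero_mul]; positivity
  have hd : 0 < a - b := by linarith
  have hconv := (convexOn_rpow (p := p) (by linarith)).2
    (show (h - k) * a / (a - b) ∈ Ici 0 by
      rw [mem_Ici]; have := sub_pos.2 hhk; positivity)
    (show k * a / b ∈ Ici 0 by rw [mem_Ici]; positivity)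
    (show 0 ≤ (a - b) / a by positivity) (show 0 ≤ b / a by positivity)
    (by field_simp; ring)
  simp only [smul_eq_mul] at hconv
  have e : (a - b) / a * ((h - k) * a / (a - b)) + b / a * (k * a / b) = h := by
    field_simp; ring
  have hhk0 : 0 ≤ h - k := by linarith
  rw [e, Real.div_rpow (by positivity) hd.le, Real.div_rpow (by positivity) hb.le,
    Real.mul_rpow hhk0 ha.le, Real.mul_rpow hk ha.le] at hconv
  rw [abs_of_nonneg hhk0]
  have ea : a ^ p = a ^ (p - 1) * a := by
    nth_rw 3 [← Real.rpow_one a]; rw [← Real.rpow_add ha]; congr 1; ring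
  have eb : b ^ p = b ^ (p - 1) * b := by
    nth_rw 3 [← Real.rpow_one b]; rw [← Real.rpow_add hb]; congr 1; ring
  have ed : (a - b) ^ p = (a - b) ^ (p - 1) * (a - b) := by
    nth_rw 3 [← Real.rpow_one (a - b)]; rw [← Real.rpow_add hd]; congr 1; ring
  have ia : a ^ (1 - p) = (a ^ (p - 1))⁻¹ := by rw [← Real.rpow_neg ha.le]; congr 1; ring
  have ib : b ^ (1 - p) = (b ^ (p - 1))⁻¹ := by rw [← Real.rpow_neg hb.le]; congr 1; ring
  have hA := Real.rpow_pos_of_pos ha (p - 1)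
  have hB := Real.rpow_pos_of_pos hb (p - 1)
  have hD := Real.rpow_pos_of_pos hd (p - 1)
  rw [ea, eb, ed] at hconv
  rw [ia, ib]
  set A := a ^ (p - 1)
  set B := b ^ (p - 1)
  set D := (a - b) ^ (p - 1)
  have hc2 : h ^ p ≤ A / D * (h - k) ^ p + A / B * k ^ p := by
    refine hconv.trans (le_of_eq ?_)
    field_simp
  have hc3 : D * (h ^ p * A⁻¹) ≤ D * ((A / D * (h - k) ^ p + A / B * k ^ p) * A⁻¹) := by gcongr
  have e3 : D * ((A / D * (h - k) ^ p + A / B * k ^ p) * A⁻¹) =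
      (h - k) ^ p + D * (k ^ p * B⁻¹) := by field_simp
  rw [mul_sub]; linarith

theorem picone {p a b h k : ℝ} (hp : 2 < p) (ha : 0 < a) (hb : 0 < b) (hh : 0 ≤ h) (hk : 0 ≤ k) :
    |a - b| ^ (p - 2) * (a - b) * (h ^ p * a ^ (1 - p) - k ^ p * b ^ (1 - p)) ≤ |h - k| ^ p := by
  rcases le_total b a with hab | hab
  · exact picone_of_le hp hb hab hh hk
  · have := picone_of_le hp ha hab hk hh
    rw [abs_sub_comm a, abs_sub_comm h]
    refine le_trans (le_of_eq ?_) this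
    ring

/-- Picone's inequality with a remainder, at pairs of which one point lies outside the support. -/
theorem picone_remainder {p a b h : ℝ} (hp : 2 < p) (ha : 0 < a) (hb : 0 < b) (hh : 0 ≤ h) :
    |a - b| ^ (p - 2) * (a - b) * (h ^ p * a ^ (1 - p)) ≤
      h ^ p - (b / 2) ^ (p - 1) * (h ^ p * a ^ (1 - p)) := by
  have ia : a ^ (1 - p) = (a ^ (p - 1))⁻¹ := by rw [← Real.rpow_neg ha.le]; congr 1; ring
  have hA := Real.rpow_pos_of_pos ha (p - 1)
  have hp0 : 0 ≤ h ^ p := by positivity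
  -- Once `h ^ p * a ^ (1 - p)` is factored out, only a comparison of `a` and `b` is left.
  suffices hs : |a - b| ^ (p - 2) * (a - b) + (b / 2) ^ (p - 1) ≤ a ^ (p - 1) by
    have := mul_le_mul_of_nonneg_right hs (show 0 ≤ h ^ p * a ^ (1 - p) by positivity)
    have e : a ^ (p - 1) * (h ^ p * a ^ (1 - p)) = h ^ p := by rw [ia]; field_simp
    rw [e] at this
    linarith
  rcases le_total b a with hab | hab
  · rw [rpow_sub_two_mul_self hp (by linarith)]
    -- Superadditivity of the power `p - 1 ≥ 1`.
    have h1 : (a - b) ^ (p - 1) + b ^ (p - 1) ≤ a ^ (p - 1) := by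
      have := Real.add_rpow_le_rpow_add (sub_nonneg.2 hab) hb.le (show 1 ≤ p - 1 by linarith)
      rwa [sub_add_cancel] at this
    have h2 : (b / 2) ^ (p - 1) ≤ b ^ (p - 1) :=
      Real.rpow_le_rpow (by positivity) (by linarith) (by linarith)
    linarith
  · have e : |a - b| ^ (p - 2) * (a - b) = -(b - a) ^ (p - 1) := by
      rw [abs_sub_comm, ← rpow_sub_two_mul_self hp (sub_nonneg.2 hab)]; ring
    rw [e]
    -- Either `a ≥ b / 2` and the right side alone suffices, or `b - a ≥ b / 2` and the negative
    -- flux pays for the remainder. This dichotomy is the origin of the factor `1/2` in the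
    -- remainder.
    rcases le_total (b / 2) a with h2 | h2
    · have := Real.rpow_le_rpow (by positivity) h2 (show 0 ≤ p - 1 by linarith)
      have : 0 ≤ (b - a) ^ (p - 1) := Real.rpow_nonneg (sub_nonneg.2 hab) _
      linarith
    · have : (b / 2) ^ (p - 1) ≤ (b - a) ^ (p - 1) :=
        Real.rpow_le_rpow (by positivity) (by linarith) (by linarith)
      linarith

/-! ### Difference quotients -/

/-- The weighted difference quotient `(w x - w y) / |x - y|^{(N + ps) / p}`. -/
noncomputable def dq {N : ℕ} (p s : ℝ) (w : E N → ℝ) (z : E N × E N) : ℝ :=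
  (w z.1 - w z.2) / ‖z.1 - z.2‖ ^ (((N : ℝ) + p * s) / p)

section dq

variable {N : ℕ} {p s : ℝ}

theorem abs_dq_rpow (hp : 2 < p) (w : E N → ℝ) (z : E N × E N) :
    |dq p s w z| ^ p = |w z.1 - w z.2| ^ p / ‖z.1 - z.2‖ ^ ((N : ℝ) + p * s) := by
  rw [dq, abs_div, Real.div_rpow (abs_nonneg _) (abs_nonneg _),
    abs_of_nonneg (show 0 ≤ ‖z.1 - z.2‖ ^ (((N : ℝ) + p * s) / p) by positivity),
    ← Real.rpow_mul (norm_nonneg _), div_mul_cancel₀ _ (by linarith)]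

/-- The kernel is distributed over the `(p - 2) + 1 + 1 = p` factors. The energy form becomes an
`L^{p'}`–`L^p` pairing for Lebesgue measure on pairs of points, with no singular weight. -/
theorem dq_pairing (hp : 2 < p) (w v : E N → ℝ) (z : E N × E N) :
    |dq p s w z| ^ (p - 2) * dq p s w z * dq p s v z =
      |w z.1 - w z.2| ^ (p - 2) * (w z.1 - w z.2) * (v z.1 - v z.2) /
        ‖z.1 - z.2‖ ^ ((N : ℝ) + p * s) := by
  rcases eq_or_ne z.1 z.2 with h | h
  · simp [dq, h]
  have hz : 0 < ‖z.1 - z.2‖ := norm_pos_iff.2 (sub_ne_zero.2 h)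
  set D := ‖z.1 - z.2‖ with hD
  set c := ((N : ℝ) + p * s) / p with hc
  have e : D ^ ((N : ℝ) + p * s) = (D ^ c) ^ (p - 2) * D ^ c * D ^ c := by
    rw [← Real.rpow_mul hz.le, ← Real.rpow_add hz, ← Real.rpow_add hz]
    congr 1
    rw [hc]; field_simp; ring
  have hDc : 0 < D ^ c := by positivity
  have hDc2 : 0 < (D ^ c) ^ (p - 2) := by positivity
  rw [dq, dq, ← hD, ← hc, e, abs_div, Real.div_rpow (abs_nonneg _) (abs_nonneg _), abs_of_pos hDc]
  field_simp

theorem gagliardo_eq (hp : 2 < p) (Ω : Set (E N)) (w : E N → ℝ) :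
    gagliardo p s Ω w = ∫⁻ z in crossDomain Ω, ENNReal.ofReal (|dq p s w z| ^ p) := by
  simp only [abs_dq_rpow hp]; rfl

theorem fracPairing_eq (hp : 2 < p) (Ω : Set (E N)) (w v : E N → ℝ) :
    fracPairing p s Ω w v =
      (1 / 2) * ∫ z in crossDomain Ω, |dq p s w z| ^ (p - 2) * dq p s w z * dq p s v z := by
  simp only [dq_pairing hp]; rfl

theorem dq_sub (v w : E N → ℝ) (z : E N × E N) :
    dq p s (fun x => v x - w x) z = dq p s v z - dq p s w z := by
  simp only [dq]; ring

theorem measurable_dq {w : E N → ℝ} (hw : Measurable w) : Measurable (dq p s w) := by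
  unfold dq
  fun_prop

theorem dq_congr_ae {v w : E N → ℝ} (h : v =ᵐ[volume] w) :
    dq p s v =ᵐ[volume] dq p s w := by
  have h1 := Measure.quasiMeasurePreserving_fst (μ := (volume : Measure (E N)))
    (ν := (volume : Measure (E N))) |>.ae_eq_comp h
  have h2 := Measure.quasiMeasurePreserving_snd (μ := (volume : Measure (E N)))
    (ν := (volume : Measure (E N))) |>.ae_eq_comp h
  filter_upwards [h1, h2] with z hz1 hz2
  simp only [Function.comp_apply] at hz1 hz2
  simp only [dq, hz1, hz2]

theorem gagliardo_congr_ae (hp : 2 < p) (Ω : Set (E N)) {v w : E N → ℝ} (h : v =ᵐ[volume] w) :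
    gagliardo p s Ω v = gagliardo p s Ω w := by
  rw [gagliardo_eq hp, gagliardo_eq hp]
  refine lintegral_congr_ae (ae_restrict_of_ae ?_)
  filter_upwards [dq_congr_ae (p := p) (s := s) h] with z hz
  rw [hz]

theorem fracPairing_congr_ae (hp : 2 < p) (Ω : Set (E N)) {v w : E N → ℝ} (h : v =ᵐ[volume] w)
    (φ : E N → ℝ) : fracPairing p s Ω v φ = fracPairing p s Ω w φ := by
  rw [fracPairing_eq hp, fracPairing_eq hp]
  congr 1
  refine integral_congr_ae (ae_restrict_of_ae ?_)
  filter_upwards [dq_congr_ae (p := p) (s := s) h] with z hz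
  rw [hz]

theorem lintegral_rpow_eq_eLpNorm_rpow {α : Type*} [MeasurableSpace α] {μ : Measure α}
    (hp : 2 < p) (g : α → ℝ) :
    ∫⁻ z, ENNReal.ofReal (|g z| ^ p) ∂μ = eLpNorm g (ENNReal.ofReal p) μ ^ p := by
  have hp0 : 0 < p := by linarith
  rw [eLpNorm_eq_lintegral_rpow_enorm_toReal (by simpa using hp0) ENNReal.ofReal_ne_top,
    ENNReal.toReal_ofReal hp0.le, ← ENNReal.rpow_mul, one_div, inv_mul_cancel₀ hp0.ne',
    ENNReal.rpow_one]
  refine lintegral_congr fun z => ?_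
  rw [← ofReal_norm, ENNReal.ofReal_rpow_of_nonneg (norm_nonneg _) hp0.le,
    Real.norm_eq_abs]

theorem memLp_iff_lintegral_rpow {α : Type*} [MeasurableSpace α] {μ : Measure α}
    (hp : 2 < p) {g : α → ℝ} (hg : AEStronglyMeasurable g μ) :
    MemLp g (ENNReal.ofReal p) μ ↔ ∫⁻ z, ENNReal.ofReal (|g z| ^ p) ∂μ < ⊤ := by
  rw [lintegral_rpow_eq_eLpNorm_rpow hp, MemLp, and_iff_right hg,
    ENNReal.rpow_lt_top_iff_of_pos (by linarith)]

end dq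

/-! ### Domination of the difference quotients of Lipschitz functions -/

section dominator

variable {N : ℕ} {p s : ℝ}

/-- A `p`-integrable majorant for the difference quotients of functions that are `L`-Lipschitz,
vary by at most `M` and vanish outside the ball of radius `R`. -/
noncomputable def dominator (N : ℕ) (p s L M R : ℝ) (z : E N × E N) : ℝ :=
  {z : E N × E N | ‖z.1‖ ≤ R ∨ ‖z.2‖ ≤ R}.indicator
    (fun z => min (L * ‖z.1 - z.2‖) M / ‖z.1 - z.2‖ ^ (((N : ℝ) + p * s) / p)) z

theorem measurable_dominator (L M R : ℝ) : Measurable (dominator N p s L M R) := by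
  unfold dominator
  refine Measurable.indicator (by fun_prop) (MeasurableSet.union ?_ ?_)
  · exact measurableSet_le (f := fun z : E N × E N => ‖z.1‖) (by fun_prop) measurable_const
  · exact measurableSet_le (f := fun z : E N × E N => ‖z.2‖) (by fun_prop) measurable_const

/-- The Lipschitz bound is used for `‖h‖ < 1`, where `p - ps > 0` gives integrability, and the bound
`M` for `‖h‖ ≥ 1`, where the kernel itself is integrable. -/
theorem lintegral_kernel_lt_top (hN : 1 < N) (hp : 2 < p) (hs0 : 0 < s) (hs1 : s < 1)
    {L M : ℝ} (hL : 0 ≤ L) (hM : 0 ≤ M) :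
    ∫⁻ h : E N, ENNReal.ofReal ((min (L * ‖h‖) M) ^ p / ‖h‖ ^ ((N : ℝ) + p * s)) < ⊤ := by
  have hps0 : 0 < p * s := by positivity
  have := nontrivial_E hN
  rw [← lintegral_add_compl _ (Metric.isOpen_ball (x := (0 : E N)) (ε := 1)).measurableSet]
  refine ENNReal.add_lt_top.2 ⟨?_, ?_⟩
  · refine lt_of_le_of_lt (lintegral_mono_ae (g := fun h => ENNReal.ofReal (L ^ p) *
      ENNReal.ofReal (‖h‖ ^ (p - ((N : ℝ) + p * s)))) ?_) ?_
    · filter_upwards [ae_restrict_of_ae (Measure.ae_ne volume (0 : E N))] with h hh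
      have hh := norm_pos_iff.2 hh
      rw [← ENNReal.ofReal_mul (by positivity)]
      apply ENNReal.ofReal_le_ofReal
      rw [Real.rpow_sub hh, ← mul_div_assoc, ← Real.mul_rpow hL hh.le]
      have : 0 ≤ min (L * ‖h‖) M := le_min (by positivity) hM
      gcongr
      exact min_le_left _ _
    · rw [lintegral_const_mul' _ _ ENNReal.ofReal_ne_top]
      refine ENNReal.mul_lt_top ENNReal.ofReal_lt_top (lintegral_norm_rpow_ball_lt_top hN ?_)
      nlinarith
  · refine lt_of_le_of_lt (setLIntegral_mono' (g := fun h => ENNReal.ofReal (M ^ p) *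
      ENNReal.ofReal (‖h‖ ^ (-((N : ℝ) + p * s))))
      Metric.isOpen_ball.measurableSet.compl fun h hh => ?_) ?_
    · rw [← ENNReal.ofReal_mul (by positivity)]
      apply ENNReal.ofReal_le_ofReal
      rw [Real.rpow_neg (norm_nonneg _), ← div_eq_mul_inv]
      have : 0 ≤ min (L * ‖h‖) M := le_min (by positivity) hM
      gcongr
      exact min_le_right _ _
    · rw [lintegral_const_mul' _ _ ENNReal.ofReal_ne_top]
      refine ENNReal.mul_lt_top ENNReal.ofReal_lt_top
        (lintegral_norm_rpow_compl_ball_lt_top hN one_pos ?_)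
      linarith

theorem memLp_dominator (hN : 1 < N) (hp : 2 < p) (hs0 : 0 < s) (hs1 : s < 1)
    {L M : ℝ} (hL : 0 ≤ L) (hM : 0 ≤ M) (R : ℝ) :
    MemLp (dominator N p s L M R) (ENNReal.ofReal p) volume := by
  rw [memLp_iff_lintegral_rpow hp (measurable_dominator L M R).aestronglyMeasurable]
  set k : E N → ℝ≥0∞ := fun h =>
    ENNReal.ofReal ((min (L * ‖h‖) M) ^ p / ‖h‖ ^ ((N : ℝ) + p * s)) with hk
  have hkm : Measurable k := by fun_prop
  have hkt : ∫⁻ h, k h < ⊤ := lintegral_kernel_lt_top hN hp hs0 hs1 hL hM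
  set B : Set (E N) := Metric.closedBall 0 R with hB
  have hBm : MeasurableSet B := Metric.isClosed_closedBall.measurableSet
  -- A pair in the support has at least one end in the ball. With that end fixed, translation
  -- invariance makes the integral over the other one equal to `∫ k`.
  have hle : ∀ z : E N × E N, ENNReal.ofReal (|dominator N p s L M R z| ^ p) ≤
      B.indicator 1 z.1 * k (z.1 - z.2) + B.indicator 1 z.2 * k (z.1 - z.2) := by
    intro z
    by_cases hz : ‖z.1‖ ≤ R ∨ ‖z.2‖ ≤ R
    · have e : ENNReal.ofReal (|dominator N p s L M R z| ^ p) = k (z.1 - z.2) := by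
        rw [dominator, indicator_of_mem (by exact hz), abs_div,
          Real.div_rpow (abs_nonneg _) (abs_nonneg _),
          abs_of_nonneg (show 0 ≤ ‖z.1 - z.2‖ ^ (((N : ℝ) + p * s) / p) by positivity),
          ← Real.rpow_mul (norm_nonneg _), div_mul_cancel₀ _ (by linarith),
          abs_of_nonneg (le_min (by positivity) hM)]
      rw [e]
      rcases hz with h | h
      · rw [indicator_of_mem (show z.1 ∈ B by simpa [hB] using h)]; simp
      · rw [indicator_of_mem (show z.2 ∈ B by simpa [hB] using h)]; simp
    · rw [dominator, indicator_of_notMem (by exact hz), abs_zero, Real.zero_rpow (by linarith),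
        ENNReal.ofReal_zero]
      positivity
  refine (lintegral_mono hle).trans_lt ?_
  have hi : Measurable (B.indicator (1 : E N → ℝ≥0∞)) := measurable_one.indicator hBm
  have hm1 : Measurable fun z : E N × E N => B.indicator (1 : E N → ℝ≥0∞) z.1 * k (z.1 - z.2) :=
    (hi.comp measurable_fst).mul (hkm.comp (by fun_prop))
  have hm2 : Measurable fun z : E N × E N => B.indicator (1 : E N → ℝ≥0∞) z.2 * k (z.1 - z.2) :=
    (hi.comp measurable_snd).mul (hkm.comp (by fun_prop))
  have hBf : ∫⁻ x, B.indicator (1 : E N → ℝ≥0∞) x < ⊤ := by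
    rw [lintegral_indicator_one hBm]; exact measure_closedBall_lt_top
  rw [lintegral_add_left hm1, Measure.volume_eq_prod]
  refine ENNReal.add_lt_top.2 ⟨?_, ?_⟩
  · rw [lintegral_prod _ hm1.aemeasurable]
    have : ∀ x : E N, ∫⁻ y, B.indicator (1 : E N → ℝ≥0∞) x * k (x - y) =
        B.indicator (1 : E N → ℝ≥0∞) x * ∫⁻ h, k h := fun x => by
      rw [lintegral_const_mul _ (f := fun y => k (x - y)) (hkm.comp (by fun_prop)),
        lintegral_sub_left_eq_self k x]
    simp only [this]
    rw [lintegral_mul_const _ hi]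
    exact ENNReal.mul_lt_top hBf hkt
  · rw [lintegral_prod_symm _ hm2.aemeasurable]
    have : ∀ y : E N, ∫⁻ x, B.indicator (1 : E N → ℝ≥0∞) y * k (x - y) =
        B.indicator (1 : E N → ℝ≥0∞) y * ∫⁻ h, k h := fun y => by
      rw [lintegral_const_mul _ (f := fun x => k (x - y)) (hkm.comp (by fun_prop)),
        lintegral_sub_right_eq_self k y]
    simp only [this]
    rw [lintegral_mul_const _ hi]
    exact ENNReal.mul_lt_top hBf hkt

theorem abs_dq_le_dominator {φ : E N → ℝ} {L M R : ℝ}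
    (hL : ∀ x y, |φ x - φ y| ≤ L * ‖x - y‖) (hM : ∀ x y, |φ x - φ y| ≤ M)
    (hR : ∀ x, R < ‖x‖ → φ x = 0) (z : E N × E N) :
    |dq p s φ z| ≤ dominator N p s L M R z := by
  by_cases hz : ‖z.1‖ ≤ R ∨ ‖z.2‖ ≤ R
  · rw [dominator, indicator_of_mem (by exact hz), dq, abs_div,
      abs_of_nonneg (show 0 ≤ ‖z.1 - z.2‖ ^ (((N : ℝ) + p * s) / p) by positivity)]
    gcongr
    exact le_min (hL _ _) (hM _ _)
  · rw [dominator, indicator_of_notMem (by exact hz)]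
    push Not at hz
    rw [dq, hR _ hz.1, hR _ hz.2]; simp

theorem memLp_dq_of_lipschitz (hN : 1 < N) (hp : 2 < p) (hs0 : 0 < s) (hs1 : s < 1)
    {φ : E N → ℝ} {K : NNReal} (hφ : LipschitzWith K φ) {R : ℝ} (hR : ∀ x, R < ‖x‖ → φ x = 0) :
    MemLp (dq p s φ) (ENNReal.ofReal p) volume := by
  have hc : HasCompactSupport φ := HasCompactSupport.intro (isCompact_closedBall 0 R) fun x hx => by
    apply hR; simpa using hx
  obtain ⟨M, hM⟩ := hc.exists_bound_of_continuous hφ.continuous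
  have hM0 : 0 ≤ M := (norm_nonneg _).trans (hM 0)
  refine (memLp_dominator hN hp hs0 hs1 K.2 (show 0 ≤ M + M by linarith) R).mono'
    (measurable_dq hφ.continuous.measurable).aestronglyMeasurable (.of_forall fun z => ?_)
  refine abs_dq_le_dominator (fun x y => ?_) (fun x y => ?_) hR z
  · rw [← Real.dist_eq, ← dist_eq_norm]; exact hφ.dist_le_mul x y
  · exact (norm_sub_le _ _).trans (add_le_add (hM x) (hM y))

end dominator

/-! ### From distributional to pointwise differential inequalities -/

theorem exists_bump_primitive {δ : ℝ} (hδ : 0 < δ) :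
    ∃ (ρ : ContDiffBump (0 : ℝ)) (P : ℝ → ℝ), ρ.rOut = δ ∧ ContDiff ℝ ∞ P ∧
      (∀ t, HasDerivAt P (ρ.normed volume t) t) ∧ (∀ t ≤ -δ, P t = 0) ∧ (∀ t ≥ δ, P t = 1) ∧
      Monotone P := by
  let ρ : ContDiffBump (0 : ℝ) := ⟨δ / 2, δ, by positivity, by linarith⟩
  have hsupp : Function.support (ρ.normed volume) = Metric.ball 0 δ := ρ.support_normed_eq
  have hzero : ∀ t, δ ≤ |t| → ρ.normed volume t = 0 := by
    intro t ht
    by_contra hne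
    have : t ∈ Metric.ball (0 : ℝ) δ := hsupp ▸ Function.mem_support.2 hne
    rw [Metric.mem_ball, dist_zero_right, Real.norm_eq_abs] at this
    linarith
  have hcont : Continuous (ρ.normed volume) := ρ.continuous_normed
  have hderiv : ∀ t, HasDerivAt (fun t => ∫ τ in (-δ)..t, ρ.normed volume τ)
      (ρ.normed volume t) t := fun t =>
    intervalIntegral.integral_hasDerivAt_right (hcont.intervalIntegrable _ _)
      (hcont.stronglyMeasurableAtFilter _ _) hcont.continuousAt
  refine ⟨ρ, fun t => ∫ τ in (-δ)..t, ρ.normed volume τ, rfl, ?_, hderiv, ?_, ?_, ?_⟩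
  · rw [contDiff_infty_iff_deriv]
    refine ⟨fun t => (hderiv t).differentiableAt, ?_⟩
    rw [funext fun t => (hderiv t).deriv]
    exact ρ.contDiff_normed
  · intro t ht
    simp only
    rw [intervalIntegral.integral_congr (g := fun _ => (0 : ℝ)), intervalIntegral.integral_zero]
    intro τ hτ
    rw [uIcc_of_ge ht] at hτ
    refine hzero τ ?_
    rw [abs_of_nonpos (by linarith [hτ.2])]; linarith [hτ.2]
  · intro t ht
    simp only
    rw [intervalIntegral.integral_of_le (by linarith), ← ρ.integral_normed (μ := volume)]
    refine setIntegral_eq_integral_of_ae_compl_eq_zero (.of_forall fun τ hτ => hzero τ ?_)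
    rw [mem_Ioc, not_and_or, not_lt, not_le] at hτ
    rcases hτ with h | h
    · rw [abs_of_nonpos (by linarith)]; linarith
    · rw [abs_of_nonneg (by linarith)]; linarith
  · refine monotone_of_hasDerivAt_nonneg hderiv fun t => ρ.nonneg_normed t

/-- The tests are `P (t - t₁) - P (t - t₂)` with `P` a smoothed Heaviside step: they tend to the
indicator of `(t₁, t₂)`, and their derivatives to the difference of the Dirac masses at `t₁` and
`t₂`, against which a continuous `m` can be evaluated. The one-sided form serves both the weak
formulation, applied to `m` and `-m`, and the mass inequality. -/
theorem sub_le_integral_of_distrib {T : ℝ} {m q : ℝ → ℝ} (hm : ContinuousOn m (Ioo 0 T))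
    (hq : IntegrableOn q (Ioo 0 T))
    (h : ∀ η : ℝ → ℝ, ContDiff ℝ ∞ η → HasCompactSupport η → tsupport η ⊆ Ioo 0 T →
      (∀ t, 0 ≤ η t) → -(∫ t in Ioo 0 T, deriv η t * m t) ≤ ∫ t in Ioo 0 T, η t * q t)
    {t₁ t₂ : ℝ} (h₁ : 0 < t₁) (h₁₂ : t₁ < t₂) (h₂ : t₂ < T) :
    m t₂ - m t₁ ≤ ∫ t in Ioo t₁ t₂, q t := by
  obtain ⟨c, hc, hc1, hc2, hc3⟩ : ∃ c > 0, c < t₁ ∧ c < T - t₂ ∧ 2 * c < t₂ - t₁ := by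
    refine ⟨min (t₁ / 2) (min ((T - t₂) / 2) ((t₂ - t₁) / 4)), ?_, ?_, ?_, ?_⟩
    · refine lt_min (by linarith) (lt_min (by linarith) (by linarith))
    · exact (min_le_left _ _).trans_lt (by linarith)
    · exact ((min_le_right _ _).trans (min_le_left _ _)).trans_lt (by linarith)
    · have := (min_le_right (t₁ / 2) _).trans (min_le_right ((T - t₂) / 2) ((t₂ - t₁) / 4))
      linarith
  have hδpos : ∀ n : ℕ, 0 < c / (n + 1) := fun n => by positivity
  have hδle : ∀ n : ℕ, c / ((n : ℝ) + 1) ≤ c := fun n => by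
    apply div_le_self hc.le; linarith [n.cast_nonneg (α := ℝ)]
  have hδlim : Tendsto (fun n : ℕ => c / ((n : ℝ) + 1)) atTop (𝓝 0) := by
    have := (tendsto_one_div_add_atTop_nhds_zero_nat (𝕜 := ℝ)).const_mul c
    simpa [div_eq_mul_inv] using this
  choose ρ P hρ hPs hPd hP0 hP1 hPm using fun n => exists_bump_primitive (hδpos n)
  set M : ℝ → ℝ := (Ioo 0 T).indicator m with hM
  have hMm : AEStronglyMeasurable M volume :=
    (aestronglyMeasurable_indicator_iff measurableSet_Ioo).2 (hm.aestronglyMeasurable measurableSet_Ioo)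
  have hlim : ∀ t₀ ∈ Ioo 0 T, Tendsto (fun n => ∫ t, (ρ n).normed volume (t - t₀) * M t) atTop
      (𝓝 (m t₀)) := by
    intro t₀ ht₀
    have hMt : M t₀ = m t₀ := indicator_of_mem ht₀ _
    have hcont : ContinuousAt M t₀ := by
      refine (hm.continuousAt (Ioo_mem_nhds ht₀.1 ht₀.2)).congr ?_
      filter_upwards [Ioo_mem_nhds ht₀.1 ht₀.2] with t ht
      rw [hM, indicator_of_mem ht]
    have := ContDiffBump.convolution_tendsto_right (μ := volume) (φ := ρ) (g := fun _ => M)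
      (k := fun _ => t₀) (x₀ := t₀) (z₀ := M t₀) (l := atTop) (by simpa only [hρ] using hδlim)
      (.of_forall fun _ => hMm) (hcont.tendsto.comp tendsto_snd) tendsto_const_nhds
    rw [hMt] at this
    refine this.congr fun n => ?_
    rw [convolution_eq_swap]
    refine integral_congr_ae (.of_forall fun t => ?_)
    simp only [ContinuousLinearMap.lsmul_apply, smul_eq_mul]
    rw [← neg_sub t t₀, ContDiffBump.normed_neg]
  set η : ℕ → ℝ → ℝ := fun n t => P n (t - t₁) - P n (t - t₂) with hη
  have hηd : ∀ n t, HasDerivAt (η n)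
      ((ρ n).normed volume (t - t₁) - (ρ n).normed volume (t - t₂)) t := fun n t =>
    ((hPd n (t - t₁)).comp_sub_const t t₁).sub ((hPd n (t - t₂)).comp_sub_const t t₂)
  have hη0 : ∀ (n : ℕ) (t : ℝ), t ∉ Icc (t₁ - c / ((n : ℝ) + 1)) (t₂ + c / ((n : ℝ) + 1)) → η n t = 0 := by
    intro n t ht
    have := hδpos n
    rw [mem_Icc, not_and_or, not_le, not_le] at ht
    rcases ht with ht | ht
    · simp only [hη]
      rw [hP0 n _ (by linarith), hP0 n _ (by linarith), sub_self]
    · simp only [hη]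
      rw [hP1 n _ (by linarith), hP1 n _ (by linarith), sub_self]
  have hηts : ∀ n, tsupport (η n) ⊆ Icc (t₁ - c / ((n : ℝ) + 1)) (t₂ + c / ((n : ℝ) + 1)) := fun n =>
    closure_minimal (fun t ht => by_contra fun hh => ht (hη0 n t hh)) isClosed_Icc
  have hP01 : ∀ n t, 0 ≤ P n t ∧ P n t ≤ 1 := by
    intro n t
    have := hδpos n
    refine ⟨?_, ?_⟩
    · rw [← hP0 n (min t (-(c / ((n : ℝ) + 1)))) (min_le_right _ _)]
      exact hPm n (min_le_left _ _)
    · rw [← hP1 n (max t (c / ((n : ℝ) + 1))) (le_max_right _ _)]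
      exact hPm n (le_max_left _ _)
  have hηnn : ∀ n t, 0 ≤ η n t := fun n t => sub_nonneg.2 (hPm n (by linarith))
  have key : ∀ n, -(∫ t, deriv (η n) t * M t) ≤ ∫ t in Ioo 0 T, η n t * q t := by
    intro n
    have hI : Icc (t₁ - c / ((n : ℝ) + 1)) (t₂ + c / ((n : ℝ) + 1)) ⊆ Ioo 0 T := fun t ht => by
      have := hδle n
      exact ⟨by linarith [ht.1], by linarith [ht.2]⟩
    have h1 := h (η n) (((hPs n).comp (contDiff_id.sub contDiff_const)).sub
      ((hPs n).comp (contDiff_id.sub contDiff_const)))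
      (HasCompactSupport.of_support_subset_isCompact isCompact_Icc
        (subset_tsupport _ |>.trans (hηts n))) ((hηts n).trans hI) (hηnn n)
    refine le_trans (le_of_eq ?_) h1
    rw [← integral_indicator measurableSet_Ioo]
    congr 1
    refine integral_congr_ae (.of_forall fun t => ?_)
    simp only [hM, indicator]
    split_ifs <;> simp
  have hint : ∀ n, ∀ t₀, t₁ ≤ t₀ → t₀ ≤ t₂ →
      Integrable (fun t => (ρ n).normed volume (t - t₀) * M t) := by
    intro n t₀ ht1 ht2
    have hK : Icc (t₀ - c) (t₀ + c) ⊆ Ioo 0 T := fun t ht =>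
      ⟨by linarith [ht.1], by linarith [ht.2]⟩
    have hcK : ContinuousOn (fun t => (ρ n).normed volume (t - t₀) * M t) (Icc (t₀ - c) (t₀ + c)) := by
      refine ((ρ n).continuous_normed.comp (continuous_id.sub continuous_const)).continuousOn.mul ?_
      exact (hm.mono hK).congr fun t ht => indicator_of_mem (hK ht) _
    rw [← integrableOn_iff_integrable_of_support_subset (s := Icc (t₀ - c) (t₀ + c))]
    · exact hcK.integrableOn_compact isCompact_Icc
    · intro t ht
      have h1 : t - t₀ ∈ Function.support ((ρ n).normed volume) := fun h0 => ht (by simp [h0])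
      rw [ContDiffBump.support_normed_eq, hρ, Metric.mem_ball, dist_zero_right, Real.norm_eq_abs,
        abs_lt] at h1
      have := hδle n
      exact ⟨by linarith [h1.1], by linarith [h1.2]⟩
  have hL : Tendsto (fun n => -(∫ t, deriv (η n) t * M t)) atTop (𝓝 (m t₂ - m t₁)) := by
    have h0 := ((hlim t₂ ⟨by linarith, h₂⟩).sub (hlim t₁ ⟨h₁, by linarith⟩))
    refine h0.congr fun n => ?_
    rw [← integral_sub (hint n t₂ h₁₂.le le_rfl) (hint n t₁ le_rfl h₁₂.le), ← integral_neg]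
    refine integral_congr_ae (.of_forall fun t => ?_)
    simp only
    rw [(hηd n t).deriv]; ring
  have hR : Tendsto (fun n => ∫ t in Ioo 0 T, η n t * q t) atTop
      (𝓝 (∫ t in Ioo 0 T, (Ioo t₁ t₂).indicator q t)) := by
    refine tendsto_integral_of_dominated_convergence (fun t => |q t|) ?_ hq.abs ?_ ?_
    · intro n
      refine AEStronglyMeasurable.mul ?_ hq.1
      have : Continuous (η n) := continuous_iff_continuousAt.2 fun t => (hηd n t).continuousAt
      exact this.aestronglyMeasurable
    · refine fun n => .of_forall fun t => ?_
      rw [norm_mul, Real.norm_eq_abs, Real.norm_eq_abs]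
      refine mul_le_of_le_one_left (abs_nonneg _) ?_
      rw [abs_of_nonneg (hηnn n t)]
      linarith [(hP01 n (t - t₁)).2, (hP01 n (t - t₂)).1]
    · filter_upwards [ae_restrict_of_ae (Measure.ae_ne volume t₁),
        ae_restrict_of_ae (Measure.ae_ne volume t₂)] with t ht1 ht2
      -- Away from the jump the smoothed step eventually agrees with the Heaviside function, so the
      -- two excluded times are the only exceptions.
      have hev : ∀ a : ℝ, a ≠ 0 → ∀ᶠ n : ℕ in atTop, P n a = if 0 < a then 1 else 0 := by
        intro a ha
        filter_upwards [hδlim.eventually (gt_mem_nhds (abs_pos.2 ha))] with n hn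
        split_ifs with h0
        · exact hP1 n a (by rw [abs_of_pos h0] at hn; exact hn.le)
        · refine hP0 n a ?_
          rw [abs_of_nonpos (not_lt.1 h0)] at hn; linarith
      refine tendsto_const_nhds.congr' ?_
      filter_upwards [hev (t - t₁) (sub_ne_zero.2 ht1), hev (t - t₂) (sub_ne_zero.2 ht2)] with n e1 e2
      simp only [hη, e1, e2, indicator, mem_Ioo, sub_pos]
      by_cases a1 : t₁ < t <;> by_cases a2 : t₂ < t
      · simp [a1, a2, a2.not_gt]
      · have : t < t₂ := lt_of_le_of_ne (not_lt.1 a2) ht2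
        simp [a1, a2, this]
      · exact absurd (h₁₂.trans a2) a1
      · simp [a1, a2]
  have hfin := le_of_tendsto_of_tendsto' hL hR key
  rwa [setIntegral_indicator measurableSet_Ioo, inter_eq_self_of_subset_right
    (Ioo_subset_Ioo h₁.le h₂.le)] at hfin

/-! ### Hölder pairings and translations -/

section Holder

variable {α : Type*} [MeasurableSpace α] {μ : Measure α} {P P' : ℝ≥0∞} [P'.HolderConjugate P]

theorem integrable_mul_of_memLp {F G : α → ℝ} (hF : MemLp F P' μ) (hG : MemLp G P μ) :
    Integrable (fun x => F x * G x) μ := by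
  rw [← memLp_one_iff_integrable]
  exact hG.mul' hF

theorem lintegral_mul_le_of_memLp {F G : α → ℝ} (hF : AEStronglyMeasurable F μ)
    (hG : AEStronglyMeasurable G μ) :
    ∫⁻ x, ‖F x * G x‖ₑ ∂μ ≤ eLpNorm F P' μ * eLpNorm G P μ := by
  have := eLpNorm_smul_le_mul_eLpNorm (p := P') (q := P) (r := 1) hG hF
  rwa [eLpNorm_one_eq_lintegral_enorm] at this

theorem abs_integral_mul_le {F G : α → ℝ} (hF : MemLp F P' μ) (hG : MemLp G P μ) :
    |∫ x, F x * G x ∂μ| ≤ (eLpNorm F P' μ).toReal * (eLpNorm G P μ).toReal := by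
  rw [← ENNReal.toReal_mul, ← Real.norm_eq_abs]
  refine (norm_integral_le_lintegral_norm _).trans ?_
  refine ENNReal.toReal_mono (ENNReal.mul_ne_top hF.2.ne hG.2.ne) ?_
  refine le_trans (le_of_eq ?_) (lintegral_mul_le_of_memLp hF.1 hG.1)
  exact lintegral_congr fun x => ofReal_norm _

end Holder

section Translation

variable {Z : Type*} [NormedAddCommGroup Z] [NormedSpace ℝ Z] [FiniteDimensional ℝ Z]
  [MeasureSpace Z] [BorelSpace Z] [(volume : Measure Z).IsAddHaarMeasure]
  {P P' : ℝ≥0∞} [P'.HolderConjugate P]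

theorem measurePreserving_time_shift (σ : ℝ) :
    MeasurePreserving (fun x : ℝ × Z => (x.1 - σ, x.2)) volume volume := by
  have := (measurePreserving_sub_right (volume : Measure ℝ) σ).prod
    (MeasurePreserving.id (volume : Measure Z))
  exact this

/-- Translations act continuously on `L^{P'}` because `P' < ⊤`; nothing but integrability is asked
of `W`. -/
theorem continuous_translation_pairing (hP' : P' ≠ ⊤) {F W : ℝ × Z → ℝ}
    (hF : MemLp F P' volume) (hW : MemLp W P volume) :
    Continuous fun σ : ℝ => ∫ x : ℝ × Z, F (x.1 - σ, x.2) * W x := by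
  have : Fact (1 ≤ P') := ⟨ENNReal.HolderTriple.le P' P 1⟩
  have : Fact (1 ≤ P) := ⟨ENNReal.HolderTriple.le P P' 1⟩
  let g : ℝ → C(ℝ × Z, ℝ × Z) := fun σ => ⟨fun x => (x.1 - σ, x.2), by fun_prop⟩
  have hg : Continuous g := ContinuousMap.continuous_of_continuous_uncurry _ (by
    show Continuous fun y : ℝ × (ℝ × Z) => (y.2.1 - y.1, y.2.2)
    fun_prop)
  have hgm : ∀ σ, MeasurePreserving (g σ) (volume : Measure (ℝ × Z)) volume :=
    fun σ => measurePreserving_time_shift σ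
  have hc : Continuous fun σ => Lp.compMeasurePreserving (g σ) (hgm σ) (hF.toLp F) :=
    (continuous_const (y := hF.toLp F)).compMeasurePreservingLp hg hgm hP'
  have hpair : Continuous fun σ => (ContinuousLinearMap.mul ℝ ℝ).lpPairing volume P' P
      (Lp.compMeasurePreserving (g σ) (hgm σ) (hF.toLp F)) (hW.toLp W) := by
    fun_prop
  refine hpair.congr fun σ => ?_
  rw [ContinuousLinearMap.lpPairing_eq_integral]
  refine integral_congr_ae ?_
  filter_upwards [Lp.coeFn_compMeasurePreserving (hF.toLp F) (hgm σ), hW.coeFn_toLp,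
    (hgm σ).quasiMeasurePreserving.ae_eq_comp hF.coeFn_toLp] with x h1 h2 h3
  rw [ContinuousLinearMap.mul_apply', h1, h2, h3]
  rfl

theorem tendsto_average_translation_pairing (hP' : P' ≠ ⊤) {F W : ℝ × Z → ℝ}
    (hF : MemLp F P' volume) (hW : MemLp W P volume) :
    Tendsto (fun h : ℝ => (1 / h) * ∫ σ in Ioo 0 h, ∫ x : ℝ × Z, F (x.1 - σ, x.2) * W x)
      (𝓝[>] 0) (𝓝 (∫ x : ℝ × Z, F x * W x)) := by
  have hc := continuous_translation_pairing hP' hF hW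
  set R : ℝ → ℝ := fun σ => ∫ x : ℝ × Z, F (x.1 - σ, x.2) * W x with hR
  have hd : HasDerivAt (fun h => ∫ σ in (0 : ℝ)..h, R σ) (R 0) 0 :=
    intervalIntegral.integral_hasDerivAt_right (hc.intervalIntegrable _ _)
      (hc.stronglyMeasurableAtFilter _ _) hc.continuousAt
  have h0 : R 0 = ∫ x : ℝ × Z, F x * W x := by simp [hR]
  rw [← h0]
  have := hd.tendsto_slope_zero_right
  refine this.congr' ?_
  filter_upwards [self_mem_nhdsWithin] with h hh
  have hh : (0 : ℝ) < h := hh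
  simp only [zero_add, intervalIntegral.integral_same, sub_zero, smul_eq_mul, one_div]
  rw [intervalIntegral.integral_of_le hh.le, integral_Ioc_eq_integral_Ioo]

theorem integrable_translation_pairing {F W : ℝ × Z → ℝ}
    (hFm : Measurable F) (hWm : Measurable W) (hF : MemLp F P' volume) (hW : MemLp W P volume)
    (h : ℝ) :
    Integrable (fun y : ℝ × (ℝ × Z) => F (y.2.1 - y.1, y.2.2) * W y.2)
      ((volume.restrict (Ioo 0 h)).prod volume) := by
  refine ⟨by apply Measurable.aestronglyMeasurable; fun_prop, ?_⟩
  rw [hasFiniteIntegral_iff_enorm, lintegral_prod _ (by fun_prop)]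
  refine (lintegral_mono (g := fun _ => eLpNorm F P' volume * eLpNorm W P volume) fun σ => ?_).trans_lt ?_
  · have hs := measurePreserving_time_shift (Z := Z) σ
    have := lintegral_mul_le_of_memLp (P := P) (P' := P') (μ := (volume : Measure (ℝ × Z)))
      (hF.comp_measurePreserving hs).1 hW.1
    rw [eLpNorm_comp_measurePreserving hF.1 hs] at this
    exact this
  · rw [lintegral_const]
    exact ENNReal.mul_lt_top (ENNReal.mul_lt_top hF.2 hW.2) (by simp)

theorem integral_translation_pairing {F W : ℝ × Z → ℝ}
    (hFm : Measurable F) (hWm : Measurable W) (hF : MemLp F P' volume) (hW : MemLp W P volume)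
    (h : ℝ) :
    Integrable (fun t => ∫ τ in Ioo (t - h) t, ∫ z, F (τ, z) * W (t, z)) ∧
    ∫ t, ∫ τ in Ioo (t - h) t, ∫ z, F (τ, z) * W (t, z) =
      ∫ σ in Ioo 0 h, ∫ x : ℝ × Z, F (x.1 - σ, x.2) * W x := by
  have hI := integrable_translation_pairing (P := P) hFm hWm hF hW h
  have hsub : ∀ t, ∫ τ in Ioo (t - h) t, ∫ z, F (τ, z) * W (t, z) =
      ∫ σ in Ioo 0 h, ∫ z, F (t - σ, z) * W (t, z) := by
    intro t
    rw [← integral_indicator measurableSet_Ioo, ← integral_indicator measurableSet_Ioo,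
      ← integral_sub_left_eq_self _ volume t]
    refine integral_congr_ae (.of_forall fun σ => ?_)
    simp only [indicator, mem_Ioo]
    have : (t - h < t - σ ∧ t - σ < t) ↔ (0 < σ ∧ σ < h) := by
      constructor <;> rintro ⟨a, b⟩ <;> constructor <;> linarith
    simp only [this]
  simp only [hsub]
  have hI2 : Integrable (fun y : (ℝ × ℝ) × Z => F (y.1.2 - y.1.1, y.2) * W (y.1.2, y.2))
      (((volume.restrict (Ioo 0 h)).prod volume).prod volume) := by
    have e := (measurePreserving_prodAssoc (volume.restrict (Ioo 0 h)) (volume : Measure ℝ)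
      (volume : Measure Z))
    exact (e.integrable_comp_emb MeasurableEquiv.prodAssoc.measurableEmbedding).2 hI
  have hI3 : Integrable (fun y : ℝ × ℝ => ∫ z, F (y.2 - y.1, z) * W (y.2, z))
      ((volume.restrict (Ioo 0 h)).prod volume) := hI2.integral_prod_left
  refine ⟨hI3.integral_prod_right, ?_⟩
  rw [integral_integral_swap (f := fun t σ => ∫ z, F (t - σ, z) * W (t, z)) hI3.swap]
  refine integral_congr_ae ?_
  filter_upwards [hI.prod_right_ae] with σ hσ
  exact (integral_prod _ hσ).symm

/-- Removes time averages of Steklov type. Pairing the average of `F` over `(t - h, t)` with `W` at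
time `t` is, by `τ = t - σ`, an average of pairings of translates of `F` with `W`, hence converges
to the pairing at equal times. No regularity in time is needed. -/
theorem tendsto_average_pairing (hP' : P' ≠ ⊤) {F W : ℝ × Z → ℝ}
    (hFm : Measurable F) (hWm : Measurable W) (hF : MemLp F P' volume) (hW : MemLp W P volume) :
    Tendsto (fun h : ℝ => (1 / h) * ∫ t, ∫ τ in Ioo (t - h) t, ∫ z, F (τ, z) * W (t, z))
      (𝓝[>] 0) (𝓝 (∫ t, ∫ z, F (t, z) * W (t, z))) := by
  have h1 := tendsto_average_translation_pairing hP' hF hW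
  have h2 : ∫ x : ℝ × Z, F x * W x = ∫ t, ∫ z, F (t, z) * W (t, z) :=
    integral_prod _ (integrable_mul_of_memLp hF hW)
  rw [h2] at h1
  refine h1.congr fun h => ?_
  rw [(integral_translation_pairing hFm hWm hF hW h).2]

end Translation

theorem eLpNorm_comp_snd_restrict_rpow {Z : Type*} [MeasureSpace Z]
    [SFinite (volume : Measure Z)] {p : ℝ} (hp : 2 < p)
    (I : Set ℝ) {w : Z → ℝ} (hw : Measurable w) :
    eLpNorm (fun x : ℝ × Z => w x.2) (ENNReal.ofReal p) ((volume.restrict I).prod volume) ^ p =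
      volume I * eLpNorm w (ENNReal.ofReal p) volume ^ p := by
  rw [← lintegral_rpow_eq_eLpNorm_rpow hp, ← lintegral_rpow_eq_eLpNorm_rpow hp,
    lintegral_prod _ (by fun_prop)]
  simp [mul_comm]

theorem holderConjugate_ofReal {p : ℝ} (hp : 2 < p) :
    (ENNReal.ofReal (p / (p - 1))).HolderConjugate (ENNReal.ofReal p) := by
  have h : p.HolderConjugate (p / (p - 1)) :=
    (Real.holderConjugate_iff_eq_conjExponent (by linarith)).2 rfl
  exact h.symm.ennrealOfReal

/-! ### Pairings of space-time functions with functions of space -/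

section Pairing

variable {Z : Type*} [MeasureSpace Z] [SFinite (volume : Measure Z)] {p : ℝ}

theorem memLp_restrict_prod {P : ℝ≥0∞} {F : ℝ × Z → ℝ} (hF : MemLp F P volume) (I : Set ℝ) :
    MemLp F P ((volume.restrict I).prod volume) :=
  hF.mono_measure (Measure.prod_mono Measure.restrict_le_self le_rfl)

theorem memLp_comp_snd_restrict (hp : 2 < p) {I : Set ℝ} (hI : volume I < ⊤) {w : Z → ℝ}
    (hwm : Measurable w) (hw : MemLp w (ENNReal.ofReal p) volume) :
    MemLp (fun x : ℝ × Z => w x.2) (ENNReal.ofReal p) ((volume.restrict I).prod volume) := by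
  have hp0 : 0 < p := by linarith
  refine ⟨by apply Measurable.aestronglyMeasurable; fun_prop, ?_⟩
  rw [← ENNReal.rpow_lt_top_iff_of_pos hp0, eLpNorm_comp_snd_restrict_rpow hp I hwm]
  exact ENNReal.mul_lt_top hI (ENNReal.rpow_lt_top_of_nonneg hp0.le hw.2.ne)

theorem integrableOn_pairing (hp : 2 < p) {F : ℝ × Z → ℝ}
    (hF : MemLp F (ENNReal.ofReal (p / (p - 1))) volume) {I : Set ℝ} (hI : volume I < ⊤) {w : Z → ℝ}
    (hwm : Measurable w) (hw : MemLp w (ENNReal.ofReal p) volume) :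
    IntegrableOn (fun τ => ∫ z, F (τ, z) * w z) I := by
  have := holderConjugate_ofReal hp
  exact (integrable_mul_of_memLp (memLp_restrict_prod hF I)
    (memLp_comp_snd_restrict hp hI hwm hw)).integral_prod_left

theorem tendsto_integral_pairing (hp : 2 < p) {F : ℝ × Z → ℝ}
    (hF : MemLp F (ENNReal.ofReal (p / (p - 1))) volume) {I : Set ℝ} (hI : volume I < ⊤)
    {w : Z → ℝ} {wk : ℕ → Z → ℝ} (hwm : Measurable w) (hw : MemLp w (ENNReal.ofReal p) volume)
    (hwkm : ∀ k, Measurable (wk k)) (hwk : ∀ k, MemLp (wk k) (ENNReal.ofReal p) volume)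
    (hlim : Tendsto (fun k => eLpNorm (fun z => wk k z - w z) (ENNReal.ofReal p) volume) atTop
      (𝓝 0)) :
    Tendsto (fun k => ∫ τ in I, ∫ z, F (τ, z) * wk k z) atTop
      (𝓝 (∫ τ in I, ∫ z, F (τ, z) * w z)) := by
  have := holderConjugate_ofReal hp
  have hp0 : 0 < p := by linarith
  have hFI := memLp_restrict_prod hF I
  have hint : ∀ {u : Z → ℝ}, Measurable u → MemLp u (ENNReal.ofReal p) volume →
      Integrable (fun x : ℝ × Z => F x * u x.2) ((volume.restrict I).prod volume) :=
    fun hum hu => integrable_mul_of_memLp hFI (memLp_comp_snd_restrict hp hI hum hu)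
  have heq : ∀ {u : Z → ℝ}, Measurable u → MemLp u (ENNReal.ofReal p) volume →
      ∫ τ in I, ∫ z, F (τ, z) * u z = ∫ x, F x * u x.2 ∂((volume.restrict I).prod volume) :=
    fun hum hu => (integral_prod _ (hint hum hu)).symm
  rw [heq hwm hw]
  simp only [heq (hwkm _) (hwk _)]
  rw [tendsto_iff_norm_sub_tendsto_zero]
  set C := (eLpNorm F (ENNReal.ofReal (p / (p - 1))) ((volume.restrict I).prod volume)).toReal
  have hbound : ∀ k, ‖(∫ x, F x * wk k x.2 ∂((volume.restrict I).prod volume)) -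
      ∫ x, F x * w x.2 ∂((volume.restrict I).prod volume)‖ ≤
      C * (eLpNorm (fun x : ℝ × Z => wk k x.2 - w x.2) (ENNReal.ofReal p)
        ((volume.restrict I).prod volume)).toReal := by
    intro k
    rw [← integral_sub (hint (hwkm k) (hwk k)) (hint hwm hw)]
    simp only [← mul_sub]
    exact abs_integral_mul_le hFI (memLp_comp_snd_restrict hp hI (w := fun z => wk k z - w z)
      ((hwkm k).sub hwm) ((hwk k).sub hw))
  refine squeeze_zero (fun _ => norm_nonneg _) hbound ?_
  have h1 : Tendsto (fun k => eLpNorm (fun x : ℝ × Z => wk k x.2 - w x.2) (ENNReal.ofReal p)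
        ((volume.restrict I).prod volume)) atTop (𝓝 0) := by
    have h2 : ∀ k, eLpNorm (fun x : ℝ × Z => wk k x.2 - w x.2) (ENNReal.ofReal p)
        ((volume.restrict I).prod volume) =
        (volume I * eLpNorm (fun z => wk k z - w z) (ENNReal.ofReal p) volume ^ p) ^ p⁻¹ := fun k => by
      rw [← eLpNorm_comp_snd_restrict_rpow hp I (w := fun z => wk k z - w z) ((hwkm k).sub hwm),
        ← ENNReal.rpow_mul,
        mul_inv_cancel₀ hp0.ne', ENNReal.rpow_one]
    simp only [h2]
    have h3 : Tendsto (fun k => volume I *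
        eLpNorm (fun z => wk k z - w z) (ENNReal.ofReal p) volume ^ p) atTop (𝓝 (volume I * 0 ^ p)) :=
      ENNReal.Tendsto.const_mul (hlim.ennrpow_const p) (.inr hI.ne)
    have := h3.ennrpow_const p⁻¹
    rwa [ENNReal.zero_rpow_of_pos hp0, mul_zero, ENNReal.zero_rpow_of_pos (by positivity)] at this
  have h4 := ((ENNReal.tendsto_toReal ENNReal.zero_ne_top).comp h1).const_mul C
  simpa using h4

end Pairing

/-! ### The nonlinear flux -/

/-- The flux `|dq w|^{p-2} dq w` on `D_Ω`, extended by zero. -/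
noncomputable def flux {N : ℕ} (p s : ℝ) (Ω : Set (E N)) (w : E N → ℝ) (z : E N × E N) : ℝ :=
  (crossDomain Ω).indicator (fun z => |dq p s w z| ^ (p - 2) * dq p s w z) z

section flux

variable {N : ℕ} {p s : ℝ} {Ω : Set (E N)}

theorem measurableSet_crossDomain (hΩ : IsOpen Ω) : MeasurableSet (crossDomain Ω) :=
  (hΩ.measurableSet.compl.prod hΩ.measurableSet.compl).compl

theorem fracPairing_eq_integral_flux (hp : 2 < p) (hΩ : IsOpen Ω) (w φ : E N → ℝ) :
    fracPairing p s Ω w φ = (1 / 2) * ∫ z, flux p s Ω w z * dq p s φ z := by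
  rw [fracPairing_eq hp, ← integral_indicator (measurableSet_crossDomain hΩ)]
  congr 2
  ext z
  simp only [flux, indicator]
  split_ifs <;> simp

theorem measurable_uncurry_dq {v : ℝ → E N → ℝ} (hv : Measurable (Function.uncurry v)) :
    Measurable fun x : ℝ × (E N × E N) => dq p s (v x.1) x.2 := by
  have h1 : Measurable fun x : ℝ × (E N × E N) => v x.1 x.2.1 :=
    hv.comp (measurable_fst.prodMk (measurable_fst.comp measurable_snd))
  have h2 : Measurable fun x : ℝ × (E N × E N) => v x.1 x.2.2 :=
    hv.comp (measurable_fst.prodMk (measurable_snd.comp measurable_snd))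
  unfold dq
  fun_prop

theorem measurable_uncurry_flux (hΩ : IsOpen Ω) {v : ℝ → E N → ℝ}
    (hv : Measurable (Function.uncurry v)) :
    Measurable fun x : ℝ × (E N × E N) => flux p s Ω (v x.1) x.2 := by
  have h := measurable_uncurry_dq (p := p) (s := s) hv
  have : (fun x : ℝ × (E N × E N) => flux p s Ω (v x.1) x.2) =
      (Prod.snd ⁻¹' crossDomain Ω).indicator
        fun x => |dq p s (v x.1) x.2| ^ (p - 2) * dq p s (v x.1) x.2 := by
    ext x; rfl
  rw [this]
  exact Measurable.indicator (by fun_prop) (measurable_snd (measurableSet_crossDomain hΩ))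

/-- The exponents match because `(p - 1) p' = p`: finite energy is exactly what places the flux in
`L^{p'}`. -/
theorem enorm_flux_rpow (hp : 2 < p) (w : E N → ℝ) (z : E N × E N) :
    ‖flux p s Ω w z‖ₑ ^ (p / (p - 1)) =
      (crossDomain Ω).indicator (fun z => ENNReal.ofReal (|dq p s w z| ^ p)) z := by
  have hp1 : 0 < p - 1 := by linarith
  have hp0 : 0 < p := by linarith
  simp only [flux, indicator]
  split_ifs
  · rw [← ofReal_norm, ENNReal.ofReal_rpow_of_nonneg (norm_nonneg _) (by positivity)]
    congr 1
    rw [norm_mul, Real.norm_eq_abs, Real.norm_eq_abs, abs_of_nonneg (by positivity)]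
    have := rpow_sub_two_mul_self hp (abs_nonneg (dq p s w z))
    rw [abs_abs] at this
    rw [this, ← Real.rpow_mul (abs_nonneg _)]
    congr 1
    field_simp
  · simp only [enorm_zero]
    exact ENNReal.zero_rpow_of_pos (by positivity)

theorem memLp_uncurry_flux (hp : 2 < p) (hΩ : IsOpen Ω) {v : ℝ → E N → ℝ} {T : ℝ}
    (hv : Measurable (Function.uncurry v)) (hv0 : ∀ t ∉ Ioo 0 T, ∀ x, v t x = 0)
    (hE : ∫⁻ t in Ioo 0 T, gagliardo p s Ω (v t) < ⊤) :
    MemLp (fun x : ℝ × (E N × E N) => flux p s Ω (v x.1) x.2) (ENNReal.ofReal (p / (p - 1)))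
      volume := by
  have hp1 : 0 < p - 1 := by linarith
  have hp0 : 0 < p := by linarith
  have hm := measurable_uncurry_flux (p := p) (s := s) hΩ hv
  refine ⟨hm.aestronglyMeasurable, ?_⟩
  rw [eLpNorm_lt_top_iff_lintegral_rpow_enorm_lt_top (by simp; positivity) ENNReal.ofReal_ne_top,
    ENNReal.toReal_ofReal (by positivity)]
  simp only [enorm_flux_rpow hp]
  have hm2 : Measurable fun x : ℝ × (E N × E N) =>
      (crossDomain Ω).indicator (fun z => ENNReal.ofReal (|dq p s (v x.1) z| ^ p)) x.2 := by
    simp only [← enorm_flux_rpow hp]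
    fun_prop
  rw [Measure.volume_eq_prod, lintegral_prod _ hm2.aemeasurable]
  refine lt_of_le_of_lt (le_of_eq ?_) hE
  rw [← lintegral_indicator measurableSet_Ioo]
  refine lintegral_congr fun t => ?_
  by_cases ht : t ∈ Ioo 0 T
  · rw [indicator_of_mem ht, gagliardo_eq hp]
    exact lintegral_indicator (measurableSet_crossDomain hΩ) _
  · rw [indicator_of_notMem ht]
    have : ∀ z, dq p s (v t) z = 0 := fun z => by simp [dq, hv0 t ht]
    simp [this, Real.zero_rpow hp0.ne']

end flux

/-- The weak formulation between two times of `S`, tested with a function `φ` of space. -/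
def WeakId {N : ℕ} (p s : ℝ) (Ω : Set (E N)) (f v : ℝ → E N → ℝ) (S : Set ℝ) (φ : E N → ℝ) :
    Prop :=
  ∀ t₁ ∈ S, ∀ t₂ ∈ S, t₁ < t₂ →
    (∫ x, v t₂ x * φ x) - ∫ x, v t₁ x * φ x =
      -∫ τ in Ioo t₁ t₂, ((1 / 2) * (∫ z, flux p s Ω (v τ) z * dq p s φ z) - ∫ x, f τ x * φ x)

/-- A nonnegative energy solution with measurable representatives of the solution and of the
datum, the former vanishing outside `(0,T) × Ω`, and with good times `S`. -/
structure RegSol {N : ℕ} (p s T : ℝ) (Ω : Set (E N)) (f v : ℝ → E N → ℝ) (S : Set ℝ) : Prop where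
  measurable_v : Measurable (Function.uncurry v)
  measurable_f : Measurable (Function.uncurry f)
  nonneg_v : ∀ t x, 0 ≤ v t x
  nonneg_f : ∀ t x, 0 ≤ f t x
  zero_v : ∀ t x, ¬ (t ∈ Ioo 0 T ∧ x ∈ Ω) → v t x = 0
  memLp_f : MemLp (Function.uncurry f) (ENNReal.ofReal (p / (p - 1))) volume
  energy : ∫⁻ t in Ioo 0 T, gagliardo p s Ω (v t) < ⊤
  subset_S : S ⊆ Ioo 0 T
  ae_S : ∀ᵐ t ∂(volume.restrict (Ioo 0 T)), t ∈ S
  memW0 : ∀ t ∈ S, MemW0 p s Ω (v t)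
  weak : ∀ φ : E N → ℝ, ContDiff ℝ ∞ φ → HasCompactSupport φ → tsupport φ ⊆ Ω →
    WeakId p s Ω f v S φ

/-! ### Stability under a.e. equality, and smooth test functions -/

section

variable {N : ℕ} {p s T : ℝ} {Ω : Set (E N)}

theorem dq_const_mul (c : ℝ) (φ : E N → ℝ) (z : E N × E N) :
    dq p s (fun x => c * φ x) z = c * dq p s φ z := by
  simp only [dq]; ring

theorem fracPairing_const_mul (hp : 2 < p) (hΩ : IsOpen Ω) (w : E N → ℝ) (c : ℝ) (φ : E N → ℝ) :
    fracPairing p s Ω w (fun x => c * φ x) = c * fracPairing p s Ω w φ := by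
  rw [fracPairing_eq_integral_flux hp hΩ, fracPairing_eq_integral_flux hp hΩ]
  simp only [dq_const_mul, mul_left_comm _ c]
  rw [integral_const_mul]; ring

theorem MemW0.congr_ae (hp : 2 < p) {v w : E N → ℝ} (hv : MemW0 p s Ω v) (h : v =ᵐ[volume] w) :
    MemW0 p s Ω w := by
  obtain ⟨h1, h2, φ, h3, h4, h5⟩ := hv
  refine ⟨h1.ae_eq h, ?_, φ, h3, ?_, ?_⟩
  · filter_upwards [h, h2] with x hx1 hx2 hx
    rw [← hx1, hx2 hx]
  · refine h4.congr fun k => eLpNorm_congr_ae ?_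
    filter_upwards [h] with x hx; rw [hx]
  · refine h5.congr fun k => gagliardo_congr_ae hp Ω ?_
    filter_upwards [h] with x hx; rw [hx]

theorem memLp_lipschitz {φ : E N → ℝ} (hc : Continuous φ) (hφ : HasCompactSupport φ) (q : ℝ≥0∞) :
    MemLp φ q volume := hc.memLp_of_hasCompactSupport hφ

theorem exists_lipschitz_of_smooth {φ : E N → ℝ} (hc : ContDiff ℝ ∞ φ) (hφ : HasCompactSupport φ) :
    ∃ K, LipschitzWith K φ :=
  hc.lipschitzWith_of_hasCompactSupport hφ (by simp)

theorem exists_radius {φ : E N → ℝ} (hφ : HasCompactSupport φ) : ∃ R, ∀ x, R < ‖x‖ → φ x = 0 := by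
  obtain ⟨R, hR⟩ := hφ.isBounded.subset_closedBall 0
  refine ⟨R, fun x hx => image_eq_zero_of_notMem_tsupport fun h => ?_⟩
  have := hR h
  rw [Metric.mem_closedBall, dist_zero_right] at this
  linarith

theorem memLp_dq_of_smooth (hN : 1 < N) (hp : 2 < p) (hs0 : 0 < s) (hs1 : s < 1)
    {φ : E N → ℝ} (hc : ContDiff ℝ ∞ φ) (hφ : HasCompactSupport φ) :
    MemLp (dq p s φ) (ENNReal.ofReal p) volume := by
  obtain ⟨K, hK⟩ := exists_lipschitz_of_smooth hc hφ
  obtain ⟨R, hR⟩ := exists_radius hφ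
  exact memLp_dq_of_lipschitz hN hp hs0 hs1 hK hR

end

/-! ### Good representatives of energy solutions -/

section Regularize

variable {N : ℕ} {p s T : ℝ} {Ω : Set (E N)} {f u : ℝ → E N → ℝ} {g : E N → ℝ}

theorem IsEnergySolution.continuousOn_integral_mul (hu : IsEnergySolution p s T Ω f g u)
    {φ : E N → ℝ} (hφ : MemLp φ 2 (volume.restrict Ω)) :
    ContinuousOn (fun t => ∫ x in Ω, u t x * φ x) (Icc 0 T) := by
  intro t₀ ht₀
  have h0 := hu.continuous_L2 t₀ ht₀
  rw [ContinuousWithinAt, tendsto_iff_norm_sub_tendsto_zero]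
  have h1 := ((ENNReal.tendsto_toReal ENNReal.zero_ne_top).comp h0).mul_const
    (eLpNorm φ 2 (volume.restrict Ω)).toReal
  rw [ENNReal.toReal_zero, zero_mul] at h1
  refine squeeze_zero' (.of_forall fun _ => norm_nonneg _) ?_ h1
  filter_upwards [self_mem_nhdsWithin] with t ht
  rw [← integral_sub (integrable_mul_of_memLp (hu.memL2 t ht) hφ)
    (integrable_mul_of_memLp (hu.memL2 t₀ ht₀) hφ)]
  simp only [← sub_mul]
  exact abs_integral_mul_le (P := 2) (P' := 2) ((hu.memL2 t ht).sub (hu.memL2 t₀ ht₀)) hφ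

theorem IsEnergySolution.integral_deriv_mul (hp : 2 < p) (hΩ : IsOpen Ω)
    (hu : IsEnergySolution p s T Ω f g u) {φ : E N → ℝ} (hφs : ContDiff ℝ ∞ φ)
    (hφc : HasCompactSupport φ) (hφΩ : tsupport φ ⊆ Ω) {η : ℝ → ℝ} (hηs : ContDiff ℝ ∞ η)
    (hηc : HasCompactSupport η) (hηI : tsupport η ⊆ Ioo 0 T) :
    -(∫ t in Ioo 0 T, deriv η t * ∫ x in Ω, u t x * φ x) +
      (∫ t in Ioo 0 T, η t * fracPairing p s Ω (u t) φ) =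
      ∫ t in Ioo 0 T, η t * ∫ x in Ω, f t x * φ x := by
  have hsub : Function.support (fun z : ℝ × E N => η z.1 * φ z.2) ⊆ tsupport η ×ˢ tsupport φ := by
    intro z hz
    exact ⟨subset_tsupport _ fun h => hz (by simp [h]), subset_tsupport _ fun h => hz (by simp [h])⟩
  have h := hu.weak (fun z => η z.1 * φ z.2) ((hηs.comp contDiff_fst).mul (hφs.comp contDiff_snd))
    (HasCompactSupport.of_support_subset_isCompact (hηc.isCompact.prod hφc.isCompact) hsub)
    ((closure_minimal hsub ((isClosed_tsupport _).prod (isClosed_tsupport _))).trans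
      (prod_mono hηI hφΩ))
  have hηd : Differentiable ℝ η := hηs.differentiable (by simp)
  have e1 : ∀ t x, u t x * deriv (fun τ => η τ * φ x) t = deriv η t * (u t x * φ x) := fun t x => by
    rw [deriv_mul_const (hηd t)]; ring
  have e2 : ∀ t x, f t x * (η t * φ x) = η t * (f t x * φ x) := fun t x => by ring
  simp only [e1, e2, integral_const_mul, fracPairing_const_mul hp hΩ] at h
  exact h

/-- Properties known almost everywhere are made to hold everywhere by taking positive parts and
cutting off outside `(0,T) × Ω`; `S` collects the times, almost all of them, at which the slice is
unchanged up to a null set and lies in `W^{s,p}_0`. Testing with products `η(t) φ(x)` gives the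
equation for `t ↦ ∫ u φ` as distributions, and continuity in `L²` turns it into an identity between
individual times. -/
theorem IsEnergySolution.exists_regSol (hN : 1 < N) (hp : 2 < p) (hs0 : 0 < s) (hs1 : s < 1)
    (hΩ : IsOpen Ω) (hu : IsEnergySolution p s T Ω f g u)
    (hu0 : ∀ᵐ z ∂(volume.restrict (Ioo 0 T ×ˢ (univ : Set (E N)))), 0 ≤ u z.1 z.2)
    (hf : MemLp (fun z : ℝ × E N => f z.1 z.2) (ENNReal.ofReal (p / (p - 1)))
      (volume.restrict (Ioo 0 T ×ˢ Ω)))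
    (hf0 : ∀ᵐ z ∂(volume.restrict (Ioo 0 T ×ˢ Ω)), 0 ≤ f z.1 z.2) :
    ∃ f' v S, RegSol p s T Ω f' v S ∧ (∀ t ∈ S, v t =ᵐ[volume] u t) ∧
      (∀ᵐ z ∂(volume.restrict (Ioo 0 T ×ˢ Ω)), v z.1 z.2 = u z.1 z.2) ∧
      (∀ᵐ z ∂(volume.restrict (Ioo 0 T ×ˢ Ω)), f' z.1 z.2 = f z.1 z.2) := by
  set Q : Set (ℝ × E N) := Ioo 0 T ×ˢ Ω with hQ
  have hQm : MeasurableSet Q := measurableSet_Ioo.prod hΩ.measurableSet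
  set um := hu.memLp.1.mk _ with hum
  set fm := hf.1.mk _ with hfm
  have hum_ae : (fun z : ℝ × E N => u z.1 z.2) =ᵐ[volume.restrict (Ioo 0 T ×ˢ univ)] um :=
    hu.memLp.1.ae_eq_mk
  have hfm_ae : (fun z : ℝ × E N => f z.1 z.2) =ᵐ[volume.restrict Q] fm := hf.1.ae_eq_mk
  have hQsub : Q ⊆ Ioo 0 T ×ˢ univ := prod_mono subset_rfl (subset_univ _)
  set v : ℝ → E N → ℝ := fun t x => Q.indicator (fun z => max 0 (um z)) (t, x) with hv
  set f' : ℝ → E N → ℝ := fun t x => Q.indicator (fun z => max 0 (fm z)) (t, x) with hf'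
  have hvu : Function.uncurry v = Q.indicator (fun z => max 0 (um z)) := by ext ⟨t, x⟩; rfl
  have hfu : Function.uncurry f' = Q.indicator (fun z => max 0 (fm z)) := by ext ⟨t, x⟩; rfl
  have humm : Measurable um := hu.memLp.1.stronglyMeasurable_mk.measurable
  have hfmm : Measurable fm := hf.1.stronglyMeasurable_mk.measurable
  have hmv : Measurable (Function.uncurry v) := by
    rw [hvu]; exact (measurable_const.max humm).indicator hQm
  have hmf : Measurable (Function.uncurry f') := by
    rw [hfu]; exact (measurable_const.max hfmm).indicator hQm
  have hzv : ∀ t x, ¬ (t ∈ Ioo 0 T ∧ x ∈ Ω) → v t x = 0 := fun t x h =>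
    indicator_of_notMem (by simpa [hQ] using h) _
  have hvQ : ∀ᵐ z ∂(volume.restrict Q), v z.1 z.2 = u z.1 z.2 := by
    filter_upwards [ae_restrict_mem hQm, ae_restrict_of_ae_restrict_of_subset hQsub hum_ae,
      ae_restrict_of_ae_restrict_of_subset hQsub hu0] with z h1 h2 h3
    show Q.indicator (fun z => max 0 (um z)) z = _
    rw [indicator_of_mem h1, ← h2, max_eq_right h3]
  have hfQ : ∀ᵐ z ∂(volume.restrict Q), f' z.1 z.2 = f z.1 z.2 := by
    filter_upwards [ae_restrict_mem hQm, hfm_ae, hf0] with z h1 h2 h3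
    show Q.indicator (fun z => max 0 (fm z)) z = _
    rw [indicator_of_mem h1, ← h2, max_eq_right h3]
  have hprod : volume.restrict Q = (volume.restrict (Ioo (0 : ℝ) T)).prod
      ((volume : Measure (E N)).restrict Ω) := by
    rw [hQ, Measure.prod_restrict, Measure.volume_eq_prod]
  have hvt : ∀ᵐ t ∂(volume.restrict (Ioo 0 T)), v t =ᵐ[volume.restrict Ω] u t :=
    Measure.ae_ae_of_ae_prod (hprod ▸ hvQ)
  have hft : ∀ᵐ t ∂(volume.restrict (Ioo 0 T)), f' t =ᵐ[volume.restrict Ω] f t :=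
    Measure.ae_ae_of_ae_prod (hprod ▸ hfQ)
  have hvt' : ∀ᵐ t ∂(volume.restrict (Ioo 0 T)), v t =ᵐ[volume] u t := by
    filter_upwards [hvt, hu.memW0] with t h1 h2
    rw [Filter.EventuallyEq, ae_restrict_iff' hΩ.measurableSet] at h1
    filter_upwards [h1, h2.2.1] with x hx1 hx2
    by_cases hx : x ∈ Ω
    · exact hx1 hx
    · rw [hx2 hx, hzv t x fun h => hx h.2]
  have hE : ∫⁻ t in Ioo 0 T, gagliardo p s Ω (v t) < ⊤ := by
    refine lt_of_le_of_lt (le_of_eq (lintegral_congr_ae ?_)) hu.energy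
    filter_upwards [hvt'] with t ht using gagliardo_congr_ae hp Ω ht
  have hLf : MemLp (Function.uncurry f') (ENNReal.ofReal (p / (p - 1))) volume := by
    rw [hfu, memLp_indicator_iff_restrict hQm]
    refine hf.ae_eq ?_
    filter_upwards [hfQ, ae_restrict_mem hQm] with z h2 h3
    rw [← h2]; exact indicator_of_mem h3 _
  set S : Set ℝ := {t | t ∈ Ioo 0 T ∧ v t =ᵐ[volume] u t ∧ MemW0 p s Ω (v t)} with hS
  refine ⟨f', v, S, ⟨hmv, hmf, ?_, ?_, hzv, hLf, hE, fun t ht => ht.1, ?_,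
    fun t ht => ht.2.2, ?_⟩, fun t ht => ht.2.1, hvQ, hfQ⟩
  · exact fun t x => indicator_nonneg (fun z _ => le_max_left _ _) _
  · exact fun t x => indicator_nonneg (fun z _ => le_max_left _ _) _
  · filter_upwards [ae_restrict_mem measurableSet_Ioo, hvt', hu.memW0] with t h1 h2 h3
    exact ⟨h1, h2, h3.congr_ae hp h2.symm⟩
  · intro φ hφs hφc hφΩ t₁ ht₁ t₂ ht₂ h12
    have hφ0 : ∀ x ∉ Ω, φ x = 0 := fun x hx =>
      image_eq_zero_of_notMem_tsupport fun h => hx (hφΩ h)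
    have hI : volume (Ioo (0 : ℝ) T) < ⊤ := by simp
    set m : ℝ → ℝ := fun t => ∫ x in Ω, u t x * φ x with hm
    have hmc : ContinuousOn m (Ioo 0 T) :=
      (hu.continuousOn_integral_mul ((memLp_lipschitz hφs.continuous hφc 2).restrict Ω)).mono
        Ioo_subset_Icc_self
    set q₁ : ℝ → ℝ := fun τ => (1 / 2) * ∫ z, flux p s Ω (v τ) z * dq p s φ z with hq₁
    set q₂ : ℝ → ℝ := fun τ => ∫ x, f' τ x * φ x with hq₂
    have hq₁i : IntegrableOn q₁ (Ioo 0 T) :=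
      (integrableOn_pairing hp (memLp_uncurry_flux hp hΩ hmv
        (fun t ht x => hzv t x fun h => ht h.1) hE) hI (measurable_dq hφs.continuous.measurable)
        (memLp_dq_of_smooth hN hp hs0 hs1 hφs hφc)).const_mul _
    have hq₂i : IntegrableOn q₂ (Ioo 0 T) := integrableOn_pairing hp hLf hI
      hφs.continuous.measurable (memLp_lipschitz hφs.continuous hφc _)
    have hq₁e : ∀ᵐ t ∂(volume.restrict (Ioo 0 T)), fracPairing p s Ω (u t) φ = q₁ t := by
      filter_upwards [hvt'] with t ht
      rw [← fracPairing_congr_ae hp Ω ht, fracPairing_eq_integral_flux hp hΩ]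
    have hq₂e : ∀ᵐ t ∂(volume.restrict (Ioo 0 T)), ∫ x in Ω, f t x * φ x = q₂ t := by
      filter_upwards [hft] with t ht
      rw [hq₂]
      simp only
      rw [← setIntegral_eq_integral_of_forall_compl_eq_zero (s := Ω) (f := fun x => f' t x * φ x)]
      · refine integral_congr_ae ?_
        filter_upwards [ht] with x hx; rw [hx]
      · intro x hx; rw [hφ0 x hx, mul_zero]
    have hmS : ∀ t ∈ S, ∫ x, v t x * φ x = m t := by
      intro t ht
      rw [hm]
      simp only
      rw [setIntegral_eq_integral_of_forall_compl_eq_zero (s := Ω)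
        (fun x hx => by rw [hφ0 x hx, mul_zero])]
      refine integral_congr_ae ?_
      filter_upwards [ht.2.1] with x hx; rw [hx]
    have hkey : ∀ η : ℝ → ℝ, ContDiff ℝ ∞ η → HasCompactSupport η → tsupport η ⊆ Ioo 0 T →
        ∫ t in Ioo 0 T, deriv η t * m t = ∫ t in Ioo 0 T, η t * (q₁ t - q₂ t) := by
      intro η hηs hηc hηI
      have h := hu.integral_deriv_mul hp hΩ hφs hφc hφΩ hηs hηc hηI
      obtain ⟨C, hC⟩ := hηc.exists_bound_of_continuous hηs.continuous
      have i1 : IntegrableOn (fun t => η t * q₁ t) (Ioo 0 T) :=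
        Integrable.bdd_mul hq₁i hηs.continuous.aestronglyMeasurable (.of_forall hC)
      have i2 : IntegrableOn (fun t => η t * q₂ t) (Ioo 0 T) :=
        Integrable.bdd_mul hq₂i hηs.continuous.aestronglyMeasurable (.of_forall hC)
      have e1 : ∫ t in Ioo 0 T, η t * fracPairing p s Ω (u t) φ = ∫ t in Ioo 0 T, η t * q₁ t :=
        integral_congr_ae (hq₁e.mono fun t ht => by simp only [ht])
      have e2 : ∫ t in Ioo 0 T, η t * ∫ x in Ω, f t x * φ x = ∫ t in Ioo 0 T, η t * q₂ t :=
        integral_congr_ae (hq₂e.mono fun t ht => by simp only [ht])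
      rw [e1, e2] at h
      simp only [mul_sub]
      rw [integral_sub i1 i2]
      linarith
    have hqi : IntegrableOn (fun t => q₁ t - q₂ t) (Ioo 0 T) := hq₁i.sub hq₂i
    -- The one-sided lemma is used for `m` and for `-m`, which gives equality.
    have hup := sub_le_integral_of_distrib (q := fun t => -(q₁ t - q₂ t)) hmc hqi.neg
      (fun η hηs hηc hηI _ => by
        rw [hkey η hηs hηc hηI]
        simp only [mul_neg, integral_neg, le_refl]) ht₁.1.1 h12 ht₂.1.2
    have hlo := sub_le_integral_of_distrib hmc.neg hqi (fun η hηs hηc hηI _ => by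
      rw [← hkey η hηs hηc hηI]
      simp only [Pi.neg_apply, mul_neg, integral_neg, neg_neg, le_refl]) ht₁.1.1 h12 ht₂.1.2
    simp only [Pi.neg_apply, integral_neg] at hup hlo
    rw [hmS t₁ ht₁, hmS t₂ ht₂]
    linarith

end Regularize

/-! ### Convergence of difference quotients -/

theorem tendsto_eLpNorm_zero_of_dominated {α : Type*} [MeasurableSpace α] {μ : Measure α} {p : ℝ}
    (hp : 2 < p) {F : ℕ → α → ℝ} {g : α → ℝ} (hF : ∀ k, AEStronglyMeasurable (F k) μ)
    (hg : MemLp g (ENNReal.ofReal p) μ) (hFg : ∀ k, ∀ᵐ x ∂μ, |F k x| ≤ |g x|)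
    (hlim : ∀ᵐ x ∂μ, Tendsto (fun k => F k x) atTop (𝓝 0)) :
    Tendsto (fun k => eLpNorm (F k) (ENNReal.ofReal p) μ) atTop (𝓝 0) := by
  have hp0 : 0 < p := by linarith
  have h1 : Tendsto (fun k => ∫⁻ x, ENNReal.ofReal (|F k x| ^ p) ∂μ) atTop (𝓝 (∫⁻ _, 0 ∂μ)) := by
    refine tendsto_lintegral_of_dominated_convergence' (fun x => ENNReal.ofReal (|g x| ^ p)) ?_ ?_ ?_ ?_
    · exact fun k => ((hF k).aemeasurable.abs.pow_const p).ennreal_ofReal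
    · intro k
      filter_upwards [hFg k] with x hx
      exact ENNReal.ofReal_le_ofReal (Real.rpow_le_rpow (abs_nonneg _) hx hp0.le)
    · exact ((memLp_iff_lintegral_rpow hp hg.1).1 hg).ne
    · filter_upwards [hlim] with x hx
      have h2 : Tendsto (fun k => |F k x| ^ p) atTop (𝓝 (|0| ^ p)) :=
        (hx.abs).rpow_const (.inr hp0.le)
      rw [abs_zero, Real.zero_rpow hp0.ne'] at h2
      simpa using ENNReal.tendsto_ofReal h2
  simp only [lintegral_rpow_eq_eLpNorm_rpow hp, lintegral_zero] at h1
  have h2 := h1.ennrpow_const p⁻¹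
  rw [ENNReal.zero_rpow_of_pos (by positivity)] at h2
  refine h2.congr fun k => ?_
  rw [← ENNReal.rpow_mul, mul_inv_cancel₀ hp0.ne', ENNReal.rpow_one]

section

variable {N : ℕ} {p s T : ℝ} {Ω : Set (E N)} {f v : ℝ → E N → ℝ} {S : Set ℝ}

theorem dq_eq_zero_of_notMem {w : E N → ℝ} (hw : ∀ x ∉ Ω, w x = 0) {z : E N × E N}
    (hz : z ∉ crossDomain Ω) : dq p s w z = 0 := by
  rw [crossDomain, notMem_compl_iff] at hz
  rw [dq, hw _ hz.1, hw _ hz.2]; simp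

theorem gagliardo_eq_eLpNorm (hp : 2 < p) (hΩ : IsOpen Ω) {w : E N → ℝ}
    (hw : ∀ x ∉ Ω, w x = 0) :
    gagliardo p s Ω w = eLpNorm (dq p s w) (ENNReal.ofReal p) volume ^ p := by
  rw [gagliardo_eq hp, ← lintegral_rpow_eq_eLpNorm_rpow hp,
    ← lintegral_indicator (measurableSet_crossDomain hΩ)]
  refine lintegral_congr fun z => ?_
  by_cases hz : z ∈ crossDomain Ω
  · rw [indicator_of_mem hz]
  · rw [indicator_of_notMem hz, dq_eq_zero_of_notMem hw hz, abs_zero,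
      Real.zero_rpow (by linarith), ENNReal.ofReal_zero]

theorem RegSol.zero_v_of_notMem (h : RegSol p s T Ω f v S) (t : ℝ) : ∀ x ∉ Ω, v t x = 0 :=
  fun x hx => h.zero_v t x fun hh => hx hh.2

theorem RegSol.measurable_v_apply (h : RegSol p s T Ω f v S) (t : ℝ) : Measurable (v t) :=
  h.measurable_v.of_uncurry_left

theorem volume_lt_top_of_isBounded (hΩb : Bornology.IsBounded Ω) : volume Ω < ⊤ :=
  hΩb.measure_lt_top

theorem integrable_of_memLp_of_zero {q : ℝ≥0∞} (hq : 1 ≤ q)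
    (hΩb : Bornology.IsBounded Ω) {w : E N → ℝ} (hw : MemLp w q volume)
    (hw0 : ∀ x ∉ Ω, w x = 0) : Integrable w volume := by
  have : IsFiniteMeasure (volume.restrict Ω) := ⟨by simpa using volume_lt_top_of_isBounded hΩb⟩
  have h1 : IntegrableOn w Ω := (hw.restrict Ω).integrable hq
  exact (integrableOn_iff_integrable_of_support_subset fun x hx => by_contra fun h => hx (hw0 x h)).1 h1

theorem RegSol.integrable_v (hp : 2 < p) (hΩb : Bornology.IsBounded Ω)
    (h : RegSol p s T Ω f v S) {t : ℝ} (ht : t ∈ S) : Integrable (v t) volume :=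
  integrable_of_memLp_of_zero (by rw [ENNReal.one_le_ofReal]; linarith) hΩb (h.memW0 t ht).1
    (h.zero_v_of_notMem t)

theorem memLp_of_bounded (hΩ : IsOpen Ω) (hΩb : Bornology.IsBounded Ω) {w : E N → ℝ}
    (hwm : Measurable w) {M : ℝ} (hM : ∀ x, |w x| ≤ M) (hw0 : ∀ x ∉ Ω, w x = 0) (q : ℝ≥0∞) :
    MemLp w q volume := by
  have : IsFiniteMeasure (volume.restrict Ω) := ⟨by simpa using volume_lt_top_of_isBounded hΩb⟩
  have h1 : MemLp w q (volume.restrict Ω) :=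
    MemLp.of_bound hwm.aestronglyMeasurable M (.of_forall hM)
  have h2 : Ω.indicator w = w := indicator_eq_self.2 fun x hx => by_contra fun h => hx (hw0 x h)
  rw [← h2]
  exact (memLp_indicator_iff_restrict hΩ.measurableSet).2 h1

theorem RegSol.memLp_flux (hp : 2 < p) (hΩ : IsOpen Ω) (h : RegSol p s T Ω f v S) :
    MemLp (fun x : ℝ × (E N × E N) => flux p s Ω (v x.1) x.2) (ENNReal.ofReal (p / (p - 1)))
      volume :=
  memLp_uncurry_flux hp hΩ h.measurable_v (fun t ht x => h.zero_v t x fun hh => ht hh.1) h.energy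

/-- The weak formulation is stable under bounded convergence of test functions in the energy
norm. -/
theorem RegSol.weakId_of_tendsto (hp : 2 < p) (hΩ : IsOpen Ω) (hΩb : Bornology.IsBounded Ω)
    (h : RegSol p s T Ω f v S) {φ : E N → ℝ} {φk : ℕ → E N → ℝ} {M : ℝ}
    (hφm : Measurable φ) (hφkm : ∀ k, Measurable (φk k)) (hφM : ∀ x, |φ x| ≤ M)
    (hφkM : ∀ k x, |φk k x| ≤ M) (hφ0 : ∀ x ∉ Ω, φ x = 0) (hφk0 : ∀ k, ∀ x ∉ Ω, φk k x = 0)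
    (hφd : MemLp (dq p s φ) (ENNReal.ofReal p) volume)
    (hφkd : ∀ k, MemLp (dq p s (φk k)) (ENNReal.ofReal p) volume)
    (hae : ∀ᵐ x, Tendsto (fun k => φk k x) atTop (𝓝 (φ x)))
    (hdq : Tendsto (fun k => eLpNorm (fun z => dq p s (φk k) z - dq p s φ z) (ENNReal.ofReal p)
      volume) atTop (𝓝 0))
    (hk : ∀ k, WeakId p s Ω f v S (φk k)) : WeakId p s Ω f v S φ := by
  intro t₁ ht₁ t₂ ht₂ h12
  have hI : volume (Ioo t₁ t₂) < ⊤ := by simp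
  have hflux := h.memLp_flux hp hΩ
  have hL : ∀ t ∈ S, Tendsto (fun k => ∫ x, v t x * φk k x) atTop (𝓝 (∫ x, v t x * φ x)) := by
    intro t ht
    refine tendsto_integral_of_dominated_convergence (fun x => |v t x| * M) ?_
      ((h.integrable_v hp hΩb ht).abs.mul_const M) ?_ ?_
    · exact fun k => ((h.measurable_v_apply t).mul (hφkm k)).aestronglyMeasurable
    · refine fun k => .of_forall fun x => ?_
      rw [norm_mul, Real.norm_eq_abs, Real.norm_eq_abs]
      exact mul_le_mul_of_nonneg_left (hφkM k x) (abs_nonneg _)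
    · filter_upwards [hae] with x hx using hx.const_mul _
  have hsplit : ∀ {w : E N → ℝ}, Measurable w → (∀ x, |w x| ≤ M) → (∀ x ∉ Ω, w x = 0) →
      MemLp (dq p s w) (ENNReal.ofReal p) volume →
      ∫ τ in Ioo t₁ t₂, ((1 / 2) * (∫ z, flux p s Ω (v τ) z * dq p s w z) - ∫ x, f τ x * w x) =
      (1 / 2) * (∫ τ in Ioo t₁ t₂, ∫ z, flux p s Ω (v τ) z * dq p s w z) -
        ∫ τ in Ioo t₁ t₂, ∫ x, f τ x * w x := by
    intro w hwm hwM hw0 hwd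
    rw [integral_sub, integral_const_mul]
    · exact (integrableOn_pairing hp hflux hI (measurable_dq hwm) hwd).const_mul _
    · exact integrableOn_pairing hp h.memLp_f hI hwm (memLp_of_bounded hΩ hΩb hwm hwM hw0 _)
  have hR1 := tendsto_integral_pairing hp hflux hI (measurable_dq hφm) hφd
    (fun k => measurable_dq (hφkm k)) hφkd hdq
  have hR2 := tendsto_integral_pairing hp h.memLp_f hI hφm
    (memLp_of_bounded hΩ hΩb hφm hφM hφ0 _) hφkm
    (fun k => memLp_of_bounded hΩ hΩb (hφkm k) (hφkM k) (hφk0 k) _) (by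
      refine tendsto_eLpNorm_zero_of_dominated hp (g := Ω.indicator fun _ => 2 * M)
        (fun k => ((hφkm k).sub hφm).aestronglyMeasurable) ?_ ?_ ?_
      · have : IsFiniteMeasure (volume.restrict Ω) :=
          ⟨by simpa using volume_lt_top_of_isBounded hΩb⟩
        exact (memLp_indicator_iff_restrict hΩ.measurableSet).2 (memLp_const _)
      · refine fun k => .of_forall fun x => ?_
        by_cases hx : x ∈ Ω
        · rw [indicator_of_mem hx]
          refine le_trans ?_ (le_abs_self _)
          refine (abs_sub _ _).trans ?_
          linarith [hφkM k x, hφM x]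
        · rw [hφk0 k x hx, hφ0 x hx]; simp
      · filter_upwards [hae] with x hx
        simpa using hx.sub_const (φ x))
  refine tendsto_nhds_unique ((hL t₂ ht₂).sub (hL t₁ ht₁)) ?_
  rw [hsplit hφm hφM hφ0 hφd]
  refine (((hR1.const_mul (1 / 2)).sub hR2).neg).congr fun k => ?_
  rw [hk k t₁ ht₁ t₂ ht₂ h12, hsplit (hφkm k) (hφkM k) (hφk0 k) (hφkd k)]
  rfl

/-- Mollification of a compactly supported Lipschitz function. -/
theorem exists_mollification (hN : 1 < N) (hp : 2 < p) (hs0 : 0 < s) (hs1 : s < 1) (hΩ : IsOpen Ω)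
    {φ : E N → ℝ} {K : NNReal} (hφ : LipschitzWith K φ) (hφc : HasCompactSupport φ)
    (hφΩ : tsupport φ ⊆ Ω) {M : ℝ} (hM : ∀ x, |φ x| ≤ M) :
    ∃ φk : ℕ → E N → ℝ, (∀ k, ContDiff ℝ ∞ (φk k)) ∧ (∀ k, HasCompactSupport (φk k)) ∧
      (∀ k, tsupport (φk k) ⊆ Ω) ∧ (∀ k x, |φk k x| ≤ M) ∧
      (∀ x, Tendsto (fun k => φk k x) atTop (𝓝 (φ x))) ∧
      Tendsto (fun k => eLpNorm (fun z => dq p s (φk k) z - dq p s φ z) (ENNReal.ofReal p)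
        volume) atTop (𝓝 0) := by
  obtain ⟨d, hd, hdΩ⟩ := hφc.isCompact.exists_cthickening_subset_open hΩ hφΩ
  have hM0 : 0 ≤ M := (abs_nonneg _).trans (hM 0)
  have hδpos : ∀ n : ℕ, 0 < d / (n + 1) := fun n => by positivity
  have hδle : ∀ n : ℕ, d / ((n : ℝ) + 1) ≤ d := fun n => by
    apply div_le_self hd.le; linarith [n.cast_nonneg (α := ℝ)]
  have hδlim : Tendsto (fun n : ℕ => d / ((n : ℝ) + 1)) atTop (𝓝 0) := by
    have := (tendsto_one_div_add_atTop_nhds_zero_nat (𝕜 := ℝ)).const_mul d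
    simpa [div_eq_mul_inv] using this
  let ρ : ℕ → ContDiffBump (0 : E N) := fun n =>
    ⟨d / (n + 1) / 2, d / (n + 1), by have := hδpos n; positivity, by linarith [hδpos n]⟩
  have hcont := hφ.continuous
  set φk : ℕ → E N → ℝ := fun n =>
    convolution ((ρ n).normed volume) φ (ContinuousLinearMap.lsmul ℝ ℝ) volume with hφk
  have hφke : ∀ n x, φk n x = ∫ t, (ρ n).normed volume t * φ (x - t) := fun n x => rfl
  have hint : ∀ n x, Integrable fun t => (ρ n).normed volume t * φ (x - t) := fun n x =>
    (ρ n).integrable_normed.mul_bdd (c := M)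
      (hcont.comp (continuous_const.sub continuous_id)).aestronglyMeasurable
      (.of_forall fun t => hM _)
  have hsupp : ∀ n, tsupport (φk n) ⊆ Metric.cthickening d (tsupport φ) := by
    intro n
    refine closure_minimal (fun x hx => ?_) Metric.isClosed_cthickening
    have h1 := support_convolution_subset _ hx
    obtain ⟨a, ha, b, hb, rfl⟩ := Set.mem_add.1 h1
    rw [ContDiffBump.support_normed_eq, Metric.mem_ball, dist_zero_right] at ha
    have ha : ‖a‖ < d / (n + 1) := ha
    refine Metric.mem_cthickening_of_dist_le _ b _ _ (subset_tsupport _ hb) ?_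
    rw [dist_eq_norm, add_sub_cancel_right]
    exact ha.le.trans (hδle n)
  have hcompact : IsCompact (Metric.cthickening d (tsupport φ)) := hφc.isCompact.cthickening
  have hbd : ∀ n x, |φk n x| ≤ M := by
    intro n x
    rw [hφke, ← Real.norm_eq_abs]
    refine (norm_integral_le_of_norm_le ((ρ n).integrable_normed (μ := volume) |>.mul_const M)
      (.of_forall fun t => ?_)).trans (le_of_eq ?_)
    · rw [norm_mul, Real.norm_of_nonneg ((ρ n).nonneg_normed t)]
      exact mul_le_mul_of_nonneg_left (hM _) ((ρ n).nonneg_normed t)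
    · rw [integral_mul_const, (ρ n).integral_normed, one_mul]
  have hlip : ∀ n x y, |φk n x - φk n y| ≤ K * ‖x - y‖ := by
    intro n x y
    rw [hφke, hφke, ← integral_sub (hint n x) (hint n y), ← Real.norm_eq_abs]
    refine (norm_integral_le_of_norm_le ((ρ n).integrable_normed (μ := volume) |>.mul_const
      (K * ‖x - y‖)) (.of_forall fun t => ?_)).trans (le_of_eq ?_)
    · rw [← mul_sub, norm_mul, Real.norm_of_nonneg ((ρ n).nonneg_normed t)]
      refine mul_le_mul_of_nonneg_left ?_ ((ρ n).nonneg_normed t)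
      have := hφ.dist_le_mul (x - t) (y - t)
      rwa [dist_eq_norm, dist_eq_norm, sub_sub_sub_cancel_right] at this
    · rw [integral_mul_const, (ρ n).integral_normed, one_mul]
  have hconv : ∀ n x, |φk n x - φ x| ≤ K * (d / (n + 1)) := by
    intro n x
    have := ContDiffBump.dist_normed_convolution_le (φ := ρ n) (μ := volume) (g := φ) (x₀ := x)
      (ε := K * (d / (n + 1))) hcont.aestronglyMeasurable (fun y hy => by
        refine (hφ.dist_le_mul y x).trans ?_
        have : dist y x ≤ d / (n + 1) := (Metric.mem_ball.1 hy).le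
        gcongr)
    rwa [Real.dist_eq] at this
  have hlim : ∀ x, Tendsto (fun n => φk n x) atTop (𝓝 (φ x)) := by
    intro x
    rw [tendsto_iff_norm_sub_tendsto_zero]
    refine squeeze_zero (fun _ => norm_nonneg _) (fun n => hconv n x) ?_
    simpa using hδlim.const_mul (K : ℝ)
  have hsm : ∀ n, ContDiff ℝ ∞ (φk n) := fun n =>
    (ρ n).hasCompactSupport_normed.contDiff_convolution_left _ (ρ n).contDiff_normed
      hcont.locallyIntegrable
  refine ⟨φk, hsm, fun n => hcompact.of_isClosed_subset (isClosed_tsupport _) (hsupp n),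
    fun n => (hsupp n).trans hdΩ, hbd, hlim, ?_⟩
  obtain ⟨R, hR⟩ := hcompact.isBounded.subset_closedBall 0
  have hRφk : ∀ n x, R < ‖x‖ → φk n x = 0 := fun n x hx =>
    image_eq_zero_of_notMem_tsupport fun h => by
      have := hR (hsupp n h)
      rw [Metric.mem_closedBall, dist_zero_right] at this
      linarith
  have hRφ : ∀ x, R < ‖x‖ → φ x = 0 := fun x hx =>
    image_eq_zero_of_notMem_tsupport fun h => by
      have := hR (Metric.self_subset_cthickening _ h)
      rw [Metric.mem_closedBall, dist_zero_right] at this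
      linarith
  -- The mollifications keep the Lipschitz constant, the sup bound and a common support radius, so
  -- one dominator handles all the differences.
  refine tendsto_eLpNorm_zero_of_dominated hp
    (fun n => ((measurable_dq (hsm n).continuous.measurable).sub
      (measurable_dq hcont.measurable)).aestronglyMeasurable)
    (memLp_dominator hN hp hs0 hs1 (L := K + K) (M := (M + M) + (M + M)) (by positivity)
      (by positivity) R) ?_ ?_
  · refine fun n => .of_forall fun z => ?_
    rw [← dq_sub]
    refine (abs_dq_le_dominator (fun x y => ?_) (fun x y => ?_) (fun x hx => ?_) z).trans
      (le_abs_self _)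
    · have e : φk n x - φ x - (φk n y - φ y) = (φk n x - φk n y) - (φ x - φ y) := by ring
      rw [e, add_mul]
      refine (abs_sub _ _).trans (add_le_add (hlip n x y) ?_)
      rw [← Real.dist_eq, ← dist_eq_norm]; exact hφ.dist_le_mul x y
    · refine (abs_sub _ _).trans (add_le_add ?_ ?_) <;>
      exact (abs_sub _ _).trans (add_le_add (hbd n _) (hM _))
    · rw [hRφk n x hx, hRφ x hx, sub_zero]
  · refine .of_forall fun z => ?_
    have h1 : Tendsto (fun n => (φk n z.1 - φ z.1) - (φk n z.2 - φ z.2)) atTop (𝓝 0) := by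
      have a1 := (hlim z.1).sub_const (φ z.1)
      have a2 := (hlim z.2).sub_const (φ z.2)
      simpa using a1.sub a2
    have h2 := h1.div_const (‖z.1 - z.2‖ ^ (((N : ℝ) + p * s) / p))
    rw [zero_div] at h2
    refine h2.congr fun n => ?_
    rw [← dq_sub]; rfl

theorem RegSol.weakId_of_lipschitz (hN : 1 < N) (hp : 2 < p) (hs0 : 0 < s) (hs1 : s < 1)
    (hΩ : IsOpen Ω) (hΩb : Bornology.IsBounded Ω) (h : RegSol p s T Ω f v S)
    {φ : E N → ℝ} {K : NNReal} (hφ : LipschitzWith K φ) (hφc : HasCompactSupport φ)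
    (hφΩ : tsupport φ ⊆ Ω) : WeakId p s Ω f v S φ := by
  obtain ⟨M, hM⟩ := hφc.exists_bound_of_continuous hφ.continuous
  obtain ⟨φk, h1, h2, h3, h4, h5, h6⟩ := exists_mollification hN hp hs0 hs1 hΩ hφ hφc hφΩ hM
  obtain ⟨R, hR⟩ := exists_radius hφc
  exact h.weakId_of_tendsto hp hΩ hΩb hφ.continuous.measurable
    (fun k => (h1 k).continuous.measurable) hM h4
    (fun x hx => image_eq_zero_of_notMem_tsupport fun hh => hx (hφΩ hh))
    (fun k x hx => image_eq_zero_of_notMem_tsupport fun hh => hx (h3 k hh))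
    (memLp_dq_of_lipschitz hN hp hs0 hs1 hφ hR)
    (fun k => memLp_dq_of_smooth hN hp hs0 hs1 (h1 k) (h2 k)) (.of_forall h5) h6
    (fun k => h.weak _ (h1 k) (h2 k) (h3 k))

/-! ### Composition with a Lipschitz function -/

/-- The discrete product and chain rules: one factor is varied at a time. -/
theorem abs_dq_mul_comp_le {ζ w : E N → ℝ} {J : ℝ → ℝ} {M B L : ℝ} (hM : ∀ x, |ζ x| ≤ M)
    (hB : ∀ r, |J r| ≤ B) (hL : ∀ r r', |J r - J r'| ≤ L * |r - r'|) (z : E N × E N) :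
    |dq p s (fun x => ζ x * J (w x)) z| ≤ B * |dq p s ζ z| + M * L * |dq p s w z| := by
  have hM0 : 0 ≤ M := (abs_nonneg _).trans (hM 0)
  have h1 : |ζ z.1 * J (w z.1) - ζ z.2 * J (w z.2)| ≤
      B * |ζ z.1 - ζ z.2| + M * L * |w z.1 - w z.2| := by
    have e : ζ z.1 * J (w z.1) - ζ z.2 * J (w z.2) =
      J (w z.1) * (ζ z.1 - ζ z.2) + ζ z.2 * (J (w z.1) - J (w z.2)) := by ring
    rw [e]
    refine (abs_add_le _ _).trans (add_le_add ?_ ?_)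
    · rw [abs_mul]; exact mul_le_mul_of_nonneg_right (hB _) (abs_nonneg _)
    · rw [abs_mul, mul_assoc]; exact mul_le_mul (hM _) (hL _ _) (abs_nonneg _) hM0
  simp only [dq, abs_div]
  rw [← mul_div_assoc, ← mul_div_assoc, ← add_div]
  gcongr

theorem MemW0.memLp_dq (hN : 1 < N) (hp : 2 < p) (hs0 : 0 < s) (hs1 : s < 1) (hΩ : IsOpen Ω)
    {w : E N → ℝ} (hw : MemW0 p s Ω w) (hwm : Measurable w) (hw0 : ∀ x ∉ Ω, w x = 0) :
    MemLp (dq p s w) (ENNReal.ofReal p) volume := by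
  obtain ⟨_, _, φ, hφ, _, hg⟩ := hw
  -- A single smooth function at finite seminorm distance from `w` already suffices.
  obtain ⟨k, hk⟩ := (hg.eventually (gt_mem_nhds ENNReal.zero_lt_top)).exists
  have hφ0 : ∀ x ∉ Ω, φ k x = 0 := fun x hx =>
    image_eq_zero_of_notMem_tsupport fun h => hx ((hφ k).2.2 h)
  rw [gagliardo_eq_eLpNorm hp hΩ (fun x hx => by rw [hφ0 x hx, hw0 x hx, sub_zero]),
    ENNReal.rpow_lt_top_iff_of_pos (by linarith)] at hk
  have h1 := memLp_dq_of_smooth hN hp hs0 hs1 (hφ k).1 (hφ k).2.1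
  have h2 : MemLp (dq p s fun x => φ k x - w x) (ENNReal.ofReal p) volume :=
    ⟨(measurable_dq ((hφ k).1.continuous.measurable.sub hwm)).aestronglyMeasurable, hk⟩
  refine (h1.sub h2).ae_eq (.of_forall fun z => ?_)
  simp only [Pi.sub_apply, dq_sub, sub_sub_cancel]

/-- Makes a truncated nonlinear function of the solution an admissible test. Replacing `v t` by the
smooth functions that approximate it in `W^{s,p}_0` gives Lipschitz tests, for which the weak
identity is known; the point is the strong convergence of their difference quotients, although
composition with `J` is not linear. -/
theorem RegSol.weakId_mul_comp (hN : 1 < N) (hp : 2 < p) (hs0 : 0 < s) (hs1 : s < 1)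
    (hΩ : IsOpen Ω) (hΩb : Bornology.IsBounded Ω) (h : RegSol p s T Ω f v S)
    {ζ : E N → ℝ} {K : NNReal} (hζ : LipschitzWith K ζ) (hζc : HasCompactSupport ζ)
    (hζΩ : tsupport ζ ⊆ Ω) {J : ℝ → ℝ} {B : ℝ} {L : NNReal} (hB : ∀ r, |J r| ≤ B)
    (hJ : LipschitzWith L J) {t : ℝ} (ht : t ∈ S) :
    MemLp (dq p s fun x => ζ x * J (v t x)) (ENNReal.ofReal p) volume ∧
      WeakId p s Ω f v S fun x => ζ x * J (v t x) := by
  obtain ⟨M, hM⟩ := hζc.exists_bound_of_continuous hζ.continuous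
  have hM : ∀ x, |ζ x| ≤ M := hM
  have hM0 : 0 ≤ M := (abs_nonneg _).trans (hM 0)
  have hB0 : 0 ≤ B := (abs_nonneg _).trans (hB 0)
  have hL : ∀ r r', |J r - J r'| ≤ L * |r - r'| := fun r r' => by
    have := hJ.dist_le_mul r r'; rwa [Real.dist_eq, Real.dist_eq] at this
  have hζ0 : ∀ x ∉ Ω, ζ x = 0 := fun x hx =>
    image_eq_zero_of_notMem_tsupport fun hh => hx (hζΩ hh)
  obtain ⟨R, hR⟩ := exists_radius hζc
  have hvm := h.measurable_v_apply t
  have hv0 := h.zero_v_of_notMem t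
  have hdv := (h.memW0 t ht).memLp_dq hN hp hs0 hs1 hΩ hvm hv0
  have hdζ : MemLp (dq p s ζ) (ENNReal.ofReal p) volume :=
    memLp_dq_of_lipschitz hN hp hs0 hs1 hζ hR
  have hζm : Measurable ζ := hζ.continuous.measurable
  have hJm : Measurable J := hJ.continuous.measurable
  set G : E N × E N → ℝ := fun z => B * |dq p s ζ z| + M * L * |dq p s (v t) z| with hG
  have hG0 : ∀ z, 0 ≤ G z := fun z => by positivity
  have hGp : MemLp G (ENNReal.ofReal p) volume :=
    (hdζ.abs.const_mul B).add (hdv.abs.const_mul (M * L))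
  set w : E N → ℝ := fun x => ζ x * J (v t x) with hw
  have hwm : Measurable w := hζm.mul (hJm.comp hvm)
  have hwd : MemLp (dq p s w) (ENNReal.ofReal p) volume :=
    hGp.mono' (measurable_dq hwm).aestronglyMeasurable
      (.of_forall fun z => abs_dq_mul_comp_le hM hB hL z)
  refine ⟨hwd, ?_⟩
  obtain ⟨hvp, _, φ, hφ, hφ1, hφ2⟩ := h.memW0 t ht
  have hmeas : TendstoInMeasure volume φ atTop (v t) :=
    tendstoInMeasure_of_tendsto_eLpNorm (by simp; linarith)
      (fun k => (hφ k).1.continuous.aestronglyMeasurable) hvm.aestronglyMeasurable hφ1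
  obtain ⟨ns, hns, hae⟩ := hmeas.exists_seq_tendsto_ae
  set wk : ℕ → E N → ℝ := fun k x => ζ x * J (φ (ns k) x) with hwk
  have hφm : ∀ k, Measurable (φ k) := fun k => (hφ k).1.continuous.measurable
  have hφ0 : ∀ k, ∀ x ∉ Ω, φ k x = 0 := fun k x hx =>
    image_eq_zero_of_notMem_tsupport fun hh => hx ((hφ k).2.2 hh)
  have hwkm : ∀ k, Measurable (wk k) := fun k => hζm.mul (hJm.comp (hφm _))
  have hdφ : ∀ k, MemLp (dq p s (φ k)) (ENNReal.ofReal p) volume := fun k =>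
    memLp_dq_of_smooth hN hp hs0 hs1 (hφ k).1 (hφ k).2.1
  have hwkd : ∀ k, MemLp (dq p s (wk k)) (ENNReal.ofReal p) volume := fun k =>
    MemLp.mono' ((hdζ.abs.const_mul B).add ((hdφ (ns k)).abs.const_mul (M * L)))
      (measurable_dq (hwkm k)).aestronglyMeasurable
      (.of_forall fun z => abs_dq_mul_comp_le hM hB hL z)
  have hwkl : ∀ k, ∃ C, LipschitzWith C (wk k) := by
    intro k
    obtain ⟨Kφ, hKφ⟩ := exists_lipschitz_of_smooth (hφ (ns k)).1 (hφ (ns k)).2.1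
    refine ⟨Real.toNNReal (B * K + M * L * Kφ), LipschitzWith.of_dist_le_mul fun x y => ?_⟩
    rw [Real.coe_toNNReal _ (by positivity), Real.dist_eq]
    have e : wk k x - wk k y = J (φ (ns k) x) * (ζ x - ζ y) +
        ζ y * (J (φ (ns k) x) - J (φ (ns k) y)) := by simp only [hwk]; ring
    rw [e, add_mul]
    refine (abs_add_le _ _).trans (add_le_add ?_ ?_)
    · rw [abs_mul, mul_assoc]
      refine mul_le_mul (hB _) ?_ (abs_nonneg _) hB0
      rw [← Real.dist_eq]; exact hζ.dist_le_mul x y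
    · rw [abs_mul, mul_assoc M, mul_assoc M]
      refine mul_le_mul (hM _) ((hL _ _).trans ?_) (abs_nonneg _) hM0
      rw [mul_assoc]
      refine mul_le_mul_of_nonneg_left ?_ L.2
      rw [← Real.dist_eq]; exact hKφ.dist_le_mul x y
  have hwks : ∀ k, tsupport (wk k) ⊆ tsupport ζ := fun k => tsupport_mul_subset_left
  refine h.weakId_of_tendsto hp hΩ hΩb (M := M * B) hwm hwkm ?_ ?_ ?_ ?_ hwd hwkd ?_ ?_ ?_
  · intro x; rw [hw, abs_mul]; exact mul_le_mul (hM _) (hB _) (abs_nonneg _) hM0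
  · intro k x; rw [hwk, abs_mul]; exact mul_le_mul (hM _) (hB _) (abs_nonneg _) hM0
  · intro x hx; simp only [hw, hζ0 x hx, zero_mul]
  · intro k x hx; simp only [hwk, hζ0 x hx, zero_mul]
  · filter_upwards [hae] with x hx
    exact ((hJ.continuous.tendsto _).comp hx).const_mul _
  · set e : ℕ → E N × E N → ℝ := fun k z => dq p s (φ (ns k)) z - dq p s (v t) z with he
    have hem : ∀ k, AEStronglyMeasurable (e k) volume := fun k =>
      ((measurable_dq (hφm _)).sub (measurable_dq hvm)).aestronglyMeasurable
    have he0 : Tendsto (fun k => eLpNorm (e k) (ENNReal.ofReal p) volume) atTop (𝓝 0) := by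
      have h1 := (hφ2.comp hns.tendsto_atTop).ennrpow_const p⁻¹
      rw [ENNReal.zero_rpow_of_pos (by positivity)] at h1
      refine h1.congr fun k => ?_
      rw [Function.comp_apply, gagliardo_eq_eLpNorm hp hΩ
        (fun x hx => by rw [hφ0 _ x hx, hv0 x hx, sub_zero]), ← ENNReal.rpow_mul,
        mul_inv_cancel₀ (by linarith), ENNReal.rpow_one]
      congr 1
      ext z
      rw [dq_sub]
    set hk : ℕ → E N × E N → ℝ := fun k z => dq p s (wk k) z - dq p s w z with hhk
    have hkm : ∀ k, Measurable (hk k) := fun k =>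
      (measurable_dq (hwkm k)).sub (measurable_dq hwm)
    have hGm : Measurable G := by
      have h1 := measurable_dq (p := p) (s := s) hζm
      have h2 := measurable_dq (p := p) (s := s) hvm
      fun_prop
    -- The quotients `hk` have no fixed majorant, but `|hk| ≤ 2 G + M L |e|` with `e` tending to
    -- zero in `L^p`. The part truncated at `2 G` converges by domination, and the excess is
    -- controlled by `e`.
    have hmin : Tendsto (fun k => eLpNorm (fun z => min |hk k z| (2 * G z)) (ENNReal.ofReal p) volume)
        atTop (𝓝 0) := by
      refine tendsto_eLpNorm_zero_of_dominated hp (g := fun z => 2 * G z) (fun k => ?_)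
        (hGp.const_mul 2) (fun k => .of_forall fun z => ?_) ?_
      · exact ((hkm k).abs.min (hGm.const_mul 2)).aestronglyMeasurable
      · have h2G : 0 ≤ 2 * G z := by linarith [hG0 z]
        rw [abs_of_nonneg (le_min (abs_nonneg (hk k z)) h2G), abs_of_nonneg h2G]
        exact min_le_right _ _
      · have h1 := Measure.quasiMeasurePreserving_fst (μ := (volume : Measure (E N)))
          (ν := (volume : Measure (E N))) |>.ae hae
        have h2 := Measure.quasiMeasurePreserving_snd (μ := (volume : Measure (E N)))
          (ν := (volume : Measure (E N))) |>.ae hae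
        filter_upwards [h1, h2] with z hz1 hz2
        have a1 : Tendsto (fun k => wk k z.1) atTop (𝓝 (w z.1)) :=
          ((hJ.continuous.tendsto _).comp hz1).const_mul _
        have a2 : Tendsto (fun k => wk k z.2) atTop (𝓝 (w z.2)) :=
          ((hJ.continuous.tendsto _).comp hz2).const_mul _
        have a3 : Tendsto (fun k => hk k z) atTop (𝓝 0) := by
          have := ((a1.sub a2).div_const (‖z.1 - z.2‖ ^ (((N : ℝ) + p * s) / p))).sub_const
            (dq p s w z)
          rw [show (w z.1 - w z.2) / ‖z.1 - z.2‖ ^ (((N : ℝ) + p * s) / p) = dq p s w z from rfl,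
            sub_self] at this
          exact this
        have a4 := a3.abs
        rw [abs_zero] at a4
        exact squeeze_zero (fun k => le_min (abs_nonneg _) (by linarith [hG0 z]))
          (fun k => min_le_left _ _) a4
    have hbound : ∀ k, eLpNorm (hk k) (ENNReal.ofReal p) volume ≤
        eLpNorm (fun z => min |hk k z| (2 * G z)) (ENNReal.ofReal p) volume +
        ENNReal.ofReal (M * L) * eLpNorm (e k) (ENNReal.ofReal p) volume := by
      intro k
      have hML : 0 ≤ M * (L : ℝ) := by positivity
      have h1 : eLpNorm (hk k) (ENNReal.ofReal p) volume ≤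
          eLpNorm (fun z => min |hk k z| (2 * G z) + M * L * |e k z|) (ENNReal.ofReal p) volume := by
        refine eLpNorm_mono_real fun z => ?_
        rw [Real.norm_eq_abs]
        have b1 : |dq p s (wk k) z| ≤ G z + M * L * |e k z| := by
          refine (abs_dq_mul_comp_le hM hB hL z).trans ?_
          have : |dq p s (φ (ns k)) z| ≤ |dq p s (v t) z| + |e k z| := by
            have := abs_add_le (dq p s (v t) z) (e k z)
            rwa [he, add_sub_cancel] at this
          simp only [hG]
          nlinarith [mul_le_mul_of_nonneg_left this hML]
        have b2 : |dq p s w z| ≤ G z := abs_dq_mul_comp_le hM hB hL z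
        have b3 : |hk k z| ≤ 2 * G z + M * L * |e k z| := by
          refine (abs_sub _ _).trans ?_
          linarith
        rcases le_total |hk k z| (2 * G z) with hc | hc
        · rw [min_eq_left hc]
          have : 0 ≤ M * L * |e k z| := by positivity
          linarith
        · rw [min_eq_right hc]; exact b3
      refine h1.trans ((eLpNorm_add_le (f := fun z => min |hk k z| (2 * G z))
        (g := fun z => M * L * |e k z|) ?_ ?_ ?_).trans ?_)
      · exact ((hkm k).abs.min (hGm.const_mul 2)).aestronglyMeasurable
      · exact ((hem k).norm.const_mul _)
      · rw [ENNReal.one_le_ofReal]; linarith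
      · refine add_le_add le_rfl (le_of_eq ?_)
        rw [show (fun z => M * L * |e k z|) = (M * (L : ℝ)) • fun z => ‖e k z‖ from rfl,
          eLpNorm_const_smul, eLpNorm_norm, ← ofReal_norm, Real.norm_of_nonneg hML]
    have hlim := hmin.add (ENNReal.Tendsto.const_mul he0 (a := ENNReal.ofReal (M * L))
      (.inr ENNReal.ofReal_ne_top))
    rw [mul_zero, add_zero] at hlim
    exact tendsto_of_tendsto_of_tendsto_of_le_of_le tendsto_const_nhds hlim
      (fun _ => zero_le) hbound
  · intro k
    obtain ⟨C, hC⟩ := hwkl k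
    exact h.weakId_of_lipschitz hN hp hs0 hs1 hΩ hΩb hC
      (hζc.of_isClosed_subset (isClosed_tsupport _) (hwks k)) ((hwks k).trans hζΩ)

end

/-! ### Difference quotients in time -/

theorem memLp_of_time_support {Z : Type*} [MeasureSpace Z] [SFinite (volume : Measure Z)]
    {P : ℝ≥0∞} {I : Set ℝ} (hI : MeasurableSet I) {D W : ℝ × Z → ℝ} {C : ℝ}
    (hD : MemLp D P ((volume.restrict I).prod volume)) (hWm : Measurable W)
    (hW : ∀ x, |W x| ≤ C * |D x|) (hW0 : ∀ x, x.1 ∉ I → W x = 0) : MemLp W P volume := by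
  have h1 : MemLp W P ((volume.restrict I).prod volume) :=
    hD.of_le_mul hWm.aestronglyMeasurable (.of_forall hW)
  have h2 : (I ×ˢ univ).indicator W = W := indicator_eq_self.2 fun x hx =>
    by_contra fun h => hx (hW0 x fun h' => h ⟨h', mem_univ _⟩)
  have h3 : (volume.restrict I).prod (volume : Measure Z) =
      (volume : Measure (ℝ × Z)).restrict (I ×ˢ univ) := by
    rw [Measure.volume_eq_prod, ← Measure.prod_restrict, Measure.restrict_univ]
  rw [← h2, memLp_indicator_iff_restrict (hI.prod MeasurableSet.univ), ← h3]
  exact h1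

/-- The difference quotients of a bounded function of time against a `C¹` function. -/
theorem tendsto_integral_difference {η Y : ℝ → ℝ} (hη : ContDiff ℝ 1 η) (hηc : HasCompactSupport η)
    (hY : Measurable Y) {M : ℝ} (hM : ∀ t, |Y t| ≤ M) :
    Tendsto (fun h : ℝ => (1 / h) * ∫ t, η t * (Y t - Y (t - h))) (𝓝[>] 0)
      (𝓝 (-∫ t, deriv η t * Y t)) := by
  obtain ⟨K, hK⟩ := hη.lipschitzWith_of_hasCompactSupport hηc (by simp)
  have hM0 : 0 ≤ M := (abs_nonneg _).trans (hM 0)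
  have hYb : ∀ u : ℝ → ℝ, Integrable u → ∀ h, Integrable fun t => u t * Y (t - h) := fun u hu h =>
    hu.mul_bdd (c := M) (hY.comp (measurable_id.sub_const h)).aestronglyMeasurable
      (.of_forall fun t => hM _)
  have hηi : Integrable η := hη.continuous.integrable_of_hasCompactSupport hηc
  have e1 : ∀ h, ∫ t, η t * (Y t - Y (t - h)) = ∫ t, (η t - η (t + h)) * Y t := by
    intro h
    have a1 := hYb η hηi 0
    have a2 := hYb η hηi h
    have a3 := hYb _ (hηi.comp_add_right h) 0
    simp only [sub_zero] at a1 a3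
    simp only [mul_sub, sub_mul]
    rw [integral_sub a1 a2, integral_sub a1 a3,
      ← integral_add_right_eq_self (fun t => η t * Y (t - h)) h]
    simp
  simp only [e1, ← integral_const_mul, ← integral_neg]
  set Q := Metric.cthickening 1 (tsupport η) with hQ
  have hQc : IsCompact Q := hηc.isCompact.cthickening
  refine tendsto_integral_filter_of_dominated_convergence (Q.indicator fun _ => K * M) ?_ ?_ ?_ ?_
  · refine .of_forall fun h => ?_
    have := hη.continuous.measurable
    exact Measurable.aestronglyMeasurable (by fun_prop)
  · filter_upwards [Ioo_mem_nhdsGT (show (0 : ℝ) < 1 by norm_num)] with h hh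
    refine .of_forall fun t => ?_
    by_cases ht : t ∈ Q
    · rw [indicator_of_mem ht, Real.norm_eq_abs, abs_mul, abs_mul, ← mul_assoc]
      refine mul_le_mul ?_ (hM t) (abs_nonneg _) K.2
      have := hK.dist_le_mul t (t + h)
      rw [Real.dist_eq, Real.dist_eq, sub_add_cancel_left, abs_neg, abs_of_pos hh.1] at this
      rw [abs_of_pos (by have := hh.1; positivity), one_div, inv_mul_le_iff₀ hh.1, mul_comm]
      exact this
    · have t1 : η t = 0 := image_eq_zero_of_notMem_tsupport fun h' =>
        ht (Metric.self_subset_cthickening _ h')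
      have t2 : η (t + h) = 0 := image_eq_zero_of_notMem_tsupport fun h' =>
        ht (Metric.mem_cthickening_of_dist_le _ _ _ _ h' (by
          rw [Real.dist_eq, sub_add_cancel_left, abs_neg, abs_of_pos hh.1]; exact hh.2.le))
      rw [indicator_of_notMem ht, t1, t2]; simp
  · exact (integrable_indicator_iff hQc.measurableSet).2
      (integrableOn_const hQc.measure_lt_top.ne)
  · refine .of_forall fun t => ?_
    have hd : HasDerivAt η (deriv η t) t := (hη.differentiable (by simp) t).hasDerivAt
    have h2 := (hd.tendsto_slope_zero_right.neg).mul_const (Y t)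
    rw [neg_mul] at h2
    refine h2.congr fun h => ?_
    simp only [smul_eq_mul, one_div]
    ring

/-! ### The equation tested with a nonlinear function of the solution -/

section

variable {N : ℕ} {p s T : ℝ} {Ω : Set (E N)} {f v : ℝ → E N → ℝ} {S : Set ℝ}

theorem RegSol.memLp_dq (hp : 2 < p) (hΩ : IsOpen Ω) (h : RegSol p s T Ω f v S) :
    MemLp (fun x : ℝ × (E N × E N) => dq p s (v x.1) x.2) (ENNReal.ofReal p)
      ((volume.restrict (Ioo 0 T)).prod volume) := by
  have hp0 : 0 < p := by linarith
  have hm := measurable_uncurry_dq (p := p) (s := s) h.measurable_v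
  refine ⟨hm.aestronglyMeasurable, ?_⟩
  rw [← ENNReal.rpow_lt_top_iff_of_pos hp0, ← lintegral_rpow_eq_eLpNorm_rpow hp,
    lintegral_prod _ ((hm.abs.pow_const p).ennreal_ofReal).aemeasurable]
  refine lt_of_le_of_lt (le_of_eq (lintegral_congr fun t => ?_)) h.energy
  rw [gagliardo_eq_eLpNorm hp hΩ (h.zero_v_of_notMem t), ← lintegral_rpow_eq_eLpNorm_rpow hp]

theorem RegSol.measurable_uncurry_mul_comp (h : RegSol p s T Ω f v S) {ζ : E N → ℝ}
    (hζ : Measurable ζ) {J : ℝ → ℝ} (hJ : Measurable J) :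
    Measurable (Function.uncurry fun t x => ζ x * J (v t x)) :=
  (hζ.comp measurable_snd).mul (hJ.comp h.measurable_v)

/-- Testing the equation with `η(t) ζ(x) J(v)` where `J` is bounded, Lipschitz and nonincreasing,
with concave primitive `G`. -/
theorem RegSol.integral_deriv_mul_le (hN : 1 < N) (hp : 2 < p) (hs0 : 0 < s) (hs1 : s < 1)
    (hΩ : IsOpen Ω) (hΩb : Bornology.IsBounded Ω) (h : RegSol p s T Ω f v S)
    {ζ : E N → ℝ} {K : NNReal} (hζ : LipschitzWith K ζ) (hζc : HasCompactSupport ζ)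
    (hζΩ : tsupport ζ ⊆ Ω) (hζ0 : ∀ x, 0 ≤ ζ x) {J G : ℝ → ℝ} {B B' : ℝ} {L : NNReal}
    (hB : ∀ r, |J r| ≤ B) (hJ : LipschitzWith L J) (hG : Measurable G) (hB' : ∀ r, |G r| ≤ B')
    (hGJ : ∀ a b, 0 ≤ a → 0 ≤ b → J a * (a - b) ≤ G a - G b)
    {η : ℝ → ℝ} (hη : ContDiff ℝ 1 η) (hηc : HasCompactSupport η) (hηT : tsupport η ⊆ Ioo 0 T)
    (hη0 : ∀ t, 0 ≤ η t) :
    Integrable (fun t => η t * ∫ z, flux p s Ω (v t) z * dq p s (fun x => ζ x * J (v t x)) z) ∧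
    Integrable (fun z : ℝ × E N => f z.1 z.2 * (η z.1 * (ζ z.2 * J (v z.1 z.2)))) ∧
    ∫ t, deriv η t * ∫ x, ζ x * G (v t x) ≤
      (1 / 2) * (∫ t, η t * ∫ z, flux p s Ω (v t) z * dq p s (fun x => ζ x * J (v t x)) z) -
        ∫ t, η t * ∫ x, f t x * (ζ x * J (v t x)) := by
  have := holderConjugate_ofReal hp
  have : (volume : Measure (E N × E N)).IsAddHaarMeasure := by
    rw [Measure.volume_eq_prod]; infer_instance
  have hp0 : 0 < p := by linarith
  obtain ⟨M, hM⟩ := hζc.exists_bound_of_continuous hζ.continuous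
  have hM : ∀ x, |ζ x| ≤ M := hM
  have hM0 : 0 ≤ M := (abs_nonneg _).trans (hM 0)
  have hB0 : 0 ≤ B := (abs_nonneg _).trans (hB 0)
  obtain ⟨H, hH⟩ := hηc.exists_bound_of_continuous hη.continuous
  have hH : ∀ x, |η x| ≤ H := hH
  have hH0 : 0 ≤ H := (abs_nonneg _).trans (hH 0)
  have hL : ∀ r r', |J r - J r'| ≤ L * |r - r'| := fun r r' => by
    have := hJ.dist_le_mul r r'; rwa [Real.dist_eq, Real.dist_eq] at this
  have hηm : Measurable η := hη.continuous.measurable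
  have hζm : Measurable ζ := hζ.continuous.measurable
  have hJm : Measurable J := hJ.continuous.measurable
  have hζz : ∀ x ∉ Ω, ζ x = 0 := fun x hx => image_eq_zero_of_notMem_tsupport fun h' => hx (hζΩ h')
  have hηz : ∀ t ∉ Ioo 0 T, η t = 0 := fun x hx =>
    image_eq_zero_of_notMem_tsupport fun h' => hx (hηT h')
  have hζi : Integrable ζ := hζ.continuous.integrable_of_hasCompactSupport hζc
  set φ : ℝ → E N → ℝ := fun t x => ζ x * J (v t x) with hφ
  have hφm : Measurable (Function.uncurry φ) := h.measurable_uncurry_mul_comp hζm hJm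
  have hφt := fun t ht => h.weakId_mul_comp hN hp hs0 hs1 hΩ hΩb hζ hζc hζΩ hB hJ (t := t) ht
  set F₁ : ℝ × (E N × E N) → ℝ := fun x => flux p s Ω (v x.1) x.2 with hF₁
  set W₁ : ℝ × (E N × E N) → ℝ := fun x => η x.1 * dq p s (φ x.1) x.2 with hW₁
  set F₂ : ℝ × E N → ℝ := Function.uncurry f with hF₂
  set W₂ : ℝ × E N → ℝ := fun x => η x.1 * φ x.1 x.2 with hW₂
  have hF₁m : Measurable F₁ := measurable_uncurry_flux hΩ h.measurable_v
  have hF₁p : MemLp F₁ (ENNReal.ofReal (p / (p - 1))) volume := h.memLp_flux hp hΩ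
  have hW₁m : Measurable W₁ := (hηm.comp measurable_fst).mul (measurable_uncurry_dq hφm)
  have hW₂m : Measurable W₂ := (hηm.comp measurable_fst).mul hφm
  have hdζ : MemLp (dq p s ζ) (ENNReal.ofReal p) volume := by
    obtain ⟨R, hR⟩ := exists_radius hζc
    exact memLp_dq_of_lipschitz hN hp hs0 hs1 hζ hR
  have hW₁p : MemLp W₁ (ENNReal.ofReal p) volume := by
    have d1 := ((memLp_comp_snd_restrict hp (I := Ioo 0 T) (by simp) (measurable_dq hζm)
      hdζ).abs.const_mul B).add ((h.memLp_dq hp hΩ).abs.const_mul (M * L))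
    refine memLp_of_time_support measurableSet_Ioo d1 hW₁m (C := H) (fun x => ?_) (fun x hx => ?_)
    · rw [hW₁]
      simp only [abs_mul]
      refine mul_le_mul (hH _) ?_ (abs_nonneg _) hH0
      exact (abs_dq_mul_comp_le hM hB hL x.2).trans (le_abs_self _)
    · simp [hW₁, hηz _ hx]
  have hW₂p : MemLp W₂ (ENNReal.ofReal p) volume := by
    have d1 := (memLp_comp_snd_restrict hp (I := Ioo 0 T) (by simp) hζm
      (memLp_lipschitz hζ.continuous hζc _)).const_mul B
    refine memLp_of_time_support measurableSet_Ioo d1 hW₂m (C := H) (fun x => ?_) (fun x hx => ?_)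
    · simp only [hW₂, hφ, abs_mul]
      refine mul_le_mul (hH _) ?_ (by positivity) hH0
      rw [mul_comm, abs_of_nonneg hB0]
      exact mul_le_mul_of_nonneg_right (hB _) (abs_nonneg _)
    · simp [hW₂, hηz _ hx]
  have hP : ENNReal.ofReal (p / (p - 1)) ≠ ⊤ := ENNReal.ofReal_ne_top
  have lim₁ := tendsto_average_pairing hP hF₁m hW₁m hF₁p hW₁p
  have lim₂ := tendsto_average_pairing hP h.measurable_f hW₂m h.memLp_f hW₂p
  have i₁ : ∀ t, ∫ z, F₁ (t, z) * W₁ (t, z) = η t * ∫ z, flux p s Ω (v t) z * dq p s (φ t) z :=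
    fun t => by rw [← integral_const_mul]; congr 1; ext z; simp only [hF₁, hW₁]; ring
  have i₂ : ∀ t, ∫ z, Function.uncurry f (t, z) * W₂ (t, z) = η t * ∫ x, f t x * φ t x :=
    fun t => by
      rw [← integral_const_mul]; congr 1; ext z; simp only [Function.uncurry, hW₂]; ring
  have I₁ := (integrable_mul_of_memLp hF₁p hW₁p).integral_prod_left
  have I₂ := integrable_mul_of_memLp h.memLp_f hW₂p
  simp only [i₁] at lim₁ I₁
  simp only [i₂] at lim₂
  refine ⟨I₁, I₂, ?_⟩
  set Y : ℝ → ℝ := fun t => ∫ x, ζ x * G (v t x) with hY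
  have hYm : Measurable Y :=
    (h.measurable_uncurry_mul_comp hζm hG).stronglyMeasurable.integral_prod_right.measurable
  have hGi : ∀ t, Integrable fun x => ζ x * G (v t x) := fun t =>
    hζi.mul_bdd (c := B') (hG.comp (h.measurable_v_apply t)).aestronglyMeasurable
      (.of_forall fun x => hB' _)
  have hYb : ∀ t, |Y t| ≤ ∫ x, ‖ζ x‖ * B' := fun t => by
    rw [← Real.norm_eq_abs]
    refine norm_integral_le_of_norm_le (hζi.norm.mul_const _) (.of_forall fun x => ?_)
    rw [norm_mul]
    exact mul_le_mul_of_nonneg_left (hB' _) (norm_nonneg _)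
  have lim₃ := tendsto_integral_difference hη hηc hYm hYb
  -- The test function is frozen at time `t` while the equation is integrated over `(t - δ, t)`. The
  -- difference is taken backward so that `J` is evaluated at the later time, as `hGJ` requires.
  have key : ∀ᶠ δ in 𝓝[>] (0 : ℝ),
      -((1 / 2) * ((1 / δ) * ∫ t, ∫ τ in Ioo (t - δ) t, ∫ z, F₁ (τ, z) * W₁ (t, z)) -
        (1 / δ) * ∫ t, ∫ τ in Ioo (t - δ) t, ∫ z, Function.uncurry f (τ, z) * W₂ (t, z)) ≤
      (1 / δ) * ∫ t, η t * (Y t - Y (t - δ)) := by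
    obtain ⟨d, hd, hdI⟩ := hηc.isCompact.exists_cthickening_subset_open isOpen_Ioo hηT
    filter_upwards [Ioo_mem_nhdsGT hd] with δ hδ
    have hδ0 : 0 < δ := hδ.1
    have J₁ := (integral_translation_pairing hF₁m hW₁m hF₁p hW₁p δ).1
    have J₂ := (integral_translation_pairing h.measurable_f hW₂m h.memLp_f hW₂p δ).1
    have e : -((1 / 2) * ((1 / δ) * ∫ t, ∫ τ in Ioo (t - δ) t, ∫ z, F₁ (τ, z) * W₁ (t, z)) -
        (1 / δ) * ∫ t, ∫ τ in Ioo (t - δ) t, ∫ z, Function.uncurry f (τ, z) * W₂ (t, z)) =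
        (1 / δ) * ∫ t, -((1 / 2) * (∫ τ in Ioo (t - δ) t, ∫ z, F₁ (τ, z) * W₁ (t, z)) -
          ∫ τ in Ioo (t - δ) t, ∫ z, Function.uncurry f (τ, z) * W₂ (t, z)) := by
      rw [integral_neg, integral_sub (J₁.const_mul _) J₂, integral_const_mul]
      ring
    rw [e]
    refine mul_le_mul_of_nonneg_left ?_ (by positivity)
    refine integral_mono_ae ((J₁.const_mul _).sub J₂).neg ?_ ?_
    · have hηi : Integrable η := hη.continuous.integrable_of_hasCompactSupport hηc
      refine hηi.mul_bdd (c := (∫ x, ‖ζ x‖ * B') + ∫ x, ‖ζ x‖ * B') ?_ (.of_forall fun t => ?_)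
      · exact (hYm.sub (hYm.comp (measurable_id.sub_const δ))).aestronglyMeasurable
      · exact (norm_sub_le _ _).trans (add_le_add (hYb _) (hYb _))
    · have s1 : ∀ᵐ t, t ∈ Ioo 0 T → t ∈ S := (ae_restrict_iff' measurableSet_Ioo).1 h.ae_S
      have s2 : ∀ᵐ t, t - δ ∈ Ioo 0 T → t - δ ∈ S :=
        (measurePreserving_sub_right (volume : Measure ℝ) δ).quasiMeasurePreserving.ae s1
      filter_upwards [s1, s2] with t h1 h2
      -- Where `η` vanishes there is nothing to prove. Elsewhere `δ < d` keeps `t - δ` inside `(0,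
      -- T)`, so that outside a null set both times are good.
      by_cases hηt : η t = 0
      · simp [hW₁, hW₂, hηt]
      have htm : t ∈ tsupport η := subset_tsupport _ hηt
      have ht : t ∈ S := h1 (hηT htm)
      have ht' : t - δ ∈ S := h2 (hdI (Metric.mem_cthickening_of_dist_le _ t _ _ htm (by
        rw [Real.dist_eq, sub_sub_cancel_left, abs_neg, abs_of_pos hδ0]; exact hδ.2.le)))
      obtain ⟨hφd, hW⟩ := hφt t ht
      have hid := hW _ ht' _ ht (by linarith)
      have hφtm : Measurable (φ t) := hφm.of_uncurry_left
      have hφtp : MemLp (φ t) (ENNReal.ofReal p) volume :=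
        memLp_of_bounded hΩ hΩb hφtm (M := M * B) (fun x => by
          rw [hφ, abs_mul]; exact mul_le_mul (hM _) (hB _) (abs_nonneg _) hM0)
          (fun x hx => by simp [hφ, hζz x hx]) _
      have c₁ : IntegrableOn (fun τ => ∫ z, flux p s Ω (v τ) z * dq p s (φ t) z)
          (Ioo (t - δ) t) := integrableOn_pairing hp hF₁p (by simp) (measurable_dq hφtm) hφd
      have c₂ : IntegrableOn (fun τ => ∫ x, f τ x * φ t x) (Ioo (t - δ) t) :=
        integrableOn_pairing hp h.memLp_f (by simp) hφtm hφtp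
      have k₁ : ∀ τ, ∫ z, F₁ (τ, z) * W₁ (t, z) =
          η t * ∫ z, flux p s Ω (v τ) z * dq p s (φ t) z := fun τ => by
        rw [← integral_const_mul]; congr 1; ext z; simp only [hF₁, hW₁]; ring
      have k₂ : ∀ τ, ∫ z, Function.uncurry f (τ, z) * W₂ (t, z) =
          η t * ∫ x, f τ x * φ t x := fun τ => by
        rw [← integral_const_mul]; congr 1; ext z; simp only [Function.uncurry, hW₂]; ring
      simp only [k₁, k₂, integral_const_mul]
      have e3 : -((1 / 2) * (η t * ∫ τ in Ioo (t - δ) t, ∫ z, flux p s Ω (v τ) z * dq p s (φ t) z) -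
          η t * ∫ τ in Ioo (t - δ) t, ∫ x, f τ x * φ t x) =
          η t * -∫ τ in Ioo (t - δ) t, ((1 / 2) * (∫ z, flux p s Ω (v τ) z * dq p s (φ t) z) -
            ∫ x, f τ x * φ t x) := by
        rw [integral_sub (Integrable.const_mul c₁ _) c₂, integral_const_mul]
        ring
      rw [e3, ← hid]
      refine mul_le_mul_of_nonneg_left ?_ (hη0 t)
      have hvφ : ∀ τ ∈ S, Integrable fun x => v τ x * φ t x := fun τ hτ =>
        (h.integrable_v hp hΩb hτ).mul_bdd (c := M * B) hφtm.aestronglyMeasurable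
          (.of_forall fun x => by
            rw [Real.norm_eq_abs, hφ, abs_mul]
            exact mul_le_mul (hM _) (hB _) (abs_nonneg _) hM0)
      rw [← integral_sub (hvφ t ht) (hvφ _ ht'), hY, ← integral_sub (hGi _) (hGi _)]
      -- The pointwise concavity inequality, weighted by `ζ ≥ 0`, replaces the chain rule in time.
      refine integral_mono ((hvφ t ht).sub (hvφ _ ht')) ((hGi _).sub (hGi _)) fun x => ?_
      have := mul_le_mul_of_nonneg_left
        (hGJ (v t x) (v (t - δ) x) (h.nonneg_v _ _) (h.nonneg_v _ _)) (hζ0 x)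
      simp only [hφ]
      linarith
  have hlim := ((lim₁.const_mul (1 / 2)).sub lim₂).neg
  have := le_of_tendsto_of_tendsto hlim lim₃ key
  linarith

end

/-! ### Powers of shifted functions -/

/-- `(ε + r⁺)^q`. -/
noncomputable def shiftedPow (ε q r : ℝ) : ℝ := (ε + max r 0) ^ q

section shiftedPow

variable {ε : ℝ}

theorem shiftedPow_pos (hε : 0 < ε) (q r : ℝ) : 0 < shiftedPow ε q r :=
  Real.rpow_pos_of_pos (by have := le_max_right r 0; linarith) _

theorem abs_shiftedPow_le (hε : 0 < ε) {q : ℝ} (hq : q ≤ 0) (r : ℝ) :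
    |shiftedPow ε q r| ≤ ε ^ q := by
  rw [abs_of_pos (shiftedPow_pos hε q r)]
  exact Real.rpow_le_rpow_of_nonpos hε (by have := le_max_right r 0; linarith) hq

theorem shiftedPow_of_nonneg (q : ℝ) {r : ℝ} (hr : 0 ≤ r) : shiftedPow ε q r = (ε + r) ^ q := by
  rw [shiftedPow, max_eq_left hr]

theorem abs_shiftedPow_sub_le (hε : 0 < ε) {q : ℝ} (hq : q ≤ 0) (r r' : ℝ) :
    |shiftedPow ε q r - shiftedPow ε q r'| ≤ -q * ε ^ (q - 1) * |r - r'| := by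
  have h := abs_rpow_neg_sub_rpow_neg_le (b := -q) (by linarith) hε
    (show ε ≤ ε + max r 0 by have := le_max_right r 0; linarith)
    (show ε ≤ ε + max r' 0 by have := le_max_right r' 0; linarith)
  rw [neg_neg, add_sub_add_left_eq_sub] at h
  refine h.trans (mul_le_mul_of_nonneg_left ?_ (by
    have := Real.rpow_pos_of_pos hε (q - 1); nlinarith))
  have := abs_max_sub_max_le_abs r r' 0
  exact this

theorem lipschitzWith_shiftedPow (hε : 0 < ε) {q : ℝ} (hq : q ≤ 0) :
    LipschitzWith (Real.toNNReal (-q * ε ^ (q - 1))) (shiftedPow ε q) :=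
  LipschitzWith.of_dist_le_mul fun r r' => by
    rw [Real.dist_eq, Real.dist_eq, Real.coe_toNNReal _ (by
      have := Real.rpow_pos_of_pos hε (q - 1); nlinarith)]
    exact abs_shiftedPow_sub_le hε hq r r'

theorem measurable_shiftedPow (hε : 0 < ε) {q : ℝ} (hq : q ≤ 0) : Measurable (shiftedPow ε q) :=
  (lipschitzWith_shiftedPow hε hq).continuous.measurable

/-- The tangent line at `t = 1`, obtained from `log t ≤ t - 1` and `x + 1 ≤ exp x`. -/
theorem one_sub_le_rpow_neg {q t : ℝ} (hq : 0 ≤ q) (ht : 0 < t) : 1 - q * (t - 1) ≤ t ^ (-q) := by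
  rw [Real.rpow_def_of_pos ht]
  have h1 := Real.log_le_sub_one_of_pos ht
  have h2 := Real.add_one_le_exp (Real.log t * -q)
  nlinarith

/-- On `[0, ∞)` the function `r ↦ -(ε + r)^(2-p) / (p - 2)` is a concave primitive of `(ε +
r)^(1-p)`, and it lies below its tangent at `a`. The previous lemma is applied to the ratio `(ε + b)
/ (ε + a)`. -/
theorem shiftedPow_concavity {p : ℝ} (hp : 2 < p) (hε : 0 < ε) {a b : ℝ} (ha : 0 ≤ a)
    (hb : 0 ≤ b) :
    shiftedPow ε (1 - p) a * (a - b) ≤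
      -(shiftedPow ε (2 - p) a / (p - 2)) - -(shiftedPow ε (2 - p) b / (p - 2)) := by
  rw [shiftedPow_of_nonneg _ ha, shiftedPow_of_nonneg _ ha, shiftedPow_of_nonneg _ hb]
  have hx : 0 < ε + a := by linarith
  have hy : 0 < ε + b := by linarith
  have hp2 : 0 < p - 2 := by linarith
  have h1 := one_sub_le_rpow_neg hp2.le (div_pos hy hx)
  rw [Real.div_rpow hy.le hx.le, neg_sub] at h1
  have hX := Real.rpow_pos_of_pos hx (2 - p)
  rw [le_div_iff₀ hX] at h1
  have e : (ε + a) ^ (1 - p) = (ε + a) ^ (2 - p) / (ε + a) := by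
    rw [← Real.rpow_sub_one hx.ne']; congr 1; ring
  rw [e]
  have e2 : -((ε + a) ^ (2 - p) / (p - 2)) - -((ε + b) ^ (2 - p) / (p - 2)) =
      ((ε + b) ^ (2 - p) - (ε + a) ^ (2 - p)) / (p - 2) := by ring
  rw [e2, le_div_iff₀ hp2]
  have e3 : (1 - (p - 2) * ((ε + b) / (ε + a) - 1)) * (ε + a) ^ (2 - p) =
      (ε + a) ^ (2 - p) + (ε + a) ^ (2 - p) / (ε + a) * (a - b) * (p - 2) := by
    field_simp
    ring
  linarith

end shiftedPow

theorem abs_rpow_sub_rpow_le {p M a b : ℝ} (hp : 1 ≤ p) (ha : 0 ≤ a) (haM : a ≤ M) (hb : 0 ≤ b)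
    (hbM : b ≤ M) : |a ^ p - b ^ p| ≤ p * M ^ (p - 1) * |a - b| := by
  have hM : 0 ≤ M := ha.trans haM
  refine (convex_Icc 0 M).norm_image_sub_le_of_norm_hasDerivWithin_le
    (f := fun x : ℝ => x ^ p) (f' := fun x => p * x ^ (p - 1)) (fun x _ =>
      (Real.hasDerivAt_rpow_const (.inr hp)).hasDerivWithinAt) (fun x hx => ?_)
    ⟨hb, hbM⟩ ⟨ha, haM⟩
  have := hx.1
  rw [Real.norm_of_nonneg (by positivity)]
  have := Real.rpow_le_rpow hx.1 hx.2 (show 0 ≤ p - 1 by linarith)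
  gcongr

/-! ### Picone's inequality and the energy inequality -/

section

variable {N : ℕ} {p s T : ℝ} {Ω : Set (E N)} {f v : ℝ → E N → ℝ} {S : Set ℝ}

theorem exists_lipschitz_rpow {ψ : E N → ℝ} {K : NNReal} (hψ : LipschitzWith K ψ)
    (hψc : HasCompactSupport ψ) (hψ0 : ∀ x, 0 ≤ ψ x) (hp : 1 ≤ p) :
    ∃ L, LipschitzWith L fun x => ψ x ^ p := by
  obtain ⟨M, hM⟩ := hψc.exists_bound_of_continuous hψ.continuous
  have hM : ∀ x, ψ x ≤ M := fun x => (le_abs_self _).trans (hM x)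
  have hM0 : 0 ≤ M := (hψ0 0).trans (hM 0)
  refine ⟨Real.toNNReal (p * M ^ (p - 1)) * K, LipschitzWith.of_dist_le_mul fun x y => ?_⟩
  rw [Real.dist_eq, NNReal.coe_mul, Real.coe_toNNReal _ (by positivity), mul_assoc]
  refine (abs_rpow_sub_rpow_le hp (hψ0 x) (hM x) (hψ0 y) (hM y)).trans ?_
  have := hψ.dist_le_mul x y
  rw [Real.dist_eq] at this
  gcongr

theorem tsupport_rpow_subset (ψ : E N → ℝ) (hp : 0 < p) :
    tsupport (fun x => ψ x ^ p) ⊆ tsupport ψ :=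
  closure_mono fun x hx hψ => hx (by simp [show ψ x = 0 from hψ, Real.zero_rpow hp.ne'])

theorem MemW0.memLp_flux (hN : 1 < N) (hp : 2 < p) (hs0 : 0 < s) (hs1 : s < 1) (hΩ : IsOpen Ω)
    {w : E N → ℝ} (hw : MemW0 p s Ω w) (hwm : Measurable w) (hw0 : ∀ x ∉ Ω, w x = 0) :
    MemLp (flux p s Ω w) (ENNReal.ofReal (p / (p - 1))) volume := by
  have hp1 : 0 < p - 1 := by linarith
  have hp0 : 0 < p := by linarith
  have hm : Measurable (flux p s Ω w) :=
    Measurable.indicator (by have := measurable_dq (p := p) (s := s) hwm; fun_prop)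
      (measurableSet_crossDomain hΩ)
  refine ⟨hm.aestronglyMeasurable, ?_⟩
  rw [eLpNorm_lt_top_iff_lintegral_rpow_enorm_lt_top (by simp; positivity) ENNReal.ofReal_ne_top,
    ENNReal.toReal_ofReal (by positivity)]
  simp only [enorm_flux_rpow hp]
  refine lt_of_le_of_lt (lintegral_mono fun z => indicator_le_self _ _ _) ?_
  exact (memLp_iff_lintegral_rpow hp (measurable_dq hwm).aestronglyMeasurable).1
    (hw.memLp_dq hN hp hs0 hs1 hΩ hwm hw0)

/-- Picone's inequality for the energy form, with the gain coming from the interaction of the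
support of `ψ` with the mass of `w` on a set `F` disjoint from it. -/
theorem integral_flux_mul_dq_le (hp : 2 < p) (hs0 : 0 < s) {w ψ : E N → ℝ} (hw0 : ∀ x, 0 ≤ w x)
    (hψ0 : ∀ x, 0 ≤ ψ x) (hdψ : MemLp (dq p s ψ) (ENNReal.ofReal p) volume) {ε : ℝ} (hε : 0 < ε)
    {F : Set (E N)} (hF : MeasurableSet F) (hFΩ : F ⊆ Ω) (hψF : ∀ x ∈ F, ψ x = 0) {R : ℝ}
    (hR : ∀ x y, ψ x ≠ 0 → y ∈ F → ‖x - y‖ ≤ R)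
    (i₁ : Integrable fun z =>
      flux p s Ω w z * dq p s (fun x => ψ x ^ p * shiftedPow ε (1 - p) (w x)) z)
    (i₂ : IntegrableOn (fun x => w x ^ (p - 1)) F)
    (i₃ : Integrable fun x => ψ x ^ p * shiftedPow ε (1 - p) (w x)) :
    ∫ z, flux p s Ω w z * dq p s (fun x => ψ x ^ p * shiftedPow ε (1 - p) (w x)) z ≤
      (∫ z, |dq p s ψ z| ^ p) - (1 / 2) ^ (p - 1) / R ^ ((N : ℝ) + p * s) *
        ((∫ x in F, w x ^ (p - 1)) * ∫ x, ψ x ^ p * shiftedPow ε (1 - p) (w x)) := by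
  have hp0 : 0 < p := by linarith
  set c := (1 / 2 : ℝ) ^ (p - 1) / R ^ ((N : ℝ) + p * s) with hc
  set X : E N → ℝ := fun x => ψ x ^ p * shiftedPow ε (1 - p) (w x) with hX
  have hX0 : ∀ x, 0 ≤ X x := fun x =>
    mul_nonneg (by have := hψ0 x; positivity) (shiftedPow_pos hε _ _).le
  have j₁ : Integrable fun z => |dq p s ψ z| ^ p := by
    have := hdψ.integrable_norm_rpow (by simpa using hp0) ENNReal.ofReal_ne_top
    simpa [ENNReal.toReal_ofReal hp0.le] using this
  have i₂' : Integrable (F.indicator fun x => w x ^ (p - 1)) := (integrable_indicator_iff hF).2 i₂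
  have j₂ : Integrable fun z : E N × E N => X z.1 * F.indicator (fun x => w x ^ (p - 1)) z.2 :=
    i₃.mul_prod i₂'
  have e : (∫ x in F, w x ^ (p - 1)) * ∫ x, X x =
      ∫ z : E N × E N, X z.1 * F.indicator (fun x => w x ^ (p - 1)) z.2 := by
    rw [Measure.volume_eq_prod, integral_prod_mul, integral_indicator hF, mul_comm]
  rw [e, ← integral_const_mul, ← integral_sub j₁ (j₂.const_mul c)]
  refine integral_mono i₁ (j₁.sub (j₂.const_mul c)) fun z => ?_
  have hflux : flux p s Ω w z * dq p s X z = (crossDomain Ω).indicator (fun z =>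
      |w z.1 - w z.2| ^ (p - 2) * (w z.1 - w z.2) * (X z.1 - X z.2) /
        ‖z.1 - z.2‖ ^ ((N : ℝ) + p * s)) z := by
    simp only [flux, indicator]
    split_ifs
    · exact dq_pairing hp w X z
    · simp
  show flux p s Ω w z * dq p s X z ≤ |dq p s ψ z| ^ p -
    c * (X z.1 * F.indicator (fun x => w x ^ (p - 1)) z.2)
  rw [hflux]
  have ha : 0 < ε + w z.1 := by linarith [hw0 z.1]
  have hb : 0 < ε + w z.2 := by linarith [hw0 z.2]
  have hXe : ∀ x, X x = ψ x ^ p * (ε + w x) ^ (1 - p) := fun x => by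
    simp only [hX, shiftedPow_of_nonneg _ (hw0 x)]
  -- Pairs whose second point lies in `F`, where `ψ` vanishes, are treated with the remainder; all
  -- others by the plain Picone inequality. The mirrored pairs, with the first point in `F`, are
  -- given away.
  by_cases hzF : z.2 ∈ F
  · have hzD : z ∈ crossDomain Ω := fun h => h.2 (hFΩ hzF)
    have hX2 : X z.2 = 0 := by simp [hX, hψF _ hzF, Real.zero_rpow hp0.ne']
    rw [indicator_of_mem hzD, indicator_of_mem hzF, hX2, sub_zero]
    by_cases hψz : ψ z.1 = 0
    · have hX1 : X z.1 = 0 := by simp [hX, hψz, Real.zero_rpow hp0.ne']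
      rw [hX1]; simp; positivity
    · have hne : z.1 ≠ z.2 := fun h => hψz (h ▸ hψF _ hzF)
      have hn : 0 < ‖z.1 - z.2‖ := norm_pos_iff.2 (sub_ne_zero.2 hne)
      have hNps : 0 < (N : ℝ) + p * s := by positivity
      have h1 := picone_remainder hp ha hb (hψ0 z.1)
      rw [add_sub_add_left_eq_sub, ← hXe] at h1
      rw [abs_dq_rpow hp, hψF _ hzF, sub_zero, abs_of_nonneg (hψ0 _)]
      -- The shift `ε` is discarded in the mass on `F`, so the gain does not depend on it except
      -- through the test function.
      have h2 : (1 / 2 : ℝ) ^ (p - 1) * w z.2 ^ (p - 1) ≤ ((ε + w z.2) / 2) ^ (p - 1) := by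
        rw [← Real.mul_rpow (by norm_num) (hw0 _)]
        refine Real.rpow_le_rpow (by have := hw0 z.2; positivity) (by linarith) (by linarith)
      have h3 : (1 / 2 : ℝ) ^ (p - 1) * w z.2 ^ (p - 1) * X z.1 ≤
          ((ε + w z.2) / 2) ^ (p - 1) * X z.1 := mul_le_mul_of_nonneg_right h2 (hX0 _)
      have h4 : c * (X z.1 * w z.2 ^ (p - 1)) ≤
          (1 / 2 : ℝ) ^ (p - 1) * w z.2 ^ (p - 1) * X z.1 / ‖z.1 - z.2‖ ^ ((N : ℝ) + p * s) := by
        have : c * (X z.1 * w z.2 ^ (p - 1)) =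
          (1 / 2 : ℝ) ^ (p - 1) * w z.2 ^ (p - 1) * X z.1 / R ^ ((N : ℝ) + p * s) := by
          rw [hc]; ring
        rw [this]
        refine div_le_div_of_nonneg_left ?_ (by positivity)
          (Real.rpow_le_rpow hn.le (hR _ _ hψz hzF) hNps.le)
        have := hX0 z.1
        have := hw0 z.2
        positivity
      refine le_trans ?_ (sub_le_sub_left h4 _)
      rw [← sub_div]
      refine div_le_div_of_nonneg_right ?_ (by positivity)
      linarith
  · rw [indicator_of_notMem hzF, mul_zero, mul_zero, sub_zero]
    by_cases hzD : z ∈ crossDomain Ω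
    · rw [indicator_of_mem hzD, abs_dq_rpow hp]
      refine div_le_div_of_nonneg_right ?_ (by positivity)
      have := picone hp ha hb (hψ0 z.1) (hψ0 z.2)
      rw [add_sub_add_left_eq_sub] at this
      rwa [hXe, hXe]
    · rw [indicator_of_notMem hzD]; positivity

theorem RegSol.integrableOn_rpow (hp : 2 < p) (hΩb : Bornology.IsBounded Ω)
    (h : RegSol p s T Ω f v S) {F : Set (E N)} (hFΩ : F ⊆ Ω) {t : ℝ} (ht : t ∈ S) :
    IntegrableOn (fun x => v t x ^ (p - 1)) F := by
  have : IsFiniteMeasure (volume.restrict F) :=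
    ⟨by simpa using volume_lt_top_of_isBounded (hΩb.subset hFΩ)⟩
  have q1 : MemLp (v t) (ENNReal.ofReal (p - 1)) (volume.restrict F) :=
    ((h.memW0 t ht).1.restrict F).mono_exponent (ENNReal.ofReal_le_ofReal (by linarith))
  have q2 := q1.integrable_norm_rpow (by simp; linarith) ENNReal.ofReal_ne_top
  rw [ENNReal.toReal_ofReal (by linarith)] at q2
  refine q2.congr (.of_forall fun x => ?_)
  simp only [Real.norm_of_nonneg (h.nonneg_v t x)]

/-- The fundamental energy inequality. -/
theorem RegSol.energy_inequality (hN : 1 < N) (hp : 2 < p) (hs0 : 0 < s) (hs1 : s < 1)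
    (hΩ : IsOpen Ω) (hΩb : Bornology.IsBounded Ω) (h : RegSol p s T Ω f v S)
    {ψ : E N → ℝ} {K : NNReal} (hψ : LipschitzWith K ψ) (hψc : HasCompactSupport ψ)
    (hψΩ : tsupport ψ ⊆ Ω) (hψ0 : ∀ x, 0 ≤ ψ x) {ε : ℝ} (hε : 0 < ε)
    {F : Set (E N)} (hF : MeasurableSet F) (hFΩ : F ⊆ Ω) (hψF : ∀ x ∈ F, ψ x = 0) {R : ℝ}
    (hR0 : 0 < R) (hR : ∀ x y, ψ x ≠ 0 → y ∈ F → ‖x - y‖ ≤ R)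
    {η : ℝ → ℝ} (hη : ContDiff ℝ 1 η) (hηc : HasCompactSupport η) (hηT : tsupport η ⊆ Ioo 0 T)
    (hη0 : ∀ t, 0 ≤ η t) {m : ℝ} (hm : ∀ᵐ t, η t ≠ 0 → m ≤ ∫ x in F, v t x ^ (p - 1)) :
    Integrable (fun z : ℝ × E N =>
      f z.1 z.2 * (η z.1 * (ψ z.2 ^ p * shiftedPow ε (1 - p) (v z.1 z.2)))) ∧
    (∫ t, η t * ∫ x, f t x * (ψ x ^ p * shiftedPow ε (1 - p) (v t x))) +
      (1 / 2) ^ (p - 1) / R ^ ((N : ℝ) + p * s) * m / 2 *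
        (∫ t, η t * ∫ x, ψ x ^ p * shiftedPow ε (1 - p) (v t x)) ≤
      (1 / 2) * (∫ z, |dq p s ψ z| ^ p) * (∫ t, η t) +
        1 / (p - 2) * ∫ t, deriv η t * ∫ x, ψ x ^ p * shiftedPow ε (2 - p) (v t x) := by
  have hp0 : 0 < p := by linarith
  have hp2 : 0 < p - 2 := by linarith
  set c := (1 / 2 : ℝ) ^ (p - 1) / R ^ ((N : ℝ) + p * s) with hc
  have hc0 : 0 ≤ c := by positivity
  set A := ∫ z, |dq p s ψ z| ^ p with hA
  obtain ⟨L, hζ⟩ := exists_lipschitz_rpow hψ hψc hψ0 (p := p) (by linarith)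
  have hζs := tsupport_rpow_subset (p := p) ψ hp0
  have hζc : HasCompactSupport fun x => ψ x ^ p := hψc.of_isClosed_subset (isClosed_tsupport _) hζs
  have hζ0 : ∀ x, 0 ≤ ψ x ^ p := fun x => Real.rpow_nonneg (hψ0 x) _
  have hζi : Integrable fun x => ψ x ^ p := hζ.continuous.integrable_of_hasCompactSupport hζc
  have hJ := lipschitzWith_shiftedPow hε (q := 1 - p) (by linarith)
  have hJB := abs_shiftedPow_le hε (q := 1 - p) (by linarith)
  have hGm := measurable_shiftedPow hε (q := 2 - p) (by linarith)
  obtain ⟨k₁, k₂, k₃⟩ := h.integral_deriv_mul_le hN hp hs0 hs1 hΩ hΩb hζ hζc (hζs.trans hψΩ) hζ0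
    hJB hJ (G := fun r => -(shiftedPow ε (2 - p) r / (p - 2))) (hGm.div_const _).neg
    (B' := ε ^ (2 - p) / (p - 2)) (fun r => by
      rw [abs_neg, abs_div, abs_of_pos hp2]
      exact div_le_div_of_nonneg_right (abs_shiftedPow_le hε (by linarith) r) hp2.le)
    (fun a b ha hb => shiftedPow_concavity hp hε ha hb) hη hηc hηT hη0
  refine ⟨k₂, ?_⟩
  have e1 : ∫ t, deriv η t * ∫ x, ψ x ^ p * -(shiftedPow ε (2 - p) (v t x) / (p - 2)) =
      -(1 / (p - 2) * ∫ t, deriv η t * ∫ x, ψ x ^ p * shiftedPow ε (2 - p) (v t x)) := by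
    rw [← integral_const_mul, ← integral_neg]
    congr 1
    ext t
    have : ∀ x, ψ x ^ p * -(shiftedPow ε (2 - p) (v t x) / (p - 2)) =
        (-(1 / (p - 2))) * (ψ x ^ p * shiftedPow ε (2 - p) (v t x)) := fun x => by ring
    simp only [this]
    rw [integral_const_mul]
    ring
  rw [e1] at k₃
  set X : ℝ → ℝ := fun t => ∫ x, ψ x ^ p * shiftedPow ε (1 - p) (v t x) with hX
  have hJm := measurable_shiftedPow hε (q := 1 - p) (by linarith)
  have hXm : Measurable X := (h.measurable_uncurry_mul_comp hζ.continuous.measurable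
    hJm).stronglyMeasurable.integral_prod_right.measurable
  have hXi : ∀ t, Integrable fun x => ψ x ^ p * shiftedPow ε (1 - p) (v t x) := fun t =>
    hζi.mul_bdd (c := ε ^ (1 - p)) (hJm.comp (h.measurable_v_apply t)).aestronglyMeasurable
      (.of_forall fun x => hJB _)
  have hX0 : ∀ t, 0 ≤ X t := fun t =>
    integral_nonneg fun x => mul_nonneg (hζ0 x) (shiftedPow_pos hε _ _).le
  have hXb : ∀ t, |X t| ≤ ∫ x, ψ x ^ p * ε ^ (1 - p) := fun t => by
    rw [abs_of_nonneg (hX0 t)]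
    exact integral_mono (hXi t) (hζi.mul_const _) fun x =>
      mul_le_mul_of_nonneg_left ((le_abs_self _).trans (hJB _)) (hζ0 x)
  have hηi : Integrable η := hη.continuous.integrable_of_hasCompactSupport hηc
  have hηX : Integrable fun t => η t * X t :=
    hηi.mul_bdd hXm.aestronglyMeasurable (.of_forall hXb)
  have hmain : ∫ t, η t * ∫ z, flux p s Ω (v t) z *
      dq p s (fun x => ψ x ^ p * shiftedPow ε (1 - p) (v t x)) z ≤
      A * (∫ t, η t) - c * m * ∫ t, η t * X t := by
    rw [← integral_const_mul, ← integral_const_mul, ← integral_sub (hηi.const_mul _)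
      (hηX.const_mul _)]
    refine integral_mono_ae k₁ ((hηi.const_mul _).sub (hηX.const_mul _)) ?_
    have s1 : ∀ᵐ t, t ∈ Ioo 0 T → t ∈ S := (ae_restrict_iff' measurableSet_Ioo).1 h.ae_S
    filter_upwards [s1, hm] with t ht1 hmt
    by_cases hηt : η t = 0
    · simp [hηt]
    have ht : t ∈ S := ht1 (hηT (subset_tsupport _ hηt))
    have := holderConjugate_ofReal hp
    have hvm := h.measurable_v_apply t
    obtain ⟨l₁, _⟩ := h.weakId_mul_comp hN hp hs0 hs1 hΩ hΩb hζ hζc (hζs.trans hψΩ) hJB hJ ht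
    have l₂ := integrable_mul_of_memLp
      ((h.memW0 t ht).memLp_flux hN hp hs0 hs1 hΩ hvm (h.zero_v_of_notMem t)) l₁
    have l₃ := h.integrableOn_rpow hp hΩb hFΩ ht
    have hdψ : MemLp (dq p s ψ) (ENNReal.ofReal p) volume := by
      obtain ⟨R, hR⟩ := exists_radius hψc
      exact memLp_dq_of_lipschitz hN hp hs0 hs1 hψ hR
    have l₄ := integral_flux_mul_dq_le hp hs0 (h.nonneg_v t) hψ0 hdψ hε hF hFΩ hψF hR l₂ l₃
      (hXi t)
    have l₅ := mul_le_mul_of_nonneg_left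
      (mul_le_mul_of_nonneg_right (hmt hηt) (hX0 t)) hc0
    have l₆ := mul_le_mul_of_nonneg_left (l₄.trans (sub_le_sub_left l₅ _)) (hη0 t)
    refine l₆.trans (le_of_eq ?_)
    simp only [← hA]
    ring
  nlinarith [hmain, k₃]

end

/-! ### Persistence of mass -/

section

variable {N : ℕ} {p s T : ℝ} {Ω : Set (E N)}

theorem integrable_mul_shiftedPow {α : Type*} [MeasurableSpace α] {μ : Measure α} (hp : 2 < p)
    {ζ w : α → ℝ} (hζ : Integrable ζ μ) (hw : AEStronglyMeasurable w μ) :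
    Integrable (fun x => ζ x * shiftedPow 1 (2 - p) (w x)) μ :=
  hζ.mul_bdd (c := 1 ^ (2 - p))
    ((lipschitzWith_shiftedPow one_pos (by linarith)).continuous.comp_aestronglyMeasurable hw)
    (.of_forall fun x => abs_shiftedPow_le one_pos (by linarith) _)

theorem abs_integral_shiftedPow_sub_le {α : Type*} [MeasurableSpace α] {μ : Measure α}
    (hp : 2 < p) {ζ w w' : α → ℝ} {M : ℝ} (hζ : Integrable ζ μ) (hζM : ∀ x, |ζ x| ≤ M)
    (hw : AEStronglyMeasurable w μ) (hw' : AEStronglyMeasurable w' μ)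
    (h : Integrable (fun x => w x - w' x) μ) :
    |(∫ x, ζ x * shiftedPow 1 (2 - p) (w x) ∂μ) - ∫ x, ζ x * shiftedPow 1 (2 - p) (w' x) ∂μ| ≤
      M * (p - 2) * (eLpNorm (fun x => w x - w' x) 1 μ).toReal := by
  rw [← integral_sub (integrable_mul_shiftedPow hp hζ hw) (integrable_mul_shiftedPow hp hζ hw'),
    eLpNorm_one_eq_lintegral_enorm, ← integral_norm_eq_lintegral_enorm h.1, ← integral_const_mul,
    ← Real.norm_eq_abs]
  refine norm_integral_le_of_norm_le (h.norm.const_mul _) (.of_forall fun x => ?_)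
  rw [← mul_sub, norm_mul, mul_assoc]
  have h1 := abs_shiftedPow_sub_le one_pos (q := 2 - p) (by linarith) (w x) (w' x)
  rw [Real.one_rpow, mul_one, neg_sub] at h1
  exact mul_le_mul (hζM x) h1 (abs_nonneg _) ((abs_nonneg _).trans (hζM x))

theorem le_add_mul_rpow (hp : 2 < p) {δ r : ℝ} (hδ : 0 < δ) (hr : 0 ≤ r) :
    r ≤ δ + δ ^ (2 - p) * r ^ (p - 1) := by
  rcases le_or_gt r δ with h | h
  · have : 0 ≤ δ ^ (2 - p) * r ^ (p - 1) := by positivity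
    linarith
  · have hr0 : 0 < r := hδ.trans h
    have h1 : r ^ (2 - p) ≤ δ ^ (2 - p) := Real.rpow_le_rpow_of_nonpos hδ h.le (by linarith)
    have h2 : r ^ (2 - p) * r ^ (p - 1) = r := by
      rw [← Real.rpow_add hr0]; ring_nf; exact Real.rpow_one r
    have := mul_le_mul_of_nonneg_right h1 (Real.rpow_nonneg hr (p - 1))
    linarith

/-- The remainder in Picone's inequality is measured by the mass of `w ^ (p - 1)`, while the test
with `ε = 1` controls a deficiency of `(1 + w) ^ (2 - p)`. The tangent bound is linear in `r`, and
the parameter `δ` trades `r` for `r ^ (p - 1)` up to a small constant. -/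
theorem one_sub_shiftedPow_le (hp : 2 < p) {δ r : ℝ} (hδ : 0 < δ) (hr : 0 ≤ r) :
    1 - shiftedPow 1 (2 - p) r ≤ (p - 2) * (δ + δ ^ (2 - p) * r ^ (p - 1)) := by
  rw [shiftedPow_of_nonneg _ hr]
  have h1 := one_sub_le_rpow_neg (q := p - 2) (t := 1 + r) (by linarith) (by linarith)
  rw [neg_sub] at h1
  have h2 := mul_le_mul_of_nonneg_left (le_add_mul_rpow hp hδ hr) (show 0 ≤ p - 2 by linarith)
  linarith

/-- A deficiency of `∫ ζ (1 + w)^{2-p}` bounds the mass of `w` from below. -/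
theorem exists_mass_le (hp : 2 < p) {ζ : E N → ℝ} (hζ : Continuous ζ) (hζc : HasCompactSupport ζ)
    (hζ0 : ∀ x, 0 ≤ ζ x) {F : Set (E N)} (hF : MeasurableSet F) (hζF : ∀ x ∉ F, ζ x = 0) {κ : ℝ}
    (hκ : 0 < κ) :
    ∃ m > 0, ∀ w : E N → ℝ, Measurable w → (∀ x, 0 ≤ w x) →
      IntegrableOn (fun x => w x ^ (p - 1)) F →
      κ ≤ (∫ x, ζ x) - ∫ x, ζ x * shiftedPow 1 (2 - p) (w x) → m ≤ ∫ x in F, w x ^ (p - 1) := by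
  obtain ⟨M, hM⟩ := hζc.exists_bound_of_continuous hζ
  have hM : ∀ x, ζ x ≤ M := fun x => (le_abs_self _).trans (hM x)
  have hM0 : 0 ≤ M := (hζ0 0).trans (hM 0)
  have hp2 : 0 < p - 2 := by linarith
  have hζi : Integrable ζ := hζ.integrable_of_hasCompactSupport hζc
  set I := ∫ x, ζ x with hI
  have hI0 : 0 ≤ I := integral_nonneg hζ0
  -- The constant error then uses at most half of `κ`, leaving the other half for the mass; the `+
  -- 1` covers `I = 0`.
  set δ := κ / (2 * (p - 2) * (I + 1)) with hδ
  have hδ0 : 0 < δ := by positivity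
  refine ⟨κ / 2 / ((p - 2) * δ ^ (2 - p) * (M + 1)), by positivity, fun w hwm hw0 hwi hκw => ?_⟩
  rw [div_le_iff₀ (by positivity)]
  set m := ∫ x in F, w x ^ (p - 1) with hm
  have hm0 : 0 ≤ m := integral_nonneg fun x => by have := hw0 x; positivity
  have i₁ := integrable_mul_shiftedPow hp hζi hwm.aestronglyMeasurable
  have i₂ : Integrable (F.indicator fun x => w x ^ (p - 1)) := (integrable_indicator_iff hF).2 hwi
  have h1 : I - ∫ x, ζ x * shiftedPow 1 (2 - p) (w x) ≤
      ∫ x, ((p - 2) * δ * ζ x + (p - 2) * δ ^ (2 - p) * M * F.indicator (fun x => w x ^ (p - 1)) x) := by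
    rw [hI, ← integral_sub hζi i₁]
    refine integral_mono (hζi.sub i₁) ((hζi.const_mul _).add (i₂.const_mul _)) fun x => ?_
    by_cases hx : x ∈ F
    · have h2 := mul_le_mul_of_nonneg_left (one_sub_shiftedPow_le hp hδ0 (hw0 x)) (hζ0 x)
      have h3 : ζ x * ((p - 2) * (δ ^ (2 - p) * w x ^ (p - 1))) ≤
          M * ((p - 2) * (δ ^ (2 - p) * w x ^ (p - 1))) :=
        mul_le_mul_of_nonneg_right (hM x) (by have := hw0 x; positivity)
      simp only [indicator_of_mem hx]
      linarith
    · simp [hζF x hx, indicator_of_notMem hx]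
  rw [integral_add (hζi.const_mul _) (i₂.const_mul _), integral_const_mul, integral_const_mul,
    integral_indicator hF, ← hI, ← hm] at h1
  have h4 : (p - 2) * δ * I ≤ κ / 2 := by
    have : (p - 2) * δ * (I + 1) = κ / 2 := by rw [hδ]; field_simp
    have h5 : 0 ≤ (p - 2) * δ := by positivity
    linarith
  have h6 : 0 ≤ (p - 2) * δ ^ (2 - p) * m := by positivity
  linarith

variable {f : ℝ → E N → ℝ} {g : E N → ℝ} {u : ℝ → E N → ℝ}

/-- The source is nonnegative and can be dropped, so the growth rate depends on `ψ` and `p` only.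
The information carried by the datum therefore persists for a time that does not depend on the
source. -/
theorem IsEnergySolution.mass_inequality (hN : 1 < N) (hp : 2 < p) (hs0 : 0 < s) (hs1 : s < 1)
    (hΩ : IsOpen Ω) (hΩb : Bornology.IsBounded Ω) (hu : IsEnergySolution p s T Ω f g u)
    (hg : MemLp g 2 (volume.restrict Ω))
    {f' v : ℝ → E N → ℝ} {S : Set ℝ} (h : RegSol p s T Ω f' v S) (hvu : ∀ t ∈ S, v t =ᵐ[volume] u t)
    {ψ : E N → ℝ} {K : NNReal} (hψ : LipschitzWith K ψ) (hψc : HasCompactSupport ψ)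
    (hψΩ : tsupport ψ ⊆ Ω) (hψ0 : ∀ x, 0 ≤ ψ x) {t : ℝ} (ht : t ∈ S) :
    ∫ x, ψ x ^ p * shiftedPow 1 (2 - p) (v t x) ≤
      (∫ x in Ω, ψ x ^ p * shiftedPow 1 (2 - p) (g x)) +
        (p - 2) / 2 * (∫ z, |dq p s ψ z| ^ p) * t := by
  have hp0 : 0 < p := by linarith
  have hp2 : 0 < p - 2 := by linarith
  have hfin : IsFiniteMeasure (volume.restrict Ω) :=
    ⟨by simpa using volume_lt_top_of_isBounded hΩb⟩
  obtain ⟨L, hζ⟩ := exists_lipschitz_rpow hψ hψc hψ0 (p := p) (by linarith)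
  have hζs := tsupport_rpow_subset (p := p) ψ hp0
  have hζc : HasCompactSupport fun x => ψ x ^ p := hψc.of_isClosed_subset (isClosed_tsupport _) hζs
  obtain ⟨M, hM⟩ := hζc.exists_bound_of_continuous hζ.continuous
  have hζi : Integrable (fun x => ψ x ^ p) (volume.restrict Ω) :=
    (hζ.continuous.integrable_of_hasCompactSupport hζc).restrict
  have hζz : ∀ x ∉ Ω, ψ x ^ p = 0 := fun x hx => by
    rw [show ψ x = 0 from image_eq_zero_of_notMem_tsupport fun h' => hx (hψΩ h'),
      Real.zero_rpow hp0.ne']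
  set A := ∫ z, |dq p s ψ z| ^ p with hA
  set B := (p - 2) / 2 * A with hB
  have hA0 : 0 ≤ A := integral_nonneg fun z => by positivity
  set m : ℝ → ℝ := fun t => ∫ x in Ω, ψ x ^ p * shiftedPow 1 (2 - p) (u t x) with hm
  have hvm : ∀ t ∈ S, ∫ x, ψ x ^ p * shiftedPow 1 (2 - p) (v t x) = m t := fun t ht => by
    rw [hm, ← setIntegral_eq_integral_of_forall_compl_eq_zero (s := Ω)
      (fun x hx => by simp [hζz x hx])]
    refine integral_congr_ae (ae_restrict_of_ae ?_)
    filter_upwards [hvu t ht] with x hx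
    rw [hx]
  have hdiff : ∀ w w' : E N → ℝ, MemLp w 2 (volume.restrict Ω) → MemLp w' 2 (volume.restrict Ω) →
      |(∫ x in Ω, ψ x ^ p * shiftedPow 1 (2 - p) (w x)) -
        ∫ x in Ω, ψ x ^ p * shiftedPow 1 (2 - p) (w' x)| ≤
      M * (p - 2) * (eLpNorm (fun x => w x - w' x) 2 (volume.restrict Ω) *
        (volume.restrict Ω) univ ^ (1 / (1 : ℝ≥0∞).toReal - 1 / (2 : ℝ≥0∞).toReal)).toReal := by
    intro w w' hw hw'
    refine (abs_integral_shiftedPow_sub_le hp hζi hM hw.1 hw'.1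
      ((hw.sub hw').integrable (by norm_num))).trans ?_
    have hM0 : 0 ≤ M := (norm_nonneg _).trans (hM 0)
    refine mul_le_mul_of_nonneg_left (ENNReal.toReal_mono ?_ ?_) (by positivity)
    · exact ENNReal.mul_ne_top (hw.sub hw').2.ne
        (ENNReal.rpow_ne_top_of_nonneg (by norm_num) (measure_ne_top _ _))
    · exact eLpNorm_le_eLpNorm_mul_rpow_measure_univ (by norm_num) (hw.sub hw').1
  have hlim : ∀ (l : Filter ℝ) (w : E N → ℝ), MemLp w 2 (volume.restrict Ω) →
      (∀ᶠ τ in l, MemLp (u τ) 2 (volume.restrict Ω)) →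
      Tendsto (fun τ => eLpNorm (fun x => u τ x - w x) 2 (volume.restrict Ω)) l (𝓝 0) →
      Tendsto m l (𝓝 (∫ x in Ω, ψ x ^ p * shiftedPow 1 (2 - p) (w x))) := by
    intro l w hw hul h0
    rw [tendsto_iff_norm_sub_tendsto_zero]
    have h1 := ENNReal.Tendsto.mul_const h0 (b := (volume.restrict Ω) univ ^
      (1 / (1 : ℝ≥0∞).toReal - 1 / (2 : ℝ≥0∞).toReal)) (.inr
        (ENNReal.rpow_ne_top_of_nonneg (by norm_num) (measure_ne_top _ _)))
    rw [zero_mul] at h1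
    have h2 := ((ENNReal.tendsto_toReal ENNReal.zero_ne_top).comp h1).const_mul (M * (p - 2))
    rw [ENNReal.toReal_zero, mul_zero] at h2
    refine squeeze_zero' (.of_forall fun _ => norm_nonneg _) ?_ h2
    filter_upwards [hul] with τ hτ
    exact hdiff _ _ hτ hw
  have hmc : ContinuousOn m (Icc 0 T) := fun t ht =>
    hlim _ _ (hu.memL2 t ht) (by filter_upwards [self_mem_nhdsWithin] with τ hτ using hu.memL2 τ hτ)
      (hu.continuous_L2 t ht)
  have htT := h.subset_S ht
  have hm0 : Tendsto m (𝓝[>] 0) (𝓝 (∫ x in Ω, ψ x ^ p * shiftedPow 1 (2 - p) (g x))) :=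
    hlim _ _ hg (by
      filter_upwards [Ioo_mem_nhdsGT (htT.1.trans htT.2)] with τ hτ
      exact hu.memL2 τ (Ioo_subset_Icc_self hτ)) hu.initial
  have hstep : ∀ t₁, 0 < t₁ → t₁ < t → m t - m t₁ ≤ B * t := by
    intro t₁ h₁ h₂
    have := sub_le_integral_of_distrib (T := T) (m := m) (q := fun _ => B)
      (hmc.mono Ioo_subset_Icc_self) (integrableOn_const (by simp)) ?_ h₁ h₂ htT.2
    · refine this.trans ?_
      have hB0 : 0 ≤ B := by positivity
      rw [setIntegral_const, smul_eq_mul, Measure.real, Real.volume_Ioo,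
        ENNReal.toReal_ofReal (by linarith)]
      nlinarith
    · intro η hη hηc hηT hη0
      have hηz : ∀ t ∉ Ioo 0 T, η t = 0 := fun x hx =>
        image_eq_zero_of_notMem_tsupport fun h' => hx (hηT h')
      have hηz' : ∀ t ∉ Ioo 0 T, deriv η t = 0 := fun x hx =>
        image_eq_zero_of_notMem_tsupport fun h' => hx (hηT (tsupport_deriv_subset h'))
      -- The gain is switched off by `F = ∅` and `m = 0`; the value `R = 1` is immaterial, and `ε =
      -- 1` avoids small denominators.
      obtain ⟨_, k⟩ := h.energy_inequality hN hp hs0 hs1 hΩ hΩb hψ hψc hψΩ hψ0 one_pos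
        MeasurableSet.empty (empty_subset _) (by simp) one_pos (by simp) (hη.of_le (by simp)) hηc hηT
        hη0 (m := 0) (.of_forall fun t _ => by simp)
      have k1 : 0 ≤ ∫ t, η t * ∫ x, f' t x * (ψ x ^ p * shiftedPow 1 (1 - p) (v t x)) :=
        integral_nonneg fun t => mul_nonneg (hη0 t) (integral_nonneg fun x =>
          mul_nonneg (h.nonneg_f t x) (mul_nonneg (Real.rpow_nonneg (hψ0 x) _)
            (shiftedPow_pos one_pos _ _).le))
      have k2 : ∫ t, deriv η t * ∫ x, ψ x ^ p * shiftedPow 1 (2 - p) (v t x) =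
          ∫ t in Ioo 0 T, deriv η t * m t := by
        rw [← setIntegral_eq_integral_of_forall_compl_eq_zero (s := Ioo 0 T)
          (fun x hx => by rw [hηz' x hx, zero_mul])]
        refine integral_congr_ae ?_
        filter_upwards [h.ae_S] with t ht
        rw [hvm t ht]
      rw [k2, ← hA] at k
      rw [integral_mul_const, setIntegral_eq_integral_of_forall_compl_eq_zero hηz]
      simp only [mul_zero, zero_div, zero_mul, add_zero] at k
      have k3 : 0 ≤ 1 / 2 * A * (∫ t, η t) + 1 / (p - 2) * ∫ t in Ioo 0 T, deriv η t * m t :=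
        k1.trans k
      have k4 := mul_nonneg hp2.le k3
      have k5 : (p - 2) * (1 / 2 * A * (∫ t, η t) + 1 / (p - 2) * ∫ t in Ioo 0 T, deriv η t * m t) =
          (∫ t, η t) * B + ∫ t in Ioo 0 T, deriv η t * m t := by
        rw [hB]; field_simp
      linarith
  rw [hvm t ht]
  have := le_of_tendsto (hm0.const_sub (m t)) (b := B * t) (by
    filter_upwards [Ioo_mem_nhdsGT htT.1] with t₁ h₁
    exact hstep t₁ h₁.1 h₁.2)
  linarith

/-- A cutoff function away from the origin that sees a nontrivial datum. -/
theorem exists_cutoff (hN : 1 < N) (hp : 2 < p) (hΩ : IsOpen Ω) (hΩb : Bornology.IsBounded Ω)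
    {u₀ : E N → ℝ} (hu : IntegrableOn u₀ Ω) (hu0 : ∀ᵐ x ∂(volume.restrict Ω), 0 ≤ u₀ x)
    (hne : ¬ ∀ᵐ x ∂(volume.restrict Ω), u₀ x = 0) :
    ∃ ψ : E N → ℝ, LipschitzWith 1 ψ ∧ HasCompactSupport ψ ∧ tsupport ψ ⊆ Ω \ {0} ∧
      (∀ x, 0 ≤ ψ x) ∧
      ∫ x in Ω, ψ x ^ p * shiftedPow 1 (2 - p) (u₀ x) < ∫ x, ψ x ^ p := by
  have hp0 : 0 < p := by linarith
  have := nontrivial_E hN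
  set U : Set (E N) := Ω \ {0} with hU
  have hUo : IsOpen U := hΩ.sdiff isClosed_singleton
  -- Nonemptiness makes the distance to `Uᶜ` positive exactly on the open set `U`; the removed
  -- origin provides the point.
  have hUc : (Uᶜ).Nonempty := ⟨0, fun h => h.2 rfl⟩
  set ψ : ℕ → E N → ℝ := fun k x => max (Metric.infDist x Uᶜ - 1 / (k + 1)) 0 with hψ
  have hψl : ∀ k, LipschitzWith 1 (ψ k) := fun k => by
    have h1 := Metric.lipschitz_infDist_pt (Uᶜ : Set (E N))
    refine LipschitzWith.of_dist_le_mul fun x y => ?_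
    refine le_trans ?_ (h1.dist_le_mul x y)
    rw [Real.dist_eq, Real.dist_eq]
    refine (abs_max_sub_max_le_abs _ _ _).trans (le_of_eq ?_)
    rw [sub_sub_sub_cancel_right]
  have hψ0 : ∀ k x, 0 ≤ ψ k x := fun k x => le_max_right _ _
  have hsub : ∀ k, tsupport (ψ k) ⊆ U := by
    intro k
    have hk : (0 : ℝ) < 1 / (k + 1) := by positivity
    have h1 : tsupport (ψ k) ⊆ {x | 1 / ((k : ℝ) + 1) ≤ Metric.infDist x Uᶜ} := by
      refine closure_minimal (fun x hx => ?_)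
        (isClosed_le continuous_const (Metric.continuous_infDist_pt _))
      by_contra hlt
      simp only [mem_ofPred_eq, not_le] at hlt
      exact hx (max_eq_right (by linarith))
    intro x hx
    by_contra hxU
    have h2 := h1 hx
    simp only [mem_ofPred_eq, Metric.infDist_zero_of_mem (show x ∈ Uᶜ from hxU)] at h2
    linarith
  have hcs : ∀ k, HasCompactSupport (ψ k) := fun k =>
    Metric.isCompact_of_isClosed_isBounded (isClosed_tsupport _)
      (hΩb.subset ((hsub k).trans sdiff_subset))
  have hfin : IsFiniteMeasure (volume.restrict Ω) :=
    ⟨by simpa using volume_lt_top_of_isBounded hΩb⟩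
  -- The cutoffs exhaust `U`. If none of them detected the datum, then `(1 + u₀) ^ (2 - p) = 1`,
  -- that is `u₀ = 0`, almost everywhere.
  have hex : ∃ k, ¬ ∀ᵐ x ∂(volume.restrict Ω), ψ k x ^ p * (1 - shiftedPow 1 (2 - p) (u₀ x)) = 0 := by
    by_contra! hall
    refine hne ?_
    have h0 : ∀ᵐ x ∂(volume.restrict Ω), x ≠ 0 := ae_restrict_of_ae (by simp [ae_iff])
    filter_upwards [ae_all_iff.2 hall, hu0, h0, ae_restrict_mem hΩ.measurableSet] with x h1 h2 h3 h4
    have hx : x ∈ U := ⟨h4, h3⟩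
    have hd : 0 < Metric.infDist x Uᶜ :=
      (hUo.isClosed_compl.notMem_iff_infDist_pos hUc).1 (fun h => h hx)
    obtain ⟨k, hk⟩ := exists_nat_one_div_lt hd
    have hpos : 0 < ψ k x := lt_max_of_lt_left (by linarith)
    have h5 := (mul_eq_zero.1 (h1 k)).resolve_left (Real.rpow_pos_of_pos hpos p).ne'
    rw [shiftedPow_of_nonneg _ h2] at h5
    by_contra hne0
    have h6 : 0 < u₀ x := lt_of_le_of_ne h2 (Ne.symm hne0)
    have h7 := Real.rpow_lt_one_of_one_lt_of_neg (show 1 < 1 + u₀ x by linarith)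
      (show 2 - p < 0 by linarith)
    linarith
  obtain ⟨k, hk⟩ := hex
  refine ⟨ψ k, hψl k, hcs k, hsub k, hψ0 k, ?_⟩
  obtain ⟨L, hζ⟩ := exists_lipschitz_rpow (hψl k) (hcs k) (hψ0 k) (p := p) (by linarith)
  have hζc : HasCompactSupport fun x => ψ k x ^ p :=
    (hcs k).of_isClosed_subset (isClosed_tsupport _) (tsupport_rpow_subset _ hp0)
  have hζi : Integrable (fun x => ψ k x ^ p) (volume.restrict Ω) :=
    (hζ.continuous.integrable_of_hasCompactSupport hζc).restrict
  have hi := integrable_mul_shiftedPow hp hζi hu.1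
  rw [← setIntegral_eq_integral_of_forall_compl_eq_zero (s := Ω) (f := fun x => ψ k x ^ p)
    (fun x hx => by
      rw [show ψ k x = 0 from image_eq_zero_of_notMem_tsupport fun h' => hx (hsub k h').1,
        Real.zero_rpow hp0.ne']), ← sub_pos, ← integral_sub hζi hi]
  have hnn : 0 ≤ᵐ[volume.restrict Ω] fun x => ψ k x ^ p - ψ k x ^ p * shiftedPow 1 (2 - p) (u₀ x) := by
    refine .of_forall fun x => ?_
    have h1 := (le_abs_self _).trans (abs_shiftedPow_le one_pos (q := 2 - p) (by linarith) (u₀ x))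
    rw [Real.one_rpow] at h1
    have h2 := Real.rpow_nonneg (hψ0 k x) p
    simp only [Pi.zero_apply]
    nlinarith
  refine lt_of_le_of_ne (integral_nonneg_of_ae hnn) fun h0 => hk ?_
  have := (integral_eq_zero_iff_of_nonneg_ae hnn (hζi.sub hi)).1 h0.symm
  filter_upwards [this] with x hx
  rw [mul_sub, mul_one]
  exact hx

end

/-! ### Uniform lower mass bound and absorption of the time term -/

section

variable {N : ℕ} {p s T : ℝ} {Ω : Set (E N)}

/-- The set `F` is the support of a cutoff that sees `u₀`. It avoids the origin, so a ball around
`0` remains free for the functions `ψ` of the Hardy inequality. The cutoff functional is Lipschitz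
for the `L¹` distance, hence `L¹` convergence of the data is enough for uniformity. -/
theorem exists_uniform_mass (hN : 1 < N) (hp : 2 < p) (hs0 : 0 < s) (hs1 : s < 1)
    (hΩ : IsOpen Ω) (hΩb : Bornology.IsBounded Ω) (hT : 0 < T)
    {u₀ : E N → ℝ} (hu₀ : IntegrableOn u₀ Ω) (hu₀0 : ∀ᵐ x ∂(volume.restrict Ω), 0 ≤ u₀ x)
    (hne : ¬ ∀ᵐ x ∂(volume.restrict Ω), u₀ x = 0)
    {f f' u v : ℕ → ℝ → E N → ℝ} {g : ℕ → E N → ℝ} {S : ℕ → Set ℝ}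
    (hg : ∀ n, MemLp (g n) 2 (volume.restrict Ω))
    (hgu : Tendsto (fun n => eLpNorm (fun x => g n x - u₀ x) 1 (volume.restrict Ω)) atTop (𝓝 0))
    (hu : ∀ n, IsEnergySolution p s T Ω (f n) (g n) (u n))
    (h : ∀ n, RegSol p s T Ω (f' n) (v n) (S n)) (hvu : ∀ n, ∀ t ∈ S n, v n t =ᵐ[volume] u n t) :
    ∃ F : Set (E N), IsCompact F ∧ F ⊆ Ω \ {0} ∧ ∃ t₀ > 0, t₀ ≤ T ∧ ∃ m > 0, ∃ n₀, ∀ n ≥ n₀,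
      ∀ t ∈ S n, t < t₀ → m ≤ ∫ x in F, v n t x ^ (p - 1) := by
  have hp0 : 0 < p := by linarith
  have hfin : IsFiniteMeasure (volume.restrict Ω) :=
    ⟨by simpa using volume_lt_top_of_isBounded hΩb⟩
  obtain ⟨ψ, hψ, hψc, hψs, hψ0, hlt⟩ := exists_cutoff hN hp hΩ hΩb hu₀ hu₀0 hne
  have hψΩ : tsupport ψ ⊆ Ω := hψs.trans sdiff_subset
  obtain ⟨L, hζ⟩ := exists_lipschitz_rpow hψ hψc hψ0 (p := p) (by linarith)
  have hζs := tsupport_rpow_subset (p := p) ψ hp0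
  have hζc : HasCompactSupport fun x => ψ x ^ p := hψc.of_isClosed_subset (isClosed_tsupport _) hζs
  obtain ⟨M, hM⟩ := hζc.exists_bound_of_continuous hζ.continuous
  have hζi : Integrable (fun x => ψ x ^ p) (volume.restrict Ω) :=
    (hζ.continuous.integrable_of_hasCompactSupport hζc).restrict
  set Z := ∫ x, ψ x ^ p with hZ
  set Φ : (E N → ℝ) → ℝ := fun w => ∫ x in Ω, ψ x ^ p * shiftedPow 1 (2 - p) (w x) with hΦ
  -- One third pays for replacing `u₀` by `g n`, one for the growth up to time `t₀`, and the last is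
  -- the deficiency left for `exists_mass_le`.
  set κ := (Z - Φ u₀) / 3 with hκ
  have hκ0 : 0 < κ := by have := sub_pos.2 hlt; positivity
  set B := (p - 2) / 2 * (∫ z, |dq p s ψ z| ^ p) with hB
  have hB0 : 0 ≤ B := mul_nonneg (by linarith) (integral_nonneg fun z => by positivity)
  have hlim : Tendsto (fun n => Φ (g n)) atTop (𝓝 (Φ u₀)) := by
    rw [tendsto_iff_norm_sub_tendsto_zero]
    have h2 := ((ENNReal.tendsto_toReal ENNReal.zero_ne_top).comp hgu).const_mul (M * (p - 2))
    rw [ENNReal.toReal_zero, mul_zero] at h2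
    exact squeeze_zero (fun _ => norm_nonneg _) (fun n =>
      abs_integral_shiftedPow_sub_le hp hζi hM (hg n).1 hu₀.1
        (((hg n).integrable (by norm_num)).sub hu₀)) h2
  obtain ⟨n₀, hn₀⟩ := eventually_atTop.1
    (hlim.eventually (gt_mem_nhds (show Φ u₀ < Φ u₀ + κ by linarith)))
  obtain ⟨m, hm0, hm⟩ := exists_mass_le hp hζ.continuous hζc (fun x => Real.rpow_nonneg (hψ0 x) p)
    (F := tsupport ψ) (isClosed_tsupport _).measurableSet (fun x hx => by
      rw [image_eq_zero_of_notMem_tsupport hx, Real.zero_rpow hp0.ne']) hκ0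
  refine ⟨tsupport ψ, hψc, hψs, min T (κ / (B + 1)), lt_min hT (by positivity), min_le_left _ _,
    m, hm0, n₀, fun n hn t ht htt => ?_⟩
  refine hm (v n t) ((h n).measurable_v_apply t) ((h n).nonneg_v t)
    ((h n).integrableOn_rpow hp hΩb hψΩ ht) ?_
  have h1 := (hu n).mass_inequality hN hp hs0 hs1 hΩ hΩb (hg n) (h n) (hvu n) hψ hψc hψΩ hψ0 ht
  have h2 := hn₀ n hn
  have h3 : B * t ≤ κ := by
    have h4 : t < κ / (B + 1) := htt.trans_le (min_le_right _ _)
    rw [lt_div_iff₀ (by positivity)] at h4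
    have := ((h n).subset_S ht).1
    nlinarith
  simp only [hΦ] at h2
  have h5 : Z - Φ u₀ = 3 * κ := by rw [hκ]; ring
  simp only [hΦ] at h5
  rw [← hB] at h1
  rw [← hZ]
  linarith

/-- An inequality of Young type. If `a x ≤ c θ`, the first term on the right dominates. Otherwise `θ
/ x < a / c`, and `θ ^ (k - 1) ≤ θ ^ (p - 2)`, because `k - 1 ≥ p - 2` and `θ ≤ 1`, bounds the left
side by the second term. The power `k - 1` is the one produced by differentiating `θ ^ k`, and the
error is independent of `x`. -/
theorem absorption (hp : 2 < p) {a c θ x : ℝ} {k : ℕ} (ha : 0 ≤ a) (hc : 0 < c) (hθ0 : 0 ≤ θ)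
    (hθ1 : θ ≤ 1) (hx : 0 < x) (hk : p - 1 ≤ k) :
    a * θ ^ (k - 1) * x ^ (2 - p) ≤ c * θ ^ k * x ^ (1 - p) + a * (a / c) ^ (p - 2) := by
  have hk2 : 2 ≤ k := by
    have : (1 : ℝ) < k := by linarith
    exact_mod_cast this
  obtain ⟨j, rfl⟩ : ∃ j, k = j + 1 := ⟨k - 1, by omega⟩
  rw [Nat.add_sub_cancel]
  push_cast at hk
  have hac : 0 ≤ a * (a / c) ^ (p - 2) := by positivity
  rcases hθ0.eq_or_lt with rfl | hθ
  · rw [zero_pow (by omega)]; simp [hac]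
  have e1 : x ^ (1 - p) = x ^ (2 - p) / x := by
    rw [← Real.rpow_sub_one hx.ne']; congr 1; ring
  have hX := Real.rpow_pos_of_pos hx (2 - p)
  rcases le_or_gt (a * x) (c * θ) with h | h
  · have h1 : a ≤ c * θ / x := (le_div_iff₀ hx).2 h
    have h2 := mul_le_mul_of_nonneg_right h1 (show 0 ≤ θ ^ j * x ^ (2 - p) by positivity)
    rw [e1, pow_succ]
    have e2 : c * (θ ^ j * θ) * (x ^ (2 - p) / x) = c * θ / x * (θ ^ j * x ^ (2 - p)) := by ring
    rw [e2]
    linarith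
  · have h1 : θ / x ≤ a / c := by rw [div_le_div_iff₀ hx hc]; linarith
    have h2 : θ ^ j ≤ θ ^ (p - 2) := by
      rw [← Real.rpow_natCast]
      exact Real.rpow_le_rpow_of_exponent_ge hθ hθ1 (by linarith)
    have h3 : θ ^ (p - 2) * x ^ (2 - p) = (θ / x) ^ (p - 2) := by
      rw [Real.div_rpow hθ0 hx.le, show 2 - p = -(p - 2) by ring, Real.rpow_neg hx.le, div_eq_mul_inv]
    have h4 := Real.rpow_le_rpow (by positivity) h1 (show 0 ≤ p - 2 by linarith)
    have h5 : θ ^ j * x ^ (2 - p) ≤ (a / c) ^ (p - 2) :=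
      (mul_le_mul_of_nonneg_right h2 hX.le).trans (h3.le.trans h4)
    have h6 : 0 ≤ c * θ ^ (j + 1) * x ^ (1 - p) := by positivity
    have h7 := mul_le_mul_of_nonneg_left h5 ha
    linarith

variable {f v : ℝ → E N → ℝ} {S : Set ℝ}

/-- A bound free of `ε`, and dependent on the solution only through the mass `m`; this is the form
that survives the passage to the limit. The summand `c` added to `f` is the part of the gain not
spent on the time derivative. -/
theorem RegSol.lintegral_le (hN : 1 < N) (hp : 2 < p) (hs0 : 0 < s) (hs1 : s < 1)
    (hΩ : IsOpen Ω) (hΩb : Bornology.IsBounded Ω) (hT : 0 < T) (h : RegSol p s T Ω f v S)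
    {ψ : E N → ℝ} {K : NNReal} (hψ : LipschitzWith K ψ) (hψc : HasCompactSupport ψ)
    (hψΩ : tsupport ψ ⊆ Ω) (hψ0 : ∀ x, 0 ≤ ψ x) {ε : ℝ} (hε : 0 < ε)
    {F : Set (E N)} (hF : MeasurableSet F) (hFΩ : F ⊆ Ω) (hψF : ∀ x ∈ F, ψ x = 0) {R : ℝ}
    (hR0 : 0 < R) (hR : ∀ x y, ψ x ≠ 0 → y ∈ F → ‖x - y‖ ≤ R)
    {θ : ℝ → ℝ} (hθ : ContDiff ℝ 1 θ) (hθc : HasCompactSupport θ) (hθT : tsupport θ ⊆ Ioo 0 T)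
    (hθ0 : ∀ t, 0 ≤ θ t) (hθ1 : ∀ t, θ t ≤ 1) {D : ℝ} (hD : ∀ t, |deriv θ t| ≤ D)
    {k : ℕ} (hk : p - 1 ≤ k) {m : ℝ} (hm0 : 0 < m)
    (hm : ∀ᵐ t, θ t ≠ 0 → m ≤ ∫ x in F, v t x ^ (p - 1)) {a c : ℝ} (ha : a = k * D / (p - 2))
    (hc : c = (1 / 2) ^ (p - 1) / R ^ ((N : ℝ) + p * s) * m / 4) :
    ∫⁻ z : ℝ × E N, ENNReal.ofReal
      (θ z.1 ^ k * (ψ z.2 ^ p * (shiftedPow ε (1 - p) (v z.1 z.2) * (f z.1 z.2 + c)))) ≤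
    ENNReal.ofReal ((1 / 2) * (∫ z, |dq p s ψ z| ^ p) * (∫ t, θ t ^ k) +
      a * (a / c) ^ (p - 2) * T * ∫ x, ψ x ^ p) := by
  have hp0 : 0 < p := by linarith
  have hp2 : 0 < p - 2 := by linarith
  have hk1 : (1 : ℝ) < k := by linarith
  have hk0 : k ≠ 0 := by rintro rfl; norm_num at hk1
  have hD0 : 0 ≤ D := (abs_nonneg _).trans (hD 0)
  have ha0 : 0 ≤ a := by rw [ha]; positivity
  have hc0 : 0 < c := by rw [hc]; positivity
  set η : ℝ → ℝ := fun t => θ t ^ k with hη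
  have hηC : ContDiff ℝ 1 η := hθ.pow k
  have hηs : tsupport η ⊆ tsupport θ := closure_mono fun x hx h' =>
    hx (by simp [hη, show θ x = 0 from h', hk0])
  have hηc : HasCompactSupport η := hθc.of_isClosed_subset (isClosed_tsupport _) hηs
  have hη0 : ∀ t, 0 ≤ η t := fun t => pow_nonneg (hθ0 t) k
  have hηi : Integrable η := hηC.continuous.integrable_of_hasCompactSupport hηc
  obtain ⟨L, hζ⟩ := exists_lipschitz_rpow hψ hψc hψ0 (p := p) (by linarith)
  have hζc : HasCompactSupport fun x => ψ x ^ p :=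
    hψc.of_isClosed_subset (isClosed_tsupport _) (tsupport_rpow_subset (p := p) ψ hp0)
  have hζ0 : ∀ x, 0 ≤ ψ x ^ p := fun x => Real.rpow_nonneg (hψ0 x) _
  have hζi : Integrable fun x => ψ x ^ p := hζ.continuous.integrable_of_hasCompactSupport hζc
  obtain ⟨i₁, k₁⟩ := h.energy_inequality hN hp hs0 hs1 hΩ hΩb hψ hψc hψΩ hψ0 hε hF hFΩ hψF hR0 hR
    hηC hηc (hηs.trans hθT) hη0 (m := m) (by
      filter_upwards [hm] with t ht hηt
      exact ht fun h' => hηt (by simp [hη, h', hk0]))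
  have hsp : ∀ {q : ℝ}, q ≤ 0 → ∀ t, Integrable fun x => ψ x ^ p * shiftedPow ε q (v t x) :=
    fun hq t => hζi.mul_bdd ((measurable_shiftedPow hε hq).comp
      (h.measurable_v_apply t)).aestronglyMeasurable (.of_forall fun x => abs_shiftedPow_le hε hq _)
  have hJm := measurable_shiftedPow hε (q := 1 - p) (by linarith)
  have i₂ : Integrable fun z : ℝ × E N =>
      η z.1 * (ψ z.2 ^ p * shiftedPow ε (1 - p) (v z.1 z.2)) := by
    have := (hηi.mul_prod hζi).mul_bdd (c := ε ^ (1 - p)) (hJm.comp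
      h.measurable_v).aestronglyMeasurable (.of_forall fun z => abs_shiftedPow_le hε (by linarith) _)
    refine this.congr (.of_forall fun z => ?_)
    simp only [Function.comp_apply, Function.uncurry, mul_assoc]
  have hXi : Integrable fun t => η t * ∫ x, ψ x ^ p * shiftedPow ε (1 - p) (v t x) := by
    refine i₂.integral_prod_left.congr (.of_forall fun t => ?_)
    simp only [integral_const_mul]
  have k₂ : 1 / (p - 2) * ∫ t, deriv η t * ∫ x, ψ x ^ p * shiftedPow ε (2 - p) (v t x) ≤
      c * (∫ t, η t * ∫ x, ψ x ^ p * shiftedPow ε (1 - p) (v t x)) +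
        a * (a / c) ^ (p - 2) * T * ∫ x, ψ x ^ p := by
    have e1 : a * (a / c) ^ (p - 2) * T * ∫ x, ψ x ^ p =
        ∫ t, (Ioo 0 T).indicator (fun _ => a * (a / c) ^ (p - 2) * ∫ x, ψ x ^ p) t := by
      rw [integral_indicator measurableSet_Ioo, setIntegral_const, smul_eq_mul, Measure.real,
        Real.volume_Ioo, ENNReal.toReal_ofReal (by linarith)]
      ring
    have j₁ : Integrable ((Ioo 0 T).indicator fun _ => a * (a / c) ^ (p - 2) * ∫ x, ψ x ^ p) :=
      (integrable_indicator_iff measurableSet_Ioo).2 (integrableOn_const (by simp))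
    rw [e1, ← integral_const_mul, ← integral_const_mul, ← integral_add (hXi.const_mul c) j₁]
    have hYm : Measurable fun t => ∫ x, ψ x ^ p * shiftedPow ε (2 - p) (v t x) :=
      (h.measurable_uncurry_mul_comp hζ.continuous.measurable
        (measurable_shiftedPow hε (by linarith))).stronglyMeasurable.integral_prod_right.measurable
    have hY0 : ∀ t, 0 ≤ ∫ x, ψ x ^ p * shiftedPow ε (2 - p) (v t x) := fun t =>
      integral_nonneg fun x => mul_nonneg (hζ0 x) (shiftedPow_pos hε _ _).le
    have hpt : ∀ t, 1 / (p - 2) * (deriv η t * ∫ x, ψ x ^ p * shiftedPow ε (2 - p) (v t x)) ≤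
        c * (η t * ∫ x, ψ x ^ p * shiftedPow ε (1 - p) (v t x)) +
          (Ioo 0 T).indicator (fun _ => a * (a / c) ^ (p - 2) * ∫ x, ψ x ^ p) t := by
      intro t
      by_cases ht : t ∈ Ioo 0 T
      · rw [indicator_of_mem ht]
        have hd : deriv η t = k * θ t ^ (k - 1) * deriv θ t :=
          ((hθ.differentiable (by simp) t).hasDerivAt.pow k).deriv
        have q1 : 1 / (p - 2) * deriv η t ≤ a * θ t ^ (k - 1) := by
          rw [hd, ha]
          have := mul_le_mul_of_nonneg_left ((le_abs_self _).trans (hD t))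
            (show 0 ≤ 1 / (p - 2) * (k * θ t ^ (k - 1)) by have := hθ0 t; positivity)
          refine le_trans (le_of_eq (by ring)) (this.trans (le_of_eq (by ring)))
        rw [← mul_assoc]
        refine (mul_le_mul_of_nonneg_right q1 (hY0 t)).trans ?_
        rw [← mul_assoc, ← integral_const_mul, ← integral_const_mul, ← integral_const_mul,
          ← integral_add ((hsp (by linarith) t).const_mul _) (hζi.const_mul _)]
        refine integral_mono ((hsp (by linarith) t).const_mul _)
          (((hsp (by linarith) t).const_mul _).add (hζi.const_mul _)) fun x => ?_
        have hx : 0 < ε + v t x := by linarith [h.nonneg_v t x]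
        have := mul_le_mul_of_nonneg_left
          (absorption hp ha0 hc0 (hθ0 t) (hθ1 t) hx hk) (hζ0 x)
        simp only [shiftedPow_of_nonneg _ (h.nonneg_v t x), hη]
        linarith
      · have h1 : η t = 0 := image_eq_zero_of_notMem_tsupport fun h' => ht (hθT (hηs h'))
        have h2 : deriv η t = 0 := image_eq_zero_of_notMem_tsupport fun h' =>
          ht (hθT (hηs (tsupport_deriv_subset h')))
        simp [h1, h2, indicator_of_notMem ht]
    refine integral_mono ?_ ((hXi.const_mul c).add j₁) hpt
    refine Integrable.const_mul (Integrable.mul_bdd (c := ∫ x, ψ x ^ p * ε ^ (2 - p))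
      ((hηC.continuous_deriv le_rfl).integrable_of_hasCompactSupport hηc.deriv)
      hYm.aestronglyMeasurable (.of_forall fun t => ?_)) _
    rw [Real.norm_of_nonneg (hY0 t)]
    exact integral_mono (hsp (by linarith) t) (hζi.mul_const _) fun x =>
      mul_le_mul_of_nonneg_left ((le_abs_self _).trans (abs_shiftedPow_le hε (by linarith) _))
        (hζ0 x)
  set Q : ℝ × E N → ℝ := fun z =>
    θ z.1 ^ k * (ψ z.2 ^ p * (shiftedPow ε (1 - p) (v z.1 z.2) * (f z.1 z.2 + c))) with hQ
  have hQe : Q = fun z => f z.1 z.2 * (η z.1 * (ψ z.2 ^ p * shiftedPow ε (1 - p) (v z.1 z.2))) +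
      c * (η z.1 * (ψ z.2 ^ p * shiftedPow ε (1 - p) (v z.1 z.2))) := by
    ext z; simp only [hQ, hη]; ring
  have hQ0 : ∀ z, 0 ≤ Q z := fun z => mul_nonneg (hη0 _) (mul_nonneg (hζ0 _)
    (mul_nonneg (shiftedPow_pos hε _ _).le (add_nonneg (h.nonneg_f _ _) hc0.le)))
  have hQi : Integrable Q := by rw [hQe]; exact i₁.add (i₂.const_mul c)
  rw [← ofReal_integral_eq_lintegral_ofReal hQi (.of_forall hQ0)]
  refine ENNReal.ofReal_le_ofReal ?_
  have e₁ : ∫ z : ℝ × E N, f z.1 z.2 * (η z.1 * (ψ z.2 ^ p * shiftedPow ε (1 - p) (v z.1 z.2))) =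
      ∫ t, η t * ∫ x, f t x * (ψ x ^ p * shiftedPow ε (1 - p) (v t x)) := by
    rw [Measure.volume_eq_prod, integral_prod _ i₁]
    refine integral_congr_ae (.of_forall fun t => ?_)
    simp only [← integral_const_mul]
    congr 1; ext x; ring
  have e₂ : ∫ z : ℝ × E N, η z.1 * (ψ z.2 ^ p * shiftedPow ε (1 - p) (v z.1 z.2)) =
      ∫ t, η t * ∫ x, ψ x ^ p * shiftedPow ε (1 - p) (v t x) := by
    rw [Measure.volume_eq_prod, integral_prod _ i₂]
    simp only [integral_const_mul]
  rw [hQe, integral_add i₁ (i₂.const_mul c), integral_const_mul, e₁, e₂]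
  -- The gain is exactly `2 c`: one `c` absorbs the time term, the other accompanies `f`. This
  -- explains the `4` in the definition of `c`.
  have e₃ : (1 / 2 : ℝ) ^ (p - 1) / R ^ ((N : ℝ) + p * s) * m / 2 = 2 * c := by rw [hc]; ring
  rw [e₃] at k₁
  linarith

end

/-! ### Passage to the limit -/

theorem tendsto_shiftedPow_atTop {p : ℝ} (hp : 2 < p) {ε v : ℕ → ℝ} (hε : ∀ n, 0 < ε n)
    (hε0 : Tendsto ε atTop (𝓝 0)) (hv0 : ∀ n, 0 ≤ v n) (hv : Tendsto v atTop (𝓝 0)) :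
    Tendsto (fun n => shiftedPow (ε n) (1 - p) (v n)) atTop atTop := by
  have h1 : Tendsto (fun n => (ε n + v n) ^ (p - 1)) atTop (𝓝[>] 0) := by
    refine tendsto_nhdsWithin_iff.2 ⟨?_, .of_forall fun n =>
      Real.rpow_pos_of_pos (by linarith [hε n, hv0 n]) _⟩
    have := (hε0.add hv).rpow_const (p := p - 1) (.inr (by linarith))
    rwa [add_zero, Real.zero_rpow (by linarith)] at this
  refine (tendsto_inv_nhdsGT_zero.comp h1).congr fun n => ?_
  rw [Function.comp_apply, shiftedPow_of_nonneg _ (hv0 n),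
    ← Real.rpow_neg (by linarith [hε n, hv0 n]), neg_sub]

/-- For `r > 0` the products converge and the surplus `c` is harmless. For `r = 0` the quotient of
`f` by the power of `v` is of type `0/0`, and it is the surplus `c > 0` that makes the sequence tend
to `+∞`. -/
theorem le_liminf_shiftedPow {p lam c b r d : ℝ} (hp : 2 < p) (hb : 0 < b) (hc : 0 < c)
    {ε v f : ℕ → ℝ} (hε : ∀ n, 0 < ε n) (hε0 : Tendsto ε atTop (𝓝 0)) (hv0 : ∀ n, 0 ≤ v n)
    (hf0 : ∀ n, 0 ≤ f n) (hr : 0 ≤ r) (hv : Tendsto v atTop (𝓝 r))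
    (hf : Tendsto f atTop (𝓝 (lam * r ^ (p - 1) / d))) :
    ENNReal.ofReal (b * (lam / d)) ≤
      liminf (fun n => ENNReal.ofReal (b * (shiftedPow (ε n) (1 - p) (v n) * (f n + c)))) atTop := by
  rcases hr.eq_or_lt with rfl | hr
  · have h1 := (tendsto_shiftedPow_atTop hp hε hε0 hv0 hv).atTop_mul_const hc
    have h2 : Tendsto (fun n => b * (shiftedPow (ε n) (1 - p) (v n) * (f n + c))) atTop atTop := by
      refine Tendsto.const_mul_atTop hb (tendsto_atTop_mono (fun n => ?_) h1)
      exact mul_le_mul_of_nonneg_left (by linarith [hf0 n]) (shiftedPow_pos (hε n) _ _).le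
    refine le_liminf_of_le (by isBoundedDefault) ?_
    filter_upwards [h2.eventually_ge_atTop (b * (lam / d))] with n hn
    exact ENNReal.ofReal_le_ofReal hn
  · have h1 : Tendsto (fun n => shiftedPow (ε n) (1 - p) (v n)) atTop (𝓝 (r ^ (1 - p))) := by
      have := (hε0.add hv).rpow_const (p := 1 - p) (.inl (by linarith))
      rw [zero_add] at this
      refine this.congr fun n => ?_
      rw [shiftedPow_of_nonneg _ (hv0 n)]
    have h2 := ENNReal.tendsto_ofReal ((h1.mul (hf.add_const c)).const_mul b)
    rw [h2.liminf_eq]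
    refine ENNReal.ofReal_le_ofReal (mul_le_mul_of_nonneg_left ?_ hb.le)
    have e : r ^ (1 - p) * (lam * r ^ (p - 1) / d + c) =
        lam / d * (r ^ (1 - p) * r ^ (p - 1)) + r ^ (1 - p) * c := by ring
    rw [e, ← Real.rpow_add hr, show 1 - p + (p - 1) = 0 by ring, Real.rpow_zero, mul_one]
    have := Real.rpow_pos_of_pos hr (1 - p)
    have : 0 < r ^ (1 - p) * c := by positivity
    linarith

theorem exists_time_cutoff {t₀ : ℝ} (ht₀ : 0 < t₀) :
    ∃ θ : ℝ → ℝ, ContDiff ℝ ∞ θ ∧ HasCompactSupport θ ∧ tsupport θ ⊆ Ioo 0 t₀ ∧ (∀ t, 0 ≤ θ t) ∧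
      (∀ t, θ t ≤ 1) ∧ ∃ t, θ t ≠ 0 := by
  let ρ : ContDiffBump (t₀ / 2) := ⟨t₀ / 8, t₀ / 4, by positivity, by linarith⟩
  refine ⟨ρ, ρ.contDiff, ρ.hasCompactSupport, ?_, fun t => ρ.nonneg, fun t => ρ.le_one, t₀ / 2, ?_⟩
  · rw [ρ.tsupport_eq, Real.closedBall_eq_Icc]
    intro t ht
    have h1 : t₀ / 2 - t₀ / 4 ≤ t := ht.1
    have h2 : t ≤ t₀ / 2 + t₀ / 4 := ht.2
    exact ⟨by linarith, by linarith⟩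
  · rw [ρ.one_of_mem_closedBall (Metric.mem_closedBall_self ρ.rIn_pos.le)]
    exact one_ne_zero

variable {N : ℕ} {p s T : ℝ} {Ω : Set (E N)}

theorem ofReal_integral_dq_rpow (hN : 1 < N) (hp : 2 < p) (hs0 : 0 < s) (hs1 : s < 1)
    {ψ : E N → ℝ} {K : NNReal} (hψ : LipschitzWith K ψ) (hψc : HasCompactSupport ψ) :
    ENNReal.ofReal (∫ z, |dq p s ψ z| ^ p) =
      ∫⁻ x, ∫⁻ y, ENNReal.ofReal (|ψ x - ψ y| ^ p / ‖x - y‖ ^ ((N : ℝ) + p * s)) := by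
  have hp0 : 0 < p := by linarith
  obtain ⟨R, hR⟩ := exists_radius hψc
  have hd := memLp_dq_of_lipschitz hN hp hs0 hs1 hψ hR
  have hm := measurable_dq (p := p) (s := s) hψ.continuous.measurable
  have hi : Integrable fun z => |dq p s ψ z| ^ p := by
    have := hd.integrable_norm_rpow (by simpa using hp0) ENNReal.ofReal_ne_top
    simpa [ENNReal.toReal_ofReal hp0.le] using this
  rw [ofReal_integral_eq_lintegral_ofReal hi (.of_forall fun z => by positivity),
    Measure.volume_eq_prod, lintegral_prod _ (by fun_prop)]
  simp only [abs_dq_rpow hp]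

/-- The weighted inequality forced by the existence of a solution, for functions supported near
the origin. -/
theorem exists_hardy_inequality (hN : 1 < N) (hp : 2 < p) (hs0 : 0 < s) (hs1 : s < 1)
    (hΩ : IsOpen Ω) (hΩb : Bornology.IsBounded Ω) (hΩ0 : (0 : E N) ∈ Ω) (hT : 0 < T)
    {lam : ℝ} (hlam : 0 ≤ lam) {u₀ : E N → ℝ} (hu₀ : IntegrableOn u₀ Ω)
    (hu₀0 : ∀ᵐ x ∂(volume.restrict Ω), 0 ≤ u₀ x)
    (hne : ¬ ∀ᵐ x ∂(volume.restrict Ω), u₀ x = 0) {u : ℝ → E N → ℝ}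
    (hu : IsSOLA p s lam T Ω u₀ u) :
    ∃ r > 0, ∃ C : ℝ, ∀ ψ : E N → ℝ, (∃ K, LipschitzWith K ψ) → (∀ x, 0 ≤ ψ x) →
      (∀ x, r ≤ ‖x‖ → ψ x = 0) →
      ENNReal.ofReal lam * ∫⁻ x, ENNReal.ofReal (ψ x ^ p / ‖x‖ ^ (p * s)) ≤
        (∫⁻ x, ∫⁻ y, ENNReal.ofReal (|ψ x - ψ y| ^ p / ‖x - y‖ ^ ((N : ℝ) + p * s))) / 2 +
          ENNReal.ofReal C * ∫⁻ x, ENNReal.ofReal (ψ x ^ p) := by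
  have hp0 : 0 < p := by linarith
  have hp2 : 0 < p - 2 := by linarith
  obtain ⟨f, g, un, hf, hf0, hg, -, hsol, hun0, hgu, hlimu, hlimf⟩ := hu.approx
  choose f' v S hreg hvu hvae hfae using fun n =>
    (hsol n).exists_regSol hN hp hs0 hs1 hΩ (hun0 n) (hf n) (hf0 n)
  obtain ⟨F, hFc, hFs, t₀, ht₀, ht₀T, m, hm0, n₀, hmass⟩ := exists_uniform_mass hN hp hs0 hs1 hΩ hΩb
    hT hu₀ hu₀0 hne hg hgu hsol hreg hvu
  have hFΩ : F ⊆ Ω := hFs.trans sdiff_subset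
  -- A ball around the origin inside `Ω` and disjoint from `F`; this is where `0 ∈ Ω` enters.
  obtain ⟨r, hr0, hr⟩ := Metric.isOpen_iff.1 (hΩ.sdiff hFc.isClosed) 0
    ⟨hΩ0, fun h => (hFs h).2 rfl⟩
  obtain ⟨θ, hθ, hθc, hθs, hθ0, hθ1, t₁, ht₁⟩ := exists_time_cutoff ht₀
  have hθT : tsupport θ ⊆ Ioo 0 T := hθs.trans (Ioo_subset_Ioo_right ht₀T)
  have hθC : ContDiff ℝ 1 θ := hθ.of_le (by simp)
  obtain ⟨D, hD⟩ := hθc.deriv.exists_bound_of_continuous (hθC.continuous_deriv le_rfl)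
  obtain ⟨k, hk⟩ := exists_nat_ge (p - 1)
  have hk0 : k ≠ 0 := by
    rintro rfl
    rw [Nat.cast_zero] at hk
    linarith
  obtain ⟨R₁, hR₁⟩ := hFc.isBounded.subset_closedBall 0
  set R := r + |R₁| with hR
  have hR0 : 0 < R := by positivity
  set c := (1 / 2 : ℝ) ^ (p - 1) / R ^ ((N : ℝ) + p * s) * m / 4 with hc
  have hc0 : 0 < c := by positivity
  set a := k * D / (p - 2) with ha
  have hD0 : 0 ≤ D := (norm_nonneg _).trans (hD 0)
  have ha0 : 0 ≤ a := by positivity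
  set e := ∫ t, θ t ^ k with he
  have he0 : 0 < e := by
    refine (hθ.continuous.pow k).integral_pos_of_hasCompactSupport_nonneg_nonzero ?_
      (fun t => pow_nonneg (hθ0 t) k) (pow_ne_zero k ht₁)
    refine hθc.of_isClosed_subset (isClosed_tsupport _) (closure_mono fun x hx h' => hx ?_)
    simp [show θ x = 0 from h', hk0]
  have hθi : Integrable fun t => θ t ^ k := by
    by_contra h
    rw [he, integral_undef h] at he0
    exact lt_irrefl _ he0
  -- Half the radius puts the closed support of `ψ` inside the open ball. The constant is the
  -- absorption error divided by `e = ∫ θ ^ k`; neither depends on `ψ`.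
  refine ⟨r / 2, by positivity, a * (a / c) ^ (p - 2) * T / e, fun ψ ⟨K, hψ⟩ hψ0 hψr => ?_⟩
  have hψball : tsupport ψ ⊆ Metric.closedBall 0 (r / 2) := by
    refine closure_minimal (fun x hx => ?_) Metric.isClosed_closedBall
    rw [mem_closedBall_zero_iff]
    by_contra! h
    exact hx (hψr x h.le)
  have hψball' : tsupport ψ ⊆ Metric.ball 0 r :=
    hψball.trans (Metric.closedBall_subset_ball (by linarith))
  have hψc : HasCompactSupport ψ :=
    (isCompact_closedBall _ _).of_isClosed_subset (isClosed_tsupport _) hψball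
  have hψΩ : tsupport ψ ⊆ Ω := fun x hx => (hr (hψball' hx)).1
  have hψF : ∀ x ∈ F, ψ x = 0 := fun x hx =>
    image_eq_zero_of_notMem_tsupport fun h => (hr (hψball' h)).2 hx
  have hψR : ∀ x y, ψ x ≠ 0 → y ∈ F → ‖x - y‖ ≤ R := by
    intro x y hx hy
    have h1 := mem_ball_zero_iff.1 (hψball' (subset_tsupport _ hx))
    have h2 := mem_closedBall_zero_iff.1 (hR₁ hy)
    have h3 := norm_sub_le x y
    have h4 := le_abs_self R₁
    linarith
  obtain ⟨L, hζ⟩ := exists_lipschitz_rpow hψ hψc hψ0 (p := p) (by linarith)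
  have hζc : HasCompactSupport fun x => ψ x ^ p :=
    hψc.of_isClosed_subset (isClosed_tsupport _) (tsupport_rpow_subset (p := p) ψ hp0)
  have hζ0 : ∀ x, 0 ≤ ψ x ^ p := fun x => Real.rpow_nonneg (hψ0 x) _
  have hζi : Integrable fun x => ψ x ^ p := hζ.continuous.integrable_of_hasCompactSupport hζc
  set A := ∫ z, |dq p s ψ z| ^ p with hA
  have hA0 : 0 ≤ A := integral_nonneg fun z => by positivity
  set Z := ∫ x, ψ x ^ p with hZ
  have hZ0 : 0 ≤ Z := integral_nonneg hζ0
  set ε : ℕ → ℝ := fun n => 1 / ((n : ℝ) + 1) with hε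
  have hεpos : ∀ n, 0 < ε n := fun n => by positivity
  have hε0 : Tendsto ε atTop (𝓝 0) := tendsto_one_div_add_atTop_nhds_zero_nat
  set Q : ℕ → ℝ × E N → ℝ≥0∞ := fun n z => ENNReal.ofReal (θ z.1 ^ k *
    (ψ z.2 ^ p * (shiftedPow (ε n) (1 - p) (v n z.1 z.2) * (f' n z.1 z.2 + c)))) with hQ
  have hbound : ∀ n ≥ n₀, ∫⁻ z, Q n z ≤
      ENNReal.ofReal ((1 / 2) * A * e + a * (a / c) ^ (p - 2) * T * Z) := by
    intro n hn
    refine (hreg n).lintegral_le hN hp hs0 hs1 hΩ hΩb hT hψ hψc hψΩ hψ0 (hεpos n)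
      hFc.isClosed.measurableSet hFΩ hψF hR0 hψR hθC hθc hθT hθ0 hθ1 hD hk hm0 ?_ rfl rfl
    have s1 : ∀ᵐ t, t ∈ Ioo 0 T → t ∈ S n := (ae_restrict_iff' measurableSet_Ioo).1 (hreg n).ae_S
    filter_upwards [s1] with t ht hθt
    have htm := subset_tsupport _ hθt
    exact hmass n hn t (ht (hθT htm)) (hθs htm).2
  have hQm : ∀ n, Measurable (Q n) := by
    intro n
    have h1 : Measurable fun z : ℝ × E N => shiftedPow (ε n) (1 - p) (v n z.1 z.2) :=
      (measurable_shiftedPow (hεpos n) (by linarith)).comp (hreg n).measurable_v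
    have h2 : Measurable fun z : ℝ × E N => f' n z.1 z.2 := (hreg n).measurable_f
    have h3 : Measurable fun z : ℝ × E N => θ z.1 ^ k :=
      (hθ.continuous.pow k).measurable.comp measurable_fst
    have h4 : Measurable fun z : ℝ × E N => ψ z.2 ^ p :=
      hζ.continuous.measurable.comp measurable_snd
    exact (h3.mul (h4.mul (h1.mul (h2.add_const c)))).ennreal_ofReal
  -- Fatou's lemma requires no integral convergence of the sources, which is why a.e. convergence
  -- suffices in the notion of SOLA. The shift `ε n` tends to zero along the same sequence.
  have hfatou : ∫⁻ z, liminf (fun n => Q n z) atTop ≤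
      ENNReal.ofReal ((1 / 2) * A * e + a * (a / c) ^ (p - 2) * T * Z) := by
    refine (lintegral_liminf_le hQm).trans ?_
    refine liminf_le_of_frequently_le' (Eventually.frequently ?_)
    filter_upwards [eventually_ge_atTop n₀] with n hn
    exact hbound n hn
  have hpt : ∀ᵐ z : ℝ × E N, ENNReal.ofReal (θ z.1 ^ k * (lam * (ψ z.2 ^ p / ‖z.2‖ ^ (p * s)))) ≤
      liminf (fun n => Q n z) atTop := by
    have hQset : MeasurableSet (Ioo 0 T ×ˢ Ω) := measurableSet_Ioo.prod hΩ.measurableSet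
    have a1 := (ae_restrict_iff' hQset).1 (hlimu.and hlimf)
    have a2 := (ae_restrict_iff' hQset).1 ((ae_all_iff.2 hvae).and (ae_all_iff.2 hfae))
    have a3 := (ae_restrict_iff' (measurableSet_Ioo.prod MeasurableSet.univ)).1 hu.nonneg
    filter_upwards [a1, a2, a3] with z h1 h2 h3
    by_cases hθz : θ z.1 = 0
    · simp [hθz, hk0]
    by_cases hψz : ψ z.2 = 0
    · simp [hψz, Real.zero_rpow hp0.ne']
    have hz : z ∈ Ioo 0 T ×ˢ Ω :=
      ⟨hθT (subset_tsupport _ hθz), hψΩ (subset_tsupport _ hψz)⟩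
    obtain ⟨hu1, hf1⟩ := h1 hz
    obtain ⟨hv2, hf2⟩ := h2 hz
    have hb : 0 < θ z.1 ^ k * ψ z.2 ^ p :=
      mul_pos (pow_pos (lt_of_le_of_ne (hθ0 _) (Ne.symm hθz)) k)
        (Real.rpow_pos_of_pos (lt_of_le_of_ne (hψ0 _) (Ne.symm hψz)) p)
    have := le_liminf_shiftedPow (d := ‖z.2‖ ^ (p * s)) hp hb hc0 hεpos hε0
      (fun n => (hreg n).nonneg_v z.1 z.2) (fun n => (hreg n).nonneg_f z.1 z.2)
      (h3 ⟨hz.1, mem_univ _⟩) (hu1.congr fun n => (hv2 n).symm) (hf1.congr fun n => (hf2 n).symm)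
    refine le_trans (le_of_eq ?_) (this.trans (le_of_eq ?_))
    · congr 1; ring
    · simp only [hQ, mul_assoc]
  have hmain := (lintegral_mono_ae hpt).trans hfatou
  have hθm : Measurable fun t => ENNReal.ofReal (θ t ^ k) :=
    (hθ.continuous.pow k).measurable.ennreal_ofReal
  have hζm : Measurable fun x => ENNReal.ofReal (ψ x ^ p / ‖x‖ ^ (p * s)) := by
    have := hζ.continuous.measurable
    exact (this.div (by fun_prop)).ennreal_ofReal
  have e1 : ∫⁻ z : ℝ × E N, ENNReal.ofReal (θ z.1 ^ k * (lam * (ψ z.2 ^ p / ‖z.2‖ ^ (p * s)))) =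
      ENNReal.ofReal e * (ENNReal.ofReal lam *
        ∫⁻ x, ENNReal.ofReal (ψ x ^ p / ‖x‖ ^ (p * s))) := by
    rw [he, ofReal_integral_eq_lintegral_ofReal hθi (.of_forall fun t => pow_nonneg (hθ0 t) k),
      ← lintegral_const_mul _ hζm, Measure.volume_eq_prod,
      ← lintegral_prod_mul hθm.aemeasurable (hζm.const_mul _).aemeasurable]
    refine lintegral_congr fun z => ?_
    rw [ENNReal.ofReal_mul (pow_nonneg (hθ0 _) k), ENNReal.ofReal_mul hlam]
  have e2 : ENNReal.ofReal ((1 / 2) * A * e + a * (a / c) ^ (p - 2) * T * Z) =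
      ENNReal.ofReal e * ((∫⁻ x, ∫⁻ y,
        ENNReal.ofReal (|ψ x - ψ y| ^ p / ‖x - y‖ ^ ((N : ℝ) + p * s))) / 2 +
          ENNReal.ofReal (a * (a / c) ^ (p - 2) * T / e) * ∫⁻ x, ENNReal.ofReal (ψ x ^ p)) := by
    rw [← ofReal_integral_dq_rpow hN hp hs0 hs1 hψ hψc, ← hA,
      ← ofReal_integral_eq_lintegral_ofReal hζi (.of_forall hζ0), ← hZ,
      ← ENNReal.ofReal_mul (by positivity), show (2 : ℝ≥0∞) = ENNReal.ofReal 2 by simp,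
      ← ENNReal.ofReal_div_of_pos two_pos, ← ENNReal.ofReal_add (by positivity) (by positivity),
      ← ENNReal.ofReal_mul he0.le]
    congr 1
    field_simp
  rw [e1, e2] at hmain
  exact (ENNReal.mul_le_mul_iff_right (by simpa using he0) ENNReal.ofReal_ne_top).1 hmain

end FracHardy

/-! ### The contradiction -/

theorem mainTheorem1 {N : ℕ} (hN : 1 < N) (p s : ℝ) (hp : 2 < p) (hs0 : 0 < s) (hs1 : s < 1)
    (hps : p * s < (N : ℝ))
    (Ω : Set (FracHardy.E N)) (hΩ_open : IsOpen Ω) (hΩ_conn : IsConnected Ω)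
    (hΩ_bdd : Bornology.IsBounded Ω) (hΩ_zero : (0 : FracHardy.E N) ∈ Ω)
    (lam : ℝ) (hlam : FracHardy.hardyConstant hN p s < lam)
    (u₀ : FracHardy.E N → ℝ) (hu₀ : IntegrableOn u₀ Ω volume)
    (hu₀_nonneg : ∀ᵐ x ∂(volume.restrict Ω), 0 ≤ u₀ x)
    (hu₀_ne : ¬ ∀ᵐ x ∂(volume.restrict Ω), u₀ x = 0)
    (T : ℝ) (hT : 0 < T) :
    ¬ ∃ u : ℝ → FracHardy.E N → ℝ, FracHardy.IsSOLA p s lam T Ω u₀ u := by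
  rintro ⟨u, hu⟩
  have hlam0 : 0 ≤ lam := (FracHardy.hardyConstant_nonneg hN p s).trans hlam.le
  obtain ⟨r, hr, C, hC⟩ := FracHardy.exists_hardy_inequality hN hp hs0 hs1 hΩ_open hΩ_bdd hΩ_zero hT
    hlam0 hu₀ hu₀_nonneg hu₀_ne hu
  obtain ⟨ψ, hψ, hψ0, hψr, hlt⟩ := FracHardy.exists_hardy_quotient_lt hN hp hs0 hs1 hps hlam C hr
  exact (hC ψ hψ hψ0 hψr).not_gt hlt
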